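/- Let $d\ge 1$, $T>0$, and let $(\Omega,\mathcal A,\mathbb P)$ be a complete probability space. For $n\ge 1$ let $\mu_n$ be a non-negative tempered measure on $\mathbb R^d$ and let $W^n=\{W^n(\varphi)\}$ be a centred Gaussian process indexed by the real test functions $\varphi\in\mathcal C_0^\infty([0,\infty)\times\mathbb R^d)$ with covariance $$\mathbb E[W^n(\varphi)W^n(\psi)]=\int_0^\infty\!\int_{\mathbb R^d}\mathcal F\varphi(t,\cdot)(\xi)\,\overline{\mathcal F\psi(t,\cdot)(\xi)}\,\mu_n(d\xi)\,dt,\qquad \mathcal Ff(\xi)=\int_{\mathbb R^d}e^{-i\langle\xi,x\rangle}f(x)\,dx .$$ Extend $W^n$ by isometry to the completion of the test functions with respect to this inner product (Wiener integral). Assume **(H1)** there exists $q\in(0,2)$ such that $\displaystyle\sup_{n\ge1}\int_{\mathbb R^d}\frac{\mu_n(d\xi)}{1+|\xi|^q}<\infty$. Let $b:\mathbb R\to\mathbb R$ be globally Lipschitz, and let $u_0:\mathbb R^d\to\mathbb R$ be bounded and $\alpha$-Hölder continuous for some $\alpha\in(0,1)$. Let $G_t(x)=(2\pi t)^{-d/2}e^{-|x|^2/(2t)}$.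 For every $n$, let $u^n$ be the mild solution on $[0,T]\times\mathbb R^d$ of the stochastic heat equation $\partial_t u^n-\tfrac12\Delta u^n=b(u^n)+\dot W^n$, $u^n(0,\cdot)=u_0$; that is, $u^n$ is a jointly measurable, $L^2(\Omega)$-continuous process, adapted to the filtration generated by $W^n$ and the null sets, with $\sup_{(t,x)\in[0,T]\times\mathbb R^d}\mathbb E|u^n(t,x)|^2<\infty$, and for all $(t,x)\in[0,T]\times\mathbb R^d$, $\mathbb P$-a.s., $$u^n(t,x)=(u_0*G_t)(x)+\int_0^t\!\int_{\mathbb R^d}G_{t-s}(x-y)\,W^n(ds,dy)+\int_0^t\big(b(u^n(s,\cdot))*G_{t-s}\big)(x)\,ds,$$ where $(u_0*G_t)(x)$ is read as $u_0(x)$ for $t=0$. Then every $u^n$ has a version with continuous paths, and the laws of these versions, $n\ge1$, form a tight family of probability measures on $\mathcal C([0,T]\times\mathbb R^d)$ endowed with the topology of uniform convergence on compact sets. -/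

import Mathlib

open MeasureTheory ProbabilityTheory Set Filter Topology
open scoped ENNReal NNReal Distributions

noncomputable section

/-- Euclidean space `ℝ^d`. -/
abbrev Space (d : ℕ) : Type := EuclideanSpace ℝ (Fin d)

/-- Real test functions on `[0,∞) × ℝ^d` (smooth up to time `0`, compactly supported). They are
represented by their smooth compactly supported extensions to `ℝ × ℝ^d`; everything below looks
only at times `s > 0`, so the choice of the extension is immaterial. -/
abbrev SpaceTimeTest (d : ℕ) : Type := 𝓓((⊤ : TopologicalSpace.Opens (ℝ × Space d)), ℝ)

/-- `ℱ f (ξ) = ∫ e^{-i⟨ξ,x⟩} f(x) dx`. -/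
def fourierL1 {d : ℕ} (f : Space d → ℝ) (ξ : Space d) : ℂ :=
  ∫ x, Complex.exp (-(Complex.I * ((inner ℝ ξ x : ℝ) : ℂ))) * ((f x : ℝ) : ℂ)

/-- The Gaussian kernel `G_t(x) = (2πt)^{-d/2} exp(-|x|²/(2t))`, the fundamental solution of
`∂_t - Δ/2` (used for `t > 0` only). -/
def heatKernel {d : ℕ} (t : ℝ) (x : Space d) : ℝ :=
  (2 * Real.pi * t) ^ (-(d : ℝ) / 2) * Real.exp (-(‖x‖ ^ 2) / (2 * t))

/-- The solution of the deterministic linear heat equation: `(u₀ * G_t)(x)` for `t > 0`, and the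
initial value `u₀(x)` at time `0`. -/
def heatInitial {d : ℕ} (u₀ : Space d → ℝ) (t : ℝ) (x : Space d) : ℝ :=
  if t = 0 then u₀ x else ∫ y, u₀ y * heatKernel t (x - y)

/-- The integrand `(s,y) ↦ 1_{s < t} G_{t-s}(x-y)` of the stochastic convolution. -/
def heatIntegrand {d : ℕ} (t : ℝ) (x : Space d) (s : ℝ) (y : Space d) : ℝ :=
  if s < t then heatKernel (t - s) (x - y) else 0

section Noise

variable {d : ℕ} {Ω : Type*} [MeasurableSpace Ω]

/-- `W` is a spatially homogeneous Gaussian noise, white in time, with spectral measure `μ`: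
a centred Gaussian process indexed by the test functions with
`E[W(φ)W(ψ)] = ∫_0^∞ ∫ ℱφ(s,·)(ξ) conj(ℱψ(s,·)(ξ)) μ(dξ) ds`, where `μ` is tempered. -/
structure IsHomogeneousNoise (P : Measure Ω) (μ : Measure (Space d))
    (W : SpaceTimeTest d → Ω → ℝ) : Prop where
  tempered : μ.HasTemperateGrowth
  gaussian : IsGaussianProcess W P
  centered : ∀ φ, ∫ ω, W φ ω ∂P = 0
  covariance : ∀ φ ψ, ((∫ ω, W φ ω * W ψ ω ∂P : ℝ) : ℂ) =
    ∫ s in Ioi (0 : ℝ), ∫ ξ, fourierL1 (fun y => φ (s, y)) ξ *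
      (starRingEnd ℂ) (fourierL1 (fun y => ψ (s, y)) ξ) ∂μ

/-- `I` is (a version of) the Wiener integral `∫_0^∞ ∫ g(s,y) W(ds,dy)`. The integrand is an element
of the completion of the test functions for the norm `E[W(φ)²]^{1/2}`, i.e. for the `L²(ds × μ(dξ))`
norm of the Fourier transform in space, and `I` is its image under the isometric extension of `W`:
there are test functions whose Fourier transforms in space tend to that of `g` in `L²(ds × μ(dξ))`
and whose images under `W` tend to `I` in `L²(P)`. This determines `I` up to a null set. -/
def IsWienerIntegral (P : Measure Ω) (μ : Measure (Space d)) (W : SpaceTimeTest d → Ω → ℝ)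
    (g : ℝ → Space d → ℝ) (I : Ω → ℝ) : Prop :=
  (∀ s, 0 < s → Integrable (g s)) ∧ MemLp I 2 P ∧
    ∃ φ : ℕ → SpaceTimeTest d,
      Tendsto (fun k => ∫⁻ s in Ioi (0 : ℝ), ∫⁻ ξ,
        ‖fourierL1 (fun y => φ k (s, y)) ξ - fourierL1 (g s) ξ‖ₑ ^ 2 ∂μ) atTop (𝓝 0) ∧
      Tendsto (fun k => eLpNorm (fun ω => W (φ k) ω - I ω) 2 P) atTop (𝓝 0)

/-- The filtration of the noise,
`ℱ_t = σ(W(1_{[0,s]} φ) : s ∈ [0,t], φ a test function) ∨ {null sets}`. -/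
@[reducible] def noiseFiltration (P : Measure Ω) (μ : Measure (Space d)) (W : SpaceTimeTest d → Ω → ℝ)
    (t : ℝ) : MeasurableSpace Ω :=
  MeasurableSpace.generateFrom
    ({A | ∃ s ∈ Icc 0 t, ∃ (φ : SpaceTimeTest d) (I : Ω → ℝ) (B : Set ℝ),
        IsWienerIntegral P μ W (fun r y => if r ∈ Icc 0 s then φ (r, y) else 0) I ∧
        MeasurableSet B ∧ A = I ⁻¹' B} ∪
      {A | MeasurableSet A ∧ P A = 0})

/-- `u` is the solution on `[0,T] × ℝ^d` of the stochastic heat equation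
`∂_t u - Δu/2 = b(u) + Ẇ`, `u(0,·) = u₀`: a jointly measurable, adapted, `L²(Ω)`-continuous process
with uniformly bounded second moments (the class in which the solution is unique) which
satisfies the mild equation at every `(t,x) ∈ [0,T] × ℝ^d`, almost surely. Only the values
`u t x` with `t ∈ [0,T]` matter. -/
structure IsMildHeatSolution (P : Measure Ω) (μ : Measure (Space d))
    (W : SpaceTimeTest d → Ω → ℝ) (b : ℝ → ℝ) (u₀ : Space d → ℝ) (T : ℝ)
    (u : ℝ → Space d → Ω → ℝ) : Prop where
  jointly_measurable :
    Measurable (fun p : (Icc (0 : ℝ) T) × Space d × Ω => u p.1 p.2.1 p.2.2)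
  adapted : ∀ t ∈ Icc 0 T, ∀ x, Measurable[noiseFiltration P μ W t] (u t x)
  l2_continuous : ∀ t ∈ Icc 0 T, ∀ x,
    Tendsto (fun p : ℝ × Space d => eLpNorm (fun ω => u p.1 p.2 ω - u t x ω) 2 P)
      (𝓝[Icc 0 T ×ˢ univ] (t, x)) (𝓝 0)
  bounded_moments : ∃ M : ℝ≥0, ∀ t ∈ Icc 0 T, ∀ x, eLpNorm (u t x) 2 P ≤ M
  mild : ∀ t ∈ Icc 0 T, ∀ x, ∃ I : Ω → ℝ,
    IsWienerIntegral P μ W (heatIntegrand t x) I ∧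
      ∀ᵐ ω ∂P, u t x ω = heatInitial u₀ t x + I ω +
        ∫ s in (0 : ℝ)..t, ∫ y, b (u s y ω) * heatKernel (t - s) (x - y)

end Noise

/-- The space `𝒞([0,T] × ℝ^d)`, with the topology of uniform convergence on compact sets
(the compact-open topology). -/
abbrev PathSpace (T : ℝ) (d : ℕ) : Type := C((Icc (0 : ℝ) T) × Space d, ℝ)

instance pathMeasurableSpace (T : ℝ) (d : ℕ) : MeasurableSpace (PathSpace T d) :=
  borel (PathSpace T d)

instance pathBorelSpace (T : ℝ) (d : ℕ) : BorelSpace (PathSpace T d) := ⟨rfl⟩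

/-- `U` is a version of the random field `u` with continuous paths, viewed as a random variable
with values in `𝒞([0,T] × ℝ^d)`. -/
structure IsContinuousVersion {d : ℕ} {Ω : Type*} [MeasurableSpace Ω] (P : Measure Ω) (T : ℝ)
    (u : ℝ → Space d → Ω → ℝ) (U : Ω → PathSpace T d) : Prop where
  measurable : Measurable U
  version : ∀ (t : Icc (0 : ℝ) T) (x : Space d), ∀ᵐ ω ∂P, U ω (t, x) = u t x ω

/-- The uniform integrability condition on the spectral measures: for some `q ∈ (0,2)`,
`sup_n ∫ μ_n(dξ) / (1 + |ξ|^q) < ∞`. -/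
def HypothesisH1 {d : ℕ} (μ : ℕ → Measure (Space d)) : Prop :=
  ∃ q : ℝ, 0 < q ∧ q < 2 ∧
    (⨆ n, ∫⁻ ξ, ENNReal.ofReal (1 / (1 + ‖ξ‖ ^ q)) ∂(μ n)) < ∞

end

/-! By Kolmogorov's criterion it suffices to bound `E|u^n(z)|` and `E|u^n(z) - u^n(z')|^p` by `D`
and `D^p |z-z'|^(pδ)`, with `D` independent of `n` and `pδ > 2(d+1)`.

Noise. The stochastic convolution is Gaussian, so its `L^p` norms are its `L²` norm times a constant
depending only on `p` (`IsWienerIntegral.eLpNorm_sub_le`). By isometry the `L²` norm is the norm of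
`e^{-i⟨ξ,x⟩} e^{-(t-s)|ξ|²/2}` in `L²(ds × μ_n(dξ))`. Integrating its square over time leaves at
most `min(t, |ξ|^{-2})`. Since `q < 2`, interpolation turns this into a multiple of `1/(1+|ξ|^q)`,
with a spare factor `|x-x'|^{2-q}` for space increments and `h^{(2-q)/2}` for time increments. (H1)
then makes every constant uniform in `n`.

Initial value. Its heat evolution is `α`-Hölder in space and `α/2`-Hölder in time
(`exists_heatInitial_holder`).

Drift. A change of variables moves a shift of `(t,x)` from the heat kernel to `u`. Increments `v` of
`u` thus satisfy `v ≤ w + L G ⋆ v`, with `w` controlled by the two previous points (and by the short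
piece of drift over `(0,h]`), and Gronwall applies. Gronwall needs a finite quantity to start from,
and no `L^p` bound with large `p` is known beforehand. So the argument is run on `E[Y v]` for
bounded `Y ≥ 0`, which is finite by the first moment bound; the resulting constant sees `Y` only
through its `L^r` norm, `1/p + 1/r = 1`, and duality gives back the `L^p` bound
(`DualBound.gronwall`, `DualBound.lintegral_rpow_le`).

Paths. Finiteness of the double integral `holderEnergy` forces a Hölder estimate, by chaining
averages over dyadic balls (`dist_limitAverage_le`). The limits of averages form a continuous
modification (`exists_continuous_modification`). Markov's inequality for the energies confines all
the laws, up to `ε`, to one set of functions with prescribed Hölder constants, compact by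
Arzelà–Ascoli (`isTightMeasureSet_of_moments`). -/

/-! ### Equivalence of moments for Gaussian variables. -/

section GaussianMoments

variable {Ω : Type*} [MeasurableSpace Ω] {P : Measure Ω}

/-- The ratio of the `L^p` and `L²` norms of a standard Gaussian variable. -/
noncomputable def gaussianMomentRatio (p : ℝ≥0) : ℝ≥0∞ :=
  eLpNorm id p (gaussianReal 0 1) / eLpNorm id 2 (gaussianReal 0 1)

lemma eLpNorm_two_standardGaussian_ne_zero : eLpNorm id 2 (gaussianReal 0 1) ≠ 0 := by
  intro h
  rw [eLpNorm_eq_zero_iff aestronglyMeasurable_id (by norm_num)] at h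
  have h1 : Var[id; gaussianReal 0 1] = Var[(0 : ℝ → ℝ); gaussianReal 0 1] := variance_congr h
  rw [variance_id_gaussianReal, variance_zero] at h1
  norm_num at h1

lemma gaussianMomentRatio_ne_top (p : ℝ≥0) : gaussianMomentRatio p ≠ ∞ :=
  ENNReal.div_ne_top (memLp_id_gaussianReal p).eLpNorm_ne_top eLpNorm_two_standardGaussian_ne_zero

/-- A centred Gaussian is in law a multiple `c` of a standard one, and all the norms scale by `|c|`.
-/
lemma eLpNorm_eq_of_hasGaussianLaw {X : Ω → ℝ} (hX : HasGaussianLaw X P)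
    (h0 : ∫ ω, X ω ∂P = 0) (p : ℝ≥0) :
    eLpNorm X p P = gaussianMomentRatio p * eLpNorm X 2 P := by
  set c : ℝ := Real.sqrt (Var[X; P].toNNReal) with hc
  have hmap : P.map X = (gaussianReal 0 1).map (fun x => c * x) := by
    rw [hX.map_eq_gaussianReal, h0, gaussianReal_map_const_mul]
    congr 1
    · simp
    · ext
      simp [hc]
  have key : ∀ r : ℝ≥0∞, eLpNorm X r P = ‖c‖ₑ * eLpNorm id r (gaussianReal 0 1) := by
    intro r
    have h1 : eLpNorm X r P = eLpNorm id r (P.map X) := by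
      rw [eLpNorm_map_measure aestronglyMeasurable_id hX.aemeasurable]; rfl
    rw [h1, hmap, eLpNorm_map_measure aestronglyMeasurable_id (by fun_prop),
      ← eLpNorm_const_smul]
    rfl
  rw [key p, key 2, gaussianMomentRatio, mul_left_comm, ENNReal.div_mul_cancel
    eLpNorm_two_standardGaussian_ne_zero]
  have : eLpNorm id 2 (gaussianReal 0 1) ≠ ∞ := by
    simpa using (memLp_id_gaussianReal (μ := 0) (v := 1) 2).eLpNorm_ne_top
  exact this

end GaussianMoments

/-! ### Fourier transforms in space and their decay for test functions. -/

section TestFunctions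

variable {d : ℕ}

lemma stronglyMeasurable_fourierL1 {X : Type*} [MeasurableSpace X] {g : X → Space d → ℝ}
    (hg : Measurable (Function.uncurry g)) :
    StronglyMeasurable fun p : X × Space d => fourierL1 (g p.1) p.2 := by
  unfold fourierL1
  have : Measurable (Function.uncurry fun (p : X × Space d) (x : Space d) =>
      Complex.exp (-(Complex.I * ((inner ℝ p.2 x : ℝ) : ℂ))) * ((g p.1 x : ℝ) : ℂ)) := by
    have h1 : Measurable fun p : (X × Space d) × Space d => g p.1.1 p.2 :=
      hg.comp ((measurable_fst.comp measurable_fst).prodMk measurable_snd)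
    have h2 : Measurable fun p : (X × Space d) × Space d => inner ℝ p.1.2 p.2 :=
      (measurable_snd.comp measurable_fst).inner measurable_snd
    exact ((Complex.measurable_ofReal.comp h2).const_mul _).neg.cexp.mul
      (Complex.measurable_ofReal.comp h1)
  exact this.stronglyMeasurable.integral_prod_right

lemma norm_fourierL1_le (f : Space d → ℝ) (ξ : Space d) : ‖fourierL1 f ξ‖ ≤ ∫ x, |f x| := by
  refine (norm_integral_le_integral_norm _).trans_eq ?_
  refine integral_congr_ae (ae_of_all _ fun x => ?_)
  have : -(Complex.I * ((inner ℝ ξ x : ℝ) : ℂ)) = ((-(inner ℝ ξ x) : ℝ) : ℂ) * Complex.I := by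
    push_cast; ring
  simp only [norm_mul, this, Complex.norm_exp_ofReal_mul_I, one_mul, Complex.norm_real,
    Real.norm_eq_abs]

lemma integrable_fourier_integrand {f : Space d → ℝ} (hf : Integrable f) (ξ : Space d) :
    Integrable fun x =>
      Complex.exp (-(Complex.I * ((inner ℝ ξ x : ℝ) : ℂ))) * ((f x : ℝ) : ℂ) := by
  refine (hf.ofReal (𝕜 := ℂ)).bdd_mul (c := 1) (by fun_prop) (ae_of_all _ fun x => ?_)
  have : -(Complex.I * ((inner ℝ ξ x : ℝ) : ℂ)) = ((-(inner ℝ ξ x) : ℝ) : ℂ) * Complex.I := by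
    push_cast; ring
  rw [this, Complex.norm_exp_ofReal_mul_I]

lemma fourierL1_sub {f g : Space d → ℝ} (hf : Integrable f) (hg : Integrable g) (ξ : Space d) :
    fourierL1 (fun x => f x - g x) ξ = fourierL1 f ξ - fourierL1 g ξ := by
  unfold fourierL1
  rw [← integral_sub (integrable_fourier_integrand hf ξ) (integrable_fourier_integrand hg ξ)]
  congr 1; ext x; push_cast; ring

lemma fourierL1_comp_add (f : Space d → ℝ) (h ξ : Space d) :
    fourierL1 (fun x => f (x + h)) ξ =
      Complex.exp (Complex.I * ((inner ℝ ξ h : ℝ) : ℂ)) * fourierL1 f ξ := by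
  unfold fourierL1
  rw [← integral_const_mul, ← integral_add_right_eq_self (fun x =>
    Complex.exp (Complex.I * ((inner ℝ ξ h : ℝ) : ℂ)) *
      (Complex.exp (-(Complex.I * ((inner ℝ ξ x : ℝ) : ℂ))) * ((f x : ℝ) : ℂ))) h]
  congr 1; ext x
  rw [← mul_assoc, ← Complex.exp_add, inner_add_right]
  congr 2; push_cast; ring

lemma SpaceTimeTest.exists_bounds (φ : SpaceTimeTest d) : ∃ R L : ℝ, 0 ≤ R ∧ 0 ≤ L ∧
    (∀ s x, φ (s, x) ≠ 0 → |s| ≤ R ∧ ‖x‖ ≤ R) ∧ (∀ s x, |φ (s, x)| ≤ L) ∧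
    ∀ s x y, |φ (s, x) - φ (s, y)| ≤ L * ‖x - y‖ := by
  obtain ⟨R, hR⟩ := φ.hasCompactSupport.isCompact.isBounded.subset_closedBall 0
  obtain ⟨C, hC⟩ := φ.contDiff.lipschitzWith_of_hasCompactSupport φ.hasCompactSupport (by simp)
  obtain ⟨M, hM⟩ := φ.hasCompactSupport.exists_bound_of_continuous φ.continuous
  refine ⟨max R 0, max C (max M 0), le_max_right _ _, by positivity, fun s x h => ?_, fun s x => ?_,
    fun s x y => ?_⟩
  · have h1 := hR (subset_tsupport _ h)
    rw [mem_closedBall_zero_iff, Prod.norm_def] at h1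
    exact ⟨((le_max_left _ _).trans h1).trans (le_max_left _ _),
      ((le_max_right _ _).trans h1).trans (le_max_left _ _)⟩
  · exact (hM (s, x)).trans ((le_max_left _ _).trans (le_max_right _ _))
  · have h1 := hC.dist_le_mul (s, x) (s, y)
    rw [Prod.dist_eq, dist_self, max_eq_right dist_nonneg, dist_eq_norm, dist_eq_norm] at h1
    exact h1.trans (mul_le_mul_of_nonneg_right (le_max_left _ _) (norm_nonneg _))

lemma SpaceTimeTest.continuous_slice (φ : SpaceTimeTest d) (s : ℝ) :
    Continuous fun x => φ (s, x) := φ.continuous.comp (by fun_prop)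

lemma SpaceTimeTest.integrable_slice (φ : SpaceTimeTest d) (s : ℝ) :
    Integrable fun x => φ (s, x) := by
  obtain ⟨R, L, hR, hL, h1, h2, h3⟩ := φ.exists_bounds
  refine (φ.continuous_slice s).integrable_of_hasCompactSupport ?_
  refine HasCompactSupport.of_support_subset_isCompact (isCompact_closedBall 0 R) fun x hx => ?_
  simpa using (h1 s x hx).2

/-- One power of decay in `ξ`, uniform in time, is enough: `(1+|ξ|²)⁻¹` is integrable for the
spectral measures, because `q < 2`. The Lipschitz constant of `φ` provides it. -/
lemma SpaceTimeTest.exists_fourier_bound (φ : SpaceTimeTest d) : ∃ R C : ℝ, 0 ≤ C ∧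
    (∀ s ξ, R < s → fourierL1 (fun y => φ (s, y)) ξ = 0) ∧
    (∀ s ξ, ‖fourierL1 (fun y => φ (s, y)) ξ‖ ≤ C) ∧
    ∀ s ξ, ‖ξ‖ * ‖fourierL1 (fun y => φ (s, y)) ξ‖ ≤ C := by
  obtain ⟨R, L, hR, hL, h1, h2, h3⟩ := φ.exists_bounds
  set V : ℝ := volume.real (Metric.closedBall (0 : Space d) R) with hV
  have hint : Integrable ((Metric.closedBall (0 : Space d) R).indicator fun _ => (1 : ℝ)) :=
    (integrable_indicator_iff measurableSet_closedBall).2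
      (integrableOn_const (measure_closedBall_lt_top.ne))
  have hval : ∫ x, (Metric.closedBall (0 : Space d) R).indicator (fun _ => (1 : ℝ)) x = V := by
    rw [integral_indicator_const _ measurableSet_closedBall]; simp [hV]
  have hV0 : 0 ≤ V := measureReal_nonneg
  have hπ := Real.pi_pos
  refine ⟨R, L * V * (1 + Real.pi), by positivity, fun s ξ hs => ?_, fun s ξ => ?_, fun s ξ => ?_⟩
  · have : (fun y => φ (s, y)) = fun _ => 0 := by
      ext y
      by_contra h
      have := (h1 s y h).1
      rw [abs_le] at this
      linarith
    rw [this]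
    simp [fourierL1]
  · refine (norm_fourierL1_le _ ξ).trans ?_
    have : ∫ x, |φ (s, x)| ≤
        ∫ x, L * (Metric.closedBall (0 : Space d) R).indicator (fun _ => (1 : ℝ)) x := by
      refine integral_mono (φ.integrable_slice s).abs (hint.const_mul L) fun x => ?_
      by_cases hx : φ (s, x) = 0
      · simp only [hx, abs_zero]
        exact mul_nonneg hL (indicator_nonneg (by simp) _)
      · have : x ∈ Metric.closedBall (0 : Space d) R := by simpa using (h1 s x hx).2
        simpa [indicator_of_mem this] using h2 s x
    rw [integral_const_mul, hval] at this
    nlinarith [mul_nonneg hL hV0]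
  · rcases eq_or_ne ξ 0 with rfl | hξ
    · simp; positivity
    have hξ' : 0 < ‖ξ‖ := norm_pos_iff.2 hξ
    -- Translation by this `h` multiplies the transform at `ξ` by `e^{iπ} = -1`. Hence twice the
    -- transform is, up to sign, that of `φ(· + h) - φ`, whose `L¹` norm is of order `‖h‖ = π/‖ξ‖`.
    set h : Space d := (Real.pi / ‖ξ‖ ^ 2) • ξ with hh
    have hin : inner ℝ ξ h = Real.pi := by
      rw [hh, inner_smul_right, real_inner_self_eq_norm_sq]; field_simp
    have hnorm : ‖h‖ = Real.pi / ‖ξ‖ := by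
      rw [hh, norm_smul, Real.norm_of_nonneg (by positivity)]; field_simp
    have h4 : Integrable fun x => φ (s, x + h) := (φ.integrable_slice s).comp_add_right h
    have h5 : fourierL1 (fun x => φ (s, x + h) - φ (s, x)) ξ =
        -2 * fourierL1 (fun y => φ (s, y)) ξ := by
      rw [fourierL1_sub h4 (φ.integrable_slice s), fourierL1_comp_add (fun x => φ (s, x)), hin,
        mul_comm Complex.I, Complex.exp_pi_mul_I]
      ring
    have h6 := norm_fourierL1_le (fun x => φ (s, x + h) - φ (s, x)) ξ
    rw [h5] at h6
    have h7 : ∫ x, |φ (s, x + h) - φ (s, x)| ≤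
        ∫ x, (L * ‖h‖) * ((Metric.closedBall (0 : Space d) R).indicator (fun _ => (1 : ℝ)) (x + h) +
          (Metric.closedBall (0 : Space d) R).indicator (fun _ => (1 : ℝ)) x) := by
      refine integral_mono (h4.sub (φ.integrable_slice s)).abs
        (((hint.comp_add_right h).add hint).const_mul _) fun x => ?_
      have hb := h3 s (x + h) x
      rw [add_sub_cancel_left] at hb
      have i1 : 0 ≤ (Metric.closedBall (0 : Space d) R).indicator (fun _ => (1 : ℝ)) (x + h) :=
        indicator_nonneg (by simp) _
      have i2 : 0 ≤ (Metric.closedBall (0 : Space d) R).indicator (fun _ => (1 : ℝ)) x :=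
        indicator_nonneg (by simp) _
      have hLh : 0 ≤ L * ‖h‖ := by positivity
      by_cases hx : φ (s, x) = 0
      · by_cases hx' : φ (s, x + h) = 0
        · simp only [hx, hx', sub_zero, abs_zero]; positivity
        · have : x + h ∈ Metric.closedBall (0 : Space d) R := by simpa using (h1 s _ hx').2
          rw [indicator_of_mem this]
          nlinarith
      · have : x ∈ Metric.closedBall (0 : Space d) R := by simpa using (h1 s x hx).2
        rw [indicator_of_mem this] at i2 ⊢
        nlinarith
    rw [integral_const_mul, integral_add (hint.comp_add_right h) hint,
      integral_add_right_eq_self (fun x =>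
        (Metric.closedBall (0 : Space d) R).indicator (fun _ => (1 : ℝ)) x) h, hval, hnorm] at h7
    rw [norm_mul, norm_neg, Complex.norm_ofNat] at h6
    have h8 := h6.trans h7
    have h9 : ‖fourierL1 (fun y => φ (s, y)) ξ‖ ≤ L * V * Real.pi / ‖ξ‖ := by
      have : L * (Real.pi / ‖ξ‖) * (V + V) = 2 * (L * V * Real.pi / ‖ξ‖) := by ring
      linarith
    have h10 := mul_le_mul_of_nonneg_left h9 hξ'.le
    have : ‖ξ‖ * (L * V * Real.pi / ‖ξ‖) = L * V * Real.pi := by field_simp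
    nlinarith [mul_nonneg hL hV0]

end TestFunctions

/-! ### Isometry and Gaussian moment bounds for Wiener integrals. -/

section WienerIntegral

variable {d : ℕ} {Ω : Type*} [MeasurableSpace Ω] {P : Measure Ω} {μ : Measure (Space d)}
  {W : SpaceTimeTest d → Ω → ℝ} {q : ℝ}

/-- The integral of `1 / (1 + |ξ|^q)` against a spectral measure. -/
noncomputable def spectralWeight (q : ℝ) (μ : Measure (Space d)) : ℝ≥0∞ :=
  ∫⁻ ξ, ENNReal.ofReal (1 / (1 + ‖ξ‖ ^ q)) ∂μ

lemma continuous_spectralDensity (hq : 0 < q) :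
    Continuous fun ξ : Space d => 1 / (1 + ‖ξ‖ ^ q) := by
  refine continuous_const.div (continuous_const.add
    (continuous_norm.rpow_const fun _ => Or.inr hq.le)) fun ξ => ?_
  have := Real.rpow_nonneg (norm_nonneg ξ) q
  positivity

/-- The density `1/(1+|ξ|^q)` is continuous and positive, so Markov's inequality on its superlevel
sets gives local finiteness. This makes Fubini available for `ds ⊗ μ(dξ)`. -/
lemma sigmaFinite_of_spectralWeight (hq : 0 < q) (h : spectralWeight q μ < ∞) :
    SigmaFinite μ := by
  have : IsLocallyFiniteMeasure μ := by
    refine ⟨fun x => ?_⟩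
    have hcont := continuous_spectralDensity (d := d) hq
    have hpos : 0 < 1 / (1 + ‖x‖ ^ q) := by
      have := Real.rpow_nonneg (norm_nonneg x) q
      positivity
    refine ⟨{ξ | 1 / (1 + ‖x‖ ^ q) / 2 < 1 / (1 + ‖ξ‖ ^ q)},
      (isOpen_lt continuous_const hcont).mem_nhds (by simp only [mem_ofPred_eq]; linarith), ?_⟩
    have hm := meas_ge_le_lintegral_div (μ := μ)
      (f := fun ξ => ENNReal.ofReal (1 / (1 + ‖ξ‖ ^ q)))
      hcont.measurable.ennreal_ofReal.aemeasurable
      (ε := ENNReal.ofReal (1 / (1 + ‖x‖ ^ q) / 2))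
      (by rw [Ne, ENNReal.ofReal_eq_zero]; push Not; linarith) ENNReal.ofReal_ne_top
    refine (measure_mono fun ξ hξ => ?_).trans_lt (hm.trans_lt (ENNReal.div_lt_top h.ne ?_))
    · exact ENNReal.ofReal_le_ofReal (le_of_lt hξ)
    · rw [Ne, ENNReal.ofReal_eq_zero]; push Not; linarith
  infer_instance

/-- The Fourier transform in space, as a function of time and frequency. -/
noncomputable def sliceFourier (g : ℝ → Space d → ℝ) (p : ℝ × Space d) : ℂ := fourierL1 (g p.1) p.2

/-- The measure `ds ⊗ μ(dξ)` on `(0,∞) × ℝ^d`. -/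
noncomputable abbrev timeSpectral (μ : Measure (Space d)) : Measure (ℝ × Space d) :=
  (volume.restrict (Ioi (0 : ℝ))).prod μ

/-- A test function in curried form. -/
noncomputable abbrev SpaceTimeTest.slice (φ : SpaceTimeTest d) : ℝ → Space d → ℝ := fun s y => φ (s, y)

lemma SpaceTimeTest.stronglyMeasurable_sliceFourier (φ : SpaceTimeTest d) :
    StronglyMeasurable (sliceFourier φ.slice) :=
  stronglyMeasurable_fourierL1 (g := φ.slice) φ.continuous.measurable

lemma SpaceTimeTest.memLp_sliceFourier (φ : SpaceTimeTest d) (hq : 0 < q) (hq2 : q < 2)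
    (h : spectralWeight q μ < ∞) : MemLp (sliceFourier φ.slice) 2 (timeSpectral μ) := by
  have := sigmaFinite_of_spectralWeight hq h
  refine ⟨φ.stronglyMeasurable_sliceFourier.aestronglyMeasurable, ?_⟩
  rw [eLpNorm_lt_top_iff_lintegral_rpow_enorm_lt_top (by norm_num) (by norm_num)]
  obtain ⟨R, C, hC, h1, h2, h3⟩ := φ.exists_fourier_bound
  have hle : ∀ p : ℝ × Space d, ‖sliceFourier φ.slice p‖ₑ ^ (2 : ℝ≥0∞).toReal ≤
      (Iic R).indicator (fun _ => ENNReal.ofReal (4 * C ^ 2)) p.1 *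
        ENNReal.ofReal (1 / (1 + ‖p.2‖ ^ q)) := by
    rintro ⟨s, ξ⟩
    by_cases hs : s ∈ Iic R
    · rw [indicator_of_mem hs, ← ENNReal.ofReal_mul (by positivity), ← ofReal_norm,
        ENNReal.ofReal_rpow_of_nonneg (norm_nonneg _) (by norm_num)]
      refine ENNReal.ofReal_le_ofReal ?_
      have ha := h2 s ξ
      have hb := h3 s ξ
      simp only [sliceFourier, ENNReal.toReal_ofNat, Real.rpow_two]
      set F := ‖fourierL1 (φ.slice s) ξ‖
      have hF : 0 ≤ F := norm_nonneg _
      have hn := norm_nonneg ξ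
      have hp := Real.rpow_nonneg hn q
      -- This is where `q < 2` enters: `F²(1+‖ξ‖^q) ≤ 2F² + (‖ξ‖F)² ≤ 3C²`.
      have hξ : ‖ξ‖ ^ q ≤ 1 + ‖ξ‖ ^ 2 := by
        rcases le_total ‖ξ‖ 1 with h' | h'
        · have := Real.rpow_le_one hn h' hq.le
          nlinarith
        · have := Real.rpow_le_rpow_of_exponent_le h' hq2.le
          rw [Real.rpow_two] at this
          linarith
      rw [mul_one_div, le_div_iff₀ (by positivity)]
      have e1 : F ^ 2 ≤ C ^ 2 := pow_le_pow_left₀ hF ha 2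
      have e2 : (‖ξ‖ * F) ^ 2 ≤ C ^ 2 := pow_le_pow_left₀ (by positivity) hb 2
      have e3 : F ^ 2 * (1 + ‖ξ‖ ^ q) ≤ F ^ 2 * (2 + ‖ξ‖ ^ 2) :=
        mul_le_mul_of_nonneg_left (by linarith) (by positivity)
      nlinarith
    · rw [indicator_of_notMem hs, zero_mul]
      simp only [mem_Iic, not_le] at hs
      simp [sliceFourier, h1 s ξ hs]
  refine (lintegral_mono hle).trans_lt ?_
  rw [lintegral_prod_mul (by fun_prop (disch := measurability))
    (continuous_spectralDensity hq).measurable.ennreal_ofReal.aemeasurable]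
  refine ENNReal.mul_lt_top ?_ h
  rw [lintegral_indicator measurableSet_Iic, Measure.restrict_restrict measurableSet_Iic,
    lintegral_const, Measure.restrict_apply_univ]
  refine ENNReal.mul_lt_top ENNReal.ofReal_lt_top ?_
  rw [inter_comm, Ioi_inter_Iic, Real.volume_Ioc]
  exact ENNReal.ofReal_lt_top

lemma IsHomogeneousNoise.memLp (hW : IsHomogeneousNoise P μ W) (φ : SpaceTimeTest d) (p : ℝ≥0∞)
    (hp : p ≠ ∞) : MemLp (W φ) p P := (hW.gaussian.hasGaussianLaw_eval φ).memLp hp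

lemma IsHomogeneousNoise.covariance_eq (hW : IsHomogeneousNoise P μ W) (hq : 0 < q) (hq2 : q < 2)
    (h : spectralWeight q μ < ∞) (φ ψ : SpaceTimeTest d) :
    ((∫ ω, W φ ω * W ψ ω ∂P : ℝ) : ℂ) = ∫ p, sliceFourier φ.slice p *
      (starRingEnd ℂ) (sliceFourier ψ.slice p) ∂(timeSpectral μ) := by
  have := sigmaFinite_of_spectralWeight hq h
  rw [hW.covariance, integral_prod]
  · rfl
  · exact (φ.memLp_sliceFourier hq hq2 h).integrable_mul (ψ.memLp_sliceFourier hq hq2 h).star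

/-- Linearity of `W` in the test function is not part of the definition. The square of the
difference is therefore expanded, and the covariance formula is applied to each of the four
products. -/
lemma IsHomogeneousNoise.eLpNorm_sub (hW : IsHomogeneousNoise P μ W) (hq : 0 < q) (hq2 : q < 2)
    (h : spectralWeight q μ < ∞) (φ ψ : SpaceTimeTest d) :
    eLpNorm (fun ω => W φ ω - W ψ ω) 2 P =
      eLpNorm (fun p => sliceFourier φ.slice p - sliceFourier ψ.slice p) 2 (timeSpectral μ) := by
  have hF := φ.memLp_sliceFourier (μ := μ) hq hq2 h
  have hG := ψ.memLp_sliceFourier (μ := μ) hq hq2 h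
  have hX := hW.memLp φ 2 (by norm_num)
  have hY := hW.memLp ψ 2 (by norm_num)
  have e1 : ∫ ω, (W φ ω - W ψ ω) ^ 2 ∂P = ∫ ω, W φ ω * W φ ω ∂P - ∫ ω, W φ ω * W ψ ω ∂P -
      (∫ ω, W ψ ω * W φ ω ∂P - ∫ ω, W ψ ω * W ψ ω ∂P) := by
    have a1 : Integrable (fun ω => W φ ω * W φ ω) P := hX.integrable_mul hX
    have a2 : Integrable (fun ω => W φ ω * W ψ ω) P := hX.integrable_mul hY
    have a3 : Integrable (fun ω => W ψ ω * W φ ω) P := hY.integrable_mul hX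
    have a4 : Integrable (fun ω => W ψ ω * W ψ ω) P := hY.integrable_mul hY
    have s1 : Integrable (fun ω => W φ ω * W φ ω - W φ ω * W ψ ω) P := a1.sub a2
    have s2 : Integrable (fun ω => W ψ ω * W φ ω - W ψ ω * W ψ ω) P := a3.sub a4
    rw [← integral_sub a1 a2, ← integral_sub a3 a4, ← integral_sub s1 s2]
    congr 1; ext ω; ring
  have e2 : ((∫ p, ‖sliceFourier φ.slice p - sliceFourier ψ.slice p‖ ^ 2 ∂(timeSpectral μ) : ℝ) : ℂ)
      = ((∫ ω, (W φ ω - W ψ ω) ^ 2 ∂P : ℝ) : ℂ) := by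
    rw [e1]
    push_cast
    have b : ∀ φ₁ φ₂ : SpaceTimeTest d, Integrable (fun p => sliceFourier φ₁.slice p *
        (starRingEnd ℂ) (sliceFourier φ₂.slice p)) (timeSpectral μ) := fun φ₁ φ₂ =>
      (φ₁.memLp_sliceFourier hq hq2 h).integrable_mul (φ₂.memLp_sliceFourier hq hq2 h).star
    have c := hW.covariance_eq hq hq2 h
    have s1 : ∀ φ₁ φ₂ φ₃ φ₄ : SpaceTimeTest d, Integrable (fun p => sliceFourier φ₁.slice p *
        (starRingEnd ℂ) (sliceFourier φ₂.slice p) - sliceFourier φ₃.slice p *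
        (starRingEnd ℂ) (sliceFourier φ₄.slice p)) (timeSpectral μ) :=
      fun φ₁ φ₂ φ₃ φ₄ => (b φ₁ φ₂).sub (b φ₃ φ₄)
    simp only [← integral_complex_ofReal, Complex.ofReal_mul] at c ⊢
    rw [c, c, c, c, ← integral_sub (b φ φ) (b φ ψ), ← integral_sub (b ψ φ) (b ψ ψ),
      ← integral_sub (s1 _ _ _ _) (s1 _ _ _ _)]
    congr 1; ext p
    rw [Complex.ofReal_pow, ← Complex.mul_conj', map_sub]
    ring
  have e3 := Complex.ofReal_injective e2
  have h2 : (2 : ℝ≥0∞) ≠ 0 := by norm_num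
  have hXY : MemLp (fun ω => W φ ω - W ψ ω) 2 P := hX.sub hY
  have hFG : MemLp (fun p => sliceFourier φ.slice p - sliceFourier ψ.slice p) 2
    (timeSpectral μ) := hF.sub hG
  rw [hXY.eLpNorm_eq_integral_rpow_norm h2 (by norm_num),
    hFG.eLpNorm_eq_integral_rpow_norm h2 (by norm_num)]
  congr 2
  simp only [ENNReal.toReal_ofNat, Real.rpow_two, Real.norm_eq_abs, sq_abs]
  exact e3.symm

lemma eLpNorm_two_timeSpectral (hμ : SFinite μ) {F : ℝ × Space d → ℂ}
    (hF : AEStronglyMeasurable F (timeSpectral μ)) :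
    ∫⁻ s in Ioi (0 : ℝ), ∫⁻ ξ, ‖F (s, ξ)‖ₑ ^ 2 ∂μ = eLpNorm F 2 (timeSpectral μ) ^ 2 := by
  have h1 := eLpNorm_nnreal_pow_eq_lintegral (f := F) (μ := timeSpectral μ) (p := 2) (by norm_num)
  have h2 : eLpNorm F 2 (timeSpectral μ) ^ 2 = ∫⁻ p, ‖F p‖ₑ ^ 2 ∂(timeSpectral μ) := by
    simpa only [NNReal.coe_ofNat, ENNReal.rpow_two, ENNReal.rpow_ofNat, ENNReal.coe_ofNat] using h1
  rw [h2, lintegral_prod _ (hF.enorm.pow_const 2)]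

/-- The Wiener integral is an isometry, and Gaussian: all moments of a difference of two Wiener
integrals are controlled by the spectral norm. -/
lemma IsWienerIntegral.eLpNorm_sub_le (hW : IsHomogeneousNoise P μ W) (hq : 0 < q) (hq2 : q < 2)
    (h : spectralWeight q μ < ∞) {g g' : ℝ → Space d → ℝ} {I I' : Ω → ℝ}
    (hI : IsWienerIntegral P μ W g I) (hI' : IsWienerIntegral P μ W g' I')
    (hg : StronglyMeasurable (sliceFourier g)) (hg' : StronglyMeasurable (sliceFourier g'))
    (p : ℝ≥0) :
    eLpNorm (fun ω => I ω - I' ω) p P ≤ gaussianMomentRatio p *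
      eLpNorm (fun z => sliceFourier g z - sliceFourier g' z) 2 (timeSpectral μ) := by
  have := sigmaFinite_of_spectralWeight hq h
  have := hW.gaussian.isProbabilityMeasure
  obtain ⟨-, hm, φ, h1, h2⟩ := hI
  obtain ⟨-, hm', ψ, h1', h2'⟩ := hI'
  have conv : ∀ {g : ℝ → Space d → ℝ} (hg : StronglyMeasurable (sliceFourier g))
      (φ : ℕ → SpaceTimeTest d), Tendsto (fun k => ∫⁻ s in Ioi (0 : ℝ), ∫⁻ ξ,
        ‖fourierL1 (fun y => φ k (s, y)) ξ - fourierL1 (g s) ξ‖ₑ ^ 2 ∂μ) atTop (𝓝 0) →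
      Tendsto (fun k => eLpNorm (fun z => sliceFourier (φ k).slice z - sliceFourier g z) 2
        (timeSpectral μ)) atTop (𝓝 0) := by
    intro g hg φ hφ
    have e : ∀ k, ∫⁻ s in Ioi (0 : ℝ), ∫⁻ ξ,
        ‖fourierL1 (fun y => φ k (s, y)) ξ - fourierL1 (g s) ξ‖ₑ ^ 2 ∂μ =
        eLpNorm (fun z => sliceFourier (φ k).slice z - sliceFourier g z) 2 (timeSpectral μ) ^ 2 :=
      fun k => eLpNorm_two_timeSpectral inferInstance
        (F := fun z => sliceFourier (φ k).slice z - sliceFourier g z)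
        ((φ k).stronglyMeasurable_sliceFourier.sub hg).aestronglyMeasurable
    simp only [e] at hφ
    have := (ENNReal.continuous_rpow_const (y := (1 / 2 : ℝ))).continuousAt.tendsto.comp hφ
    simp only [Function.comp_def, one_div, ← ENNReal.rpow_natCast, ← ENNReal.rpow_mul] at this
    simpa using this
  set Z : ℕ → Ω → ℝ := fun k ω => W (φ k) ω - W (ψ k) ω with hZ
  have hZm : ∀ k, AEStronglyMeasurable (Z k) P := fun k =>
    ((hW.memLp (φ k) 2 (by norm_num)).sub (hW.memLp (ψ k) 2 (by norm_num))).1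
  have hD : AEStronglyMeasurable (fun ω => I ω - I' ω) P := (hm.sub hm').1
  have hlim : Tendsto (fun k => eLpNorm (Z k - fun ω => I ω - I' ω) 2 P) atTop (𝓝 0) := by
    refine tendsto_of_tendsto_of_tendsto_of_le_of_le tendsto_const_nhds
      (by simpa using h2.add h2') (fun _ => zero_le) fun k => ?_
    have hsub := MeasureTheory.eLpNorm_sub_le (p := 2)
      ((hW.memLp (φ k) 2 (by norm_num)).sub hm).1
      ((hW.memLp (ψ k) 2 (by norm_num)).sub hm').1 (by norm_num)
    refine le_trans (le_of_eq ?_) hsub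
    congr 1; ext ω; simp only [hZ, Pi.sub_apply]; ring
  -- The approximants converge only in `L²`. An almost surely convergent subsequence and Fatou's
  -- lemma transfer their `L^p` bounds to the limit.
  obtain ⟨ns, hns, hae⟩ := (tendstoInMeasure_of_tendsto_eLpNorm (by norm_num) hZm hD
    hlim).exists_seq_tendsto_ae
  refine (Lp.eLpNorm_lim_le_liminf_eLpNorm (fun k => hZm (ns k)) _ hae).trans ?_
  set A := eLpNorm (fun z => sliceFourier g z - sliceFourier g' z) 2 (timeSpectral μ)
  -- For test functions the Gaussian moment identity and the isometry are exact; the triangle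
  -- inequality then isolates `A` from two errors that tend to zero.
  have hup : ∀ k, eLpNorm (Z k) p P ≤ gaussianMomentRatio p *
      (eLpNorm (fun z => sliceFourier (φ k).slice z - sliceFourier g z) 2 (timeSpectral μ) + A +
       eLpNorm (fun z => sliceFourier (ψ k).slice z - sliceFourier g' z) 2 (timeSpectral μ)) := by
    intro k
    have h0 : ∫ ω, Z k ω ∂P = 0 := by
      rw [integral_sub ((hW.memLp (φ k) 1 (by norm_num)).integrable le_rfl)
        ((hW.memLp (ψ k) 1 (by norm_num)).integrable le_rfl), hW.centered, hW.centered, sub_zero]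
    rw [eLpNorm_eq_of_hasGaussianLaw hW.gaussian.hasGaussianLaw_fun_sub h0,
      hW.eLpNorm_sub hq hq2 h]
    gcongr
    have t1 := (φ k).stronglyMeasurable_sliceFourier.sub hg
    have t2 := hg.sub hg'
    have t3 := (ψ k).stronglyMeasurable_sliceFourier.sub hg'
    have := (MeasureTheory.eLpNorm_sub_le (p := 2) (μ := timeSpectral μ)
      (t1.add t2).aestronglyMeasurable t3.aestronglyMeasurable (by norm_num)).trans
      (add_le_add_left (eLpNorm_add_le t1.aestronglyMeasurable t2.aestronglyMeasurable
        (by norm_num)) _)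
    refine le_trans (le_of_eq ?_) this
    congr 1; ext z; simp
  have hl : Tendsto (fun k => gaussianMomentRatio p *
      (eLpNorm (fun z => sliceFourier (φ k).slice z - sliceFourier g z) 2 (timeSpectral μ) + A +
       eLpNorm (fun z => sliceFourier (ψ k).slice z - sliceFourier g' z) 2 (timeSpectral μ)))
       atTop (𝓝 (gaussianMomentRatio p * (0 + A + 0))) :=
    ENNReal.Tendsto.const_mul (((conv hg φ h1).add tendsto_const_nhds).add (conv hg' ψ h1'))
      (Or.inr (gaussianMomentRatio_ne_top p))
  rw [zero_add, add_zero] at hl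
  rw [← (hl.comp hns.tendsto_atTop).liminf_eq]
  exact liminf_le_liminf (Eventually.of_forall fun k => hup (ns k))

/-- Moments of a single Wiener integral. -/
lemma IsWienerIntegral.eLpNorm_le (hW : IsHomogeneousNoise P μ W) (hq : 0 < q) (hq2 : q < 2)
    (h : spectralWeight q μ < ∞) {g : ℝ → Space d → ℝ} {I : Ω → ℝ}
    (hI : IsWienerIntegral P μ W g I) (hg : StronglyMeasurable (sliceFourier g)) (p : ℝ≥0) :
    eLpNorm I p P ≤ gaussianMomentRatio p * eLpNorm (sliceFourier g) 2 (timeSpectral μ) := by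
  have hz : ∀ ξ : Space d, fourierL1 (fun _ : Space d => (0 : ℝ)) ξ = 0 := by simp [fourierL1]
  have hz' : ∀ s (ξ : Space d), fourierL1 (fun y => (0 : SpaceTimeTest d) (s, y)) ξ = 0 :=
    fun _ ξ => hz ξ
  -- `W 0 = 0` almost surely follows from the covariance. So `0` is a Wiener integral of `0`, and
  -- the bound for differences applies with `I' = 0`.
  have h0 : eLpNorm (W 0) 2 P = 0 := by
    have e : ∫ ω, W 0 ω * W 0 ω ∂P = 0 := by
      apply Complex.ofReal_injective
      rw [hW.covariance_eq hq hq2 h]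
      simp [sliceFourier, hz']
    rw [(hW.memLp 0 2 (by norm_num)).eLpNorm_eq_integral_rpow_norm (by norm_num) (by norm_num)]
    simp only [ENNReal.toReal_ofNat, Real.rpow_two, Real.norm_eq_abs, sq_abs]
    simp only [pow_two, e]
    simp
  have hI0 : IsWienerIntegral P μ W (fun _ _ => 0) (fun _ => 0) := by
    refine ⟨fun s _ => integrable_zero _ _ _, MemLp.zero', fun _ => 0, ?_, ?_⟩
    · simp [hz]
    · simp only [sub_zero]
      exact tendsto_const_nhds.congr fun _ => h0.symm
  have e0 : sliceFourier (fun _ _ => (0 : ℝ)) = fun _ : ℝ × Space d => (0 : ℂ) := by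
    ext p; exact hz p.2
  have := hI.eLpNorm_sub_le hW hq hq2 h hI0 hg (by rw [e0]; exact stronglyMeasurable_const) p
  simpa [e0] using this

end WienerIntegral

/-! ### The heat kernel and the regularity of the deterministic evolution. -/

section HeatKernel

variable {d : ℕ}

lemma heatKernel_nonneg {t : ℝ} (ht : 0 ≤ t) (x : Space d) : 0 ≤ heatKernel t x := by
  unfold heatKernel
  have := Real.pi_pos
  positivity

lemma measurable_heatKernel : Measurable fun p : ℝ × Space d => heatKernel p.1 p.2 := by
  unfold heatKernel
  fun_prop

lemma heatKernel_neg (t : ℝ) (x : Space d) : heatKernel t (-x) = heatKernel t x := by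
  simp [heatKernel]

lemma integrable_heatKernel {t : ℝ} (ht : 0 < t) : Integrable fun x : Space d => heatKernel t x := by
  have h := (GaussianFourier.integrable_cexp_neg_mul_sq_norm_add (V := Space d)
    (b := ((1 / (2 * t) : ℝ) : ℂ)) (by rw [Complex.ofReal_re]; positivity) 0 0).norm
  refine (h.const_mul ((2 * Real.pi * t) ^ (-(d : ℝ) / 2))).congr (ae_of_all _ fun x => ?_)
  simp only [Complex.norm_exp, heatKernel]
  congr 2
  simp only [zero_mul, add_zero]
  norm_cast
  ring

/-- The substitution `y ↦ x - y` pulls out the phase; what remains is the Gaussian characteristic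
function, and the normalising powers of `2πt` cancel. -/
lemma fourierL1_heatKernel {t : ℝ} (ht : 0 < t) (x ξ : Space d) :
    fourierL1 (fun y => heatKernel t (x - y)) ξ =
      Complex.exp (-(Complex.I * ((inner ℝ ξ x : ℝ) : ℂ))) *
        ((Real.exp (-(t * ‖ξ‖ ^ 2 / 2)) : ℝ) : ℂ) := by
  have hπ := Real.pi_pos
  unfold fourierL1
  rw [← integral_sub_left_eq_self _ _ x]
  have hb : 0 < (((1 / (2 * t) : ℝ) : ℂ)).re := by rw [Complex.ofReal_re]; positivity
  have key := GaussianFourier.integral_cexp_neg_mul_sq_norm_add (V := Space d) hb Complex.I ξ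
  have e : ∀ v : Space d, Complex.exp (-(Complex.I * ((inner ℝ ξ (x - v) : ℝ) : ℂ))) *
      ((heatKernel t (x - (x - v)) : ℝ) : ℂ) =
      (Complex.exp (-(Complex.I * ((inner ℝ ξ x : ℝ) : ℂ))) *
        (((2 * Real.pi * t) ^ (-(d : ℝ) / 2) : ℝ) : ℂ)) *
      Complex.exp (-((1 / (2 * t) : ℝ) : ℂ) * ‖v‖ ^ 2 + Complex.I * ((inner ℝ ξ v : ℝ) : ℂ)) := by
    intro v
    rw [sub_sub_cancel, heatKernel, inner_sub_right]
    generalize (2 * Real.pi * t) ^ (-(d : ℝ) / 2) = K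
    push_cast
    rw [mul_left_comm, ← Complex.exp_add, mul_right_comm, ← Complex.exp_add, mul_comm]
    congr 2
    field_simp
    ring
  simp only [e]
  rw [integral_const_mul, key, mul_assoc]
  congr 1
  have hpi : ((Real.pi : ℂ) / ((1 / (2 * t) : ℝ) : ℂ)) = ((2 * Real.pi * t : ℝ) : ℂ) := by
    push_cast; field_simp
  have hfr : ((Module.finrank ℝ (Space d) : ℂ) / 2) = (((d : ℝ) / 2 : ℝ) : ℂ) := by
    rw [finrank_euclideanSpace_fin]; push_cast; rfl
  rw [hpi, hfr, ← Complex.ofReal_cpow (by positivity), ← mul_assoc, ← Complex.ofReal_mul,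
    ← Real.rpow_add (by positivity)]
  rw [show -(d : ℝ) / 2 + d / 2 = 0 by ring, Real.rpow_zero, Complex.ofReal_one, one_mul,
    Complex.ofReal_exp]
  congr 1
  have : (t : ℂ) ≠ 0 := by exact_mod_cast ht.ne'
  push_cast
  rw [Complex.I_sq]
  field_simp
  ring

/-- The Fourier transform at frequency zero. -/
lemma integral_heatKernel {t : ℝ} (ht : 0 < t) : ∫ x : Space d, heatKernel t x = 1 := by
  have h := fourierL1_heatKernel ht (0 : Space d) 0
  simp only [fourierL1, zero_sub, heatKernel_neg, inner_zero_left] at h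
  simp only [Complex.ofReal_zero, mul_zero, neg_zero, Complex.exp_zero, one_mul, norm_zero,
    ne_eq, OfNat.ofNat_ne_zero, not_false_eq_true, zero_pow, zero_div, Real.exp_zero,
    Complex.ofReal_one] at h
  rw [integral_complex_ofReal] at h
  exact_mod_cast h

lemma lintegral_heatKernel {t : ℝ} (ht : 0 < t) (x : Space d) :
    ∫⁻ y, ENNReal.ofReal (heatKernel t (x - y)) = 1 := by
  rw [lintegral_sub_left_eq_self (fun y => ENNReal.ofReal (heatKernel t y)) x,
    ← ofReal_integral_eq_lintegral_ofReal (integrable_heatKernel ht)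
      (ae_of_all _ fun y => heatKernel_nonneg ht.le y), integral_heatKernel ht, ENNReal.ofReal_one]

lemma heatKernel_sqrt_smul {t : ℝ} (ht : 0 < t) (z : Space d) :
    heatKernel t (Real.sqrt t • z) = (Real.sqrt t ^ d)⁻¹ * heatKernel 1 z := by
  have hπ := Real.pi_pos
  unfold heatKernel
  rw [norm_smul, Real.norm_of_nonneg (Real.sqrt_nonneg t), mul_pow, Real.sq_sqrt ht.le,
    Real.mul_rpow (by positivity) ht.le, mul_one, mul_one]
  have h1 : t ^ (-(d : ℝ) / 2) = (Real.sqrt t ^ d)⁻¹ := by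
    rw [Real.sqrt_eq_rpow, ← Real.rpow_natCast, ← Real.rpow_mul ht.le, ← Real.rpow_neg ht.le]
    congr 1; ring
  have h2 : -(t * ‖z‖ ^ 2) / (2 * t) = -(‖z‖ ^ 2) / 2 := by field_simp
  rw [h1, h2]; ring

/-- Brownian scaling integrates against one fixed kernel for all `t ≥ 0`, the case `t = 0` included.
Regularity in time then reduces to comparing `√(t+h)` with `√t`. -/
lemma heatInitial_eq (u₀ : Space d → ℝ) {t : ℝ} (ht : 0 ≤ t) (x : Space d) :
    heatInitial u₀ t x = ∫ z, u₀ (x - Real.sqrt t • z) * heatKernel 1 z := by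
  unfold heatInitial
  split_ifs with h0
  · subst h0
    simp only [Real.sqrt_zero, zero_smul, sub_zero]
    rw [integral_const_mul, integral_heatKernel one_pos, mul_one]
  · have ht' : 0 < t := lt_of_le_of_ne ht (Ne.symm h0)
    have hs : 0 < Real.sqrt t := Real.sqrt_pos.2 ht'
    rw [← integral_sub_left_eq_self _ _ x]
    simp only [sub_sub_cancel]
    have h := Measure.integral_comp_smul (volume : Measure (Space d))
      (fun y => u₀ (x - y) * heatKernel t y) (Real.sqrt t)
    simp only [heatKernel_sqrt_smul ht', finrank_euclideanSpace_fin, smul_eq_mul] at h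
    rw [abs_of_pos (by positivity)] at h
    have h' : ∫ z, u₀ (x - Real.sqrt t • z) * ((Real.sqrt t ^ d)⁻¹ * heatKernel 1 z) =
        (Real.sqrt t ^ d)⁻¹ * ∫ z, u₀ (x - Real.sqrt t • z) * heatKernel 1 z := by
      rw [← integral_const_mul]; congr 1; ext z; ring
    rw [h'] at h
    exact (mul_left_cancel₀ (by positivity) h).symm

lemma integrable_norm_rpow_mul_heatKernel {α : ℝ} (h0 : 0 ≤ α) (h1 : α ≤ 1) :
    Integrable fun z : Space d => ‖z‖ ^ α * heatKernel 1 z := by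
  -- The kernel at time `2` dominates: it gains a factor `e^{‖z‖²/4}`, which beats `1 + ‖z‖²`. The
  -- constant exchanges the two normalisations.
  have h2 := (integrable_heatKernel (d := d) (t := 2) two_pos).const_mul
    (8 * (2 * Real.pi * 1) ^ (-(d : ℝ) / 2) * ((2 * Real.pi * 2) ^ (-(d : ℝ) / 2))⁻¹)
  have hπ := Real.pi_pos
  refine h2.mono' ?_ (ae_of_all _ fun z => ?_)
  · refine AEStronglyMeasurable.mul ?_ (integrable_heatKernel one_pos).1
    exact (measurable_norm.pow_const α).aestronglyMeasurable
  have hz := norm_nonneg z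
  rw [Real.norm_of_nonneg (mul_nonneg (Real.rpow_nonneg hz _) (heatKernel_nonneg zero_le_one _))]
  unfold heatKernel
  have e1 : ‖z‖ ^ α ≤ 1 + ‖z‖ ^ 2 := by
    rcases le_total ‖z‖ 1 with h' | h'
    · have := Real.rpow_le_one hz h' h0
      nlinarith
    · have := Real.rpow_le_rpow_of_exponent_le h' (h1.trans one_le_two)
      rw [Real.rpow_two] at this
      linarith
  have e2 : ‖z‖ ^ 2 / 4 + 1 ≤ Real.exp (‖z‖ ^ 2 / 4) := Real.add_one_le_exp _
  have e3 : Real.exp (-‖z‖ ^ 2 / (2 * 2)) =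
      Real.exp (-‖z‖ ^ 2 / (2 * 1)) * Real.exp (‖z‖ ^ 2 / 4) := by
    rw [← Real.exp_add]; congr 1; ring
  rw [e3]
  set A := (2 * Real.pi * 1) ^ (-(d : ℝ) / 2)
  set B := (2 * Real.pi * 2) ^ (-(d : ℝ) / 2) with hB
  have hB0 : 0 < B := by positivity
  have hA0 : 0 < A := by positivity
  set E := Real.exp (-‖z‖ ^ 2 / (2 * 1))
  have hE : 0 < E := Real.exp_pos _
  have : 8 * A * B⁻¹ * (B * (E * Real.exp (‖z‖ ^ 2 / 4))) =
      8 * Real.exp (‖z‖ ^ 2 / 4) * (A * E) := by field_simp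
  rw [this]
  refine mul_le_mul_of_nonneg_right ?_ (by positivity)
  nlinarith

lemma integrable_bounded_mul_heatKernel {u : Space d → ℝ} (hu : Measurable u) {M : ℝ}
    (hM : ∀ x, |u x| ≤ M) : Integrable fun z => u z * heatKernel 1 z :=
  (integrable_heatKernel one_pos).bdd_mul hu.aestronglyMeasurable (ae_of_all _ hM)

lemma abs_heatInitial_le {u₀ : Space d → ℝ} {M : ℝ} (hM : ∀ x, |u₀ x| ≤ M) {t : ℝ} (ht : 0 ≤ t)
    (x : Space d) : |heatInitial u₀ t x| ≤ M := by
  rw [heatInitial_eq u₀ ht, ← Real.norm_eq_abs]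
  refine (norm_integral_le_of_norm_le ((integrable_heatKernel one_pos).const_mul M)
    (ae_of_all _ fun z => ?_)).trans_eq ?_
  · rw [norm_mul, Real.norm_of_nonneg (heatKernel_nonneg zero_le_one z)]
    exact mul_le_mul_of_nonneg_right (hM _) (heatKernel_nonneg zero_le_one z)
  · rw [integral_const_mul, integral_heatKernel one_pos, mul_one]

lemma sqrt_add_sub_sqrt_le {t h : ℝ} (ht : 0 ≤ t) (hh : 0 ≤ h) :
    Real.sqrt (t + h) - Real.sqrt t ≤ Real.sqrt h := by
  have h1 : 0 ≤ Real.sqrt h + Real.sqrt t := by positivity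
  rw [sub_le_iff_le_add]
  refine Real.sqrt_le_iff.2 ⟨h1, ?_⟩
  have h2 : 0 ≤ Real.sqrt t * Real.sqrt h := by positivity
  rw [add_sq, Real.sq_sqrt ht, Real.sq_sqrt hh]
  linarith

/-- Hölder regularity in space and time of the solution of the heat equation. -/
lemma exists_heatInitial_holder {u₀ : Space d → ℝ} {M : ℝ} (hM : ∀ x, |u₀ x| ≤ M) {α C : ℝ≥0}
    (hα₀ : 0 < α) (hα₁ : α < 1) (hu : HolderWith C α u₀) : ∃ K : ℝ, 0 ≤ K ∧
      (∀ t, 0 ≤ t → ∀ x h, |heatInitial u₀ t (x + h) - heatInitial u₀ t x| ≤ K * ‖h‖ ^ (α : ℝ)) ∧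
      ∀ t, 0 ≤ t → ∀ h, 0 ≤ h → ∀ x,
        |heatInitial u₀ (t + h) x - heatInitial u₀ t x| ≤ K * h ^ ((α : ℝ) / 2) := by
  have hcont : Continuous u₀ := hu.continuous hα₀
  have hH : ∀ x y, |u₀ x - u₀ y| ≤ C * ‖x - y‖ ^ (α : ℝ) := fun x y => by
    have := hu.dist_le x y
    rwa [dist_eq_norm, dist_eq_norm, Real.norm_eq_abs] at this
  set A := ∫ z : Space d, ‖z‖ ^ (α : ℝ) * heatKernel 1 z
  have hA : 0 ≤ A := integral_nonneg fun z =>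
    mul_nonneg (Real.rpow_nonneg (norm_nonneg _) _) (heatKernel_nonneg zero_le_one _)
  have hAi := integrable_norm_rpow_mul_heatKernel (d := d) α.2
    (show (α : ℝ) ≤ 1 from by exact_mod_cast hα₁.le)
  have hint : ∀ t x, Integrable fun z : Space d => u₀ (x - Real.sqrt t • z) * heatKernel 1 z :=
    fun t x => integrable_bounded_mul_heatKernel (by fun_prop) (fun z => hM _)
  refine ⟨C * (1 + A), mul_nonneg C.2 (by linarith), fun t ht x h => ?_, fun t ht h hh x => ?_⟩
  · rw [heatInitial_eq u₀ ht, heatInitial_eq u₀ ht, ← integral_sub (hint _ _) (hint _ _),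
      ← Real.norm_eq_abs]
    have hn : 0 ≤ ‖h‖ ^ (α : ℝ) := Real.rpow_nonneg (norm_nonneg _) _
    refine (norm_integral_le_of_norm_le ((integrable_heatKernel one_pos).const_mul
      (C * ‖h‖ ^ (α : ℝ))) (ae_of_all _ fun z => ?_)).trans ?_
    · rw [← sub_mul, norm_mul, Real.norm_of_nonneg (heatKernel_nonneg zero_le_one z)]
      refine mul_le_mul_of_nonneg_right ?_ (heatKernel_nonneg zero_le_one z)
      have := hH (x + h - Real.sqrt t • z) (x - Real.sqrt t • z)
      rwa [show x + h - Real.sqrt t • z - (x - Real.sqrt t • z) = h by abel] at this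
    · rw [integral_const_mul, integral_heatKernel one_pos, mul_one]
      have : 0 ≤ (C : ℝ) * A := mul_nonneg C.2 hA
      nlinarith
  · have hs : 0 ≤ Real.sqrt (t + h) - Real.sqrt t :=
      sub_nonneg.2 (Real.sqrt_le_sqrt (by linarith))
    have hs' : Real.sqrt (t + h) - Real.sqrt t ≤ Real.sqrt h := sqrt_add_sub_sqrt_le ht hh
    rw [heatInitial_eq u₀ (by linarith), heatInitial_eq u₀ ht, ← integral_sub (hint _ _) (hint _ _),
      ← Real.norm_eq_abs]
    -- The argument of `u₀` moves by at most `√h ‖z‖`, whence the time exponent `α/2`.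
    have hsq : Real.sqrt h ^ (α : ℝ) = h ^ ((α : ℝ) / 2) := by
      rw [Real.sqrt_eq_rpow, ← Real.rpow_mul hh]; congr 1; ring
    have hn : 0 ≤ h ^ ((α : ℝ) / 2) := Real.rpow_nonneg hh _
    have hdom : Integrable fun z : Space d =>
        (C * h ^ ((α : ℝ) / 2)) * (‖z‖ ^ (α : ℝ) * heatKernel 1 z) := hAi.const_mul _
    have hpt : ∀ z : Space d, ‖u₀ (x - Real.sqrt (t + h) • z) * heatKernel 1 z -
        u₀ (x - Real.sqrt t • z) * heatKernel 1 z‖ ≤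
        (C * h ^ ((α : ℝ) / 2)) * (‖z‖ ^ (α : ℝ) * heatKernel 1 z) := by
      intro z
      rw [← sub_mul, norm_mul, Real.norm_of_nonneg (heatKernel_nonneg zero_le_one z), ← mul_assoc]
      refine mul_le_mul_of_nonneg_right ?_ (heatKernel_nonneg zero_le_one z)
      have h1 := hH (x - Real.sqrt (t + h) • z) (x - Real.sqrt t • z)
      rw [show x - Real.sqrt (t + h) • z - (x - Real.sqrt t • z) =
        -((Real.sqrt (t + h) - Real.sqrt t) • z) by module, norm_neg, norm_smul,
        Real.norm_of_nonneg hs, Real.mul_rpow hs (norm_nonneg z), ← mul_assoc] at h1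
      refine h1.trans (mul_le_mul_of_nonneg_right ?_ (Real.rpow_nonneg (norm_nonneg z) _))
      rw [← hsq]
      exact mul_le_mul_of_nonneg_left (Real.rpow_le_rpow hs hs' α.2) C.2
    refine (norm_integral_le_of_norm_le hdom (ae_of_all _ hpt)).trans ?_
    rw [integral_const_mul]
    change (C : ℝ) * h ^ ((α : ℝ) / 2) * A ≤ _
    have : 0 ≤ (C : ℝ) * h ^ ((α : ℝ) / 2) := mul_nonneg C.2 hn
    nlinarith

end HeatKernel

/-! ### Spectral norms of the heat integrand and of its increments. -/

section SpectralIncrements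

variable {d : ℕ} {μ : Measure (Space d)} {q : ℝ}

/-- Used with `a = |ξ|²`: the only facts needed about the time integral `m` are `m ≤ t - r`, good at
low frequencies, and `m|ξ|² ≤ 1`, good at high ones. -/
lemma exists_lintegral_exp_eq {r t a : ℝ} (hrt : r ≤ t) (ha : 0 ≤ a) :
    ∃ m : ℝ, 0 ≤ m ∧ m ≤ t - r ∧ m * a ≤ 1 ∧
      ∫⁻ s in Ioc r t, ENNReal.ofReal (Real.exp (-((t - s) * a))) = ENNReal.ofReal m := by
  have hc : Continuous fun s : ℝ => Real.exp (-((t - s) * a)) := by fun_prop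
  refine ⟨∫ s in r..t, Real.exp (-((t - s) * a)), ?_, ?_, ?_, ?_⟩
  · exact intervalIntegral.integral_nonneg hrt fun s _ => (Real.exp_pos _).le
  · have := intervalIntegral.integral_mono_on (μ := volume) hrt (hc.intervalIntegrable r t)
      (g := fun _ => (1 : ℝ)) intervalIntegrable_const fun s hs =>
        Real.exp_le_one_iff.2 (neg_nonpos.2 (mul_nonneg (by linarith [hs.2]) ha))
    simpa using this
  · have hd : ∀ s ∈ uIcc r t, HasDerivAt (fun s => Real.exp (-((t - s) * a)))
        (Real.exp (-((t - s) * a)) * a) s := by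
      intro s _
      have h1 : HasDerivAt (fun s : ℝ => -((t - s) * a)) a s := by
        have := ((hasDerivAt_id' s).const_sub t).fun_mul (hasDerivAt_const s (-a))
        convert! this using 1
        · ext; ring
        · ring
      exact h1.exp
    have := intervalIntegral.integral_eq_sub_of_hasDerivAt hd
      ((hc.mul continuous_const).intervalIntegrable r t)
    rw [intervalIntegral.integral_mul_const] at this
    rw [this]
    have := Real.exp_pos (-((t - r) * a))
    simp only [sub_self, zero_mul, neg_zero, Real.exp_zero]
    linarith
  · rw [intervalIntegral.integral_of_le hrt, ofReal_integral_eq_lintegral_ofReal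
      ((hc.intervalIntegrable r t).1) (ae_of_all _ fun s => (Real.exp_pos _).le)]

lemma le_two_mul_div_of_le_one {x B m : ℝ} (hq : 0 < q) (hx0 : 0 ≤ x) (hx : x ≤ 1)
    (hB : 0 ≤ B) (hm : m ≤ B) : m ≤ 2 * B * (1 / (1 + x ^ q)) := by
  have h1 := Real.rpow_le_one hx0 hx hq.le
  have h0 := Real.rpow_nonneg hx0 q
  rw [mul_one_div, le_div_iff₀ (by positivity)]
  nlinarith

lemma le_two_mul_div_of_one_le {x B m : ℝ} (hq : 0 < q) (hx : 1 ≤ x)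
    (hB : 0 ≤ B) (hm : m * x ^ q ≤ B) : m ≤ 2 * B * (1 / (1 + x ^ q)) := by
  have h1 := Real.one_le_rpow hx hq.le
  rw [mul_one_div, le_div_iff₀ (by positivity)]
  rcases le_total 0 m with h | h <;> nlinarith

lemma spectral_weight_bound {x T m : ℝ} (hq : 0 < q) (hq2 : q < 2) (hx : 0 ≤ x) (hm : 0 ≤ m)
    (hmT : m ≤ T) (hmx : m * x ^ 2 ≤ 1) : m ≤ 2 * (T + 1) * (1 / (1 + x ^ q)) := by
  rcases le_total x 1 with h | h
  · exact le_two_mul_div_of_le_one hq hx h (by linarith) (by linarith)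
  · refine le_two_mul_div_of_one_le hq h (by linarith) ?_
    have := Real.rpow_le_rpow_of_exponent_le h hq2.le
    rw [Real.rpow_two] at this
    nlinarith

/-- At high frequencies `x^{2-q} m x^q = m x² ≤ 1`: a weight `|ξ|^{2-q}` is exactly what can be
afforded, which fixes the Hölder exponents of the noise term. -/
lemma spectral_weight_bound_mul {x T m : ℝ} (hq : 0 < q) (hq2 : q < 2) (hx : 0 ≤ x) (hm : 0 ≤ m)
    (hmT : m ≤ T) (hmx : m * x ^ 2 ≤ 1) :
    x ^ (2 - q) * m ≤ 2 * (T + 1) * (1 / (1 + x ^ q)) := by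
  rcases le_total x 1 with h | h
  · refine le_two_mul_div_of_le_one hq hx h (by linarith) ?_
    have := Real.rpow_le_one hx h (by linarith : 0 ≤ 2 - q)
    nlinarith
  · refine le_two_mul_div_of_one_le hq h (by linarith) ?_
    have : x ^ (2 - q) * m * x ^ q = m * x ^ 2 := by
      rw [mul_right_comm, ← Real.rpow_add (by linarith), ← Real.rpow_two]
      ring_nf
    linarith

/-- Write `m = m^{(2-q)/2} m^{q/2}`. The first factor is at most `h^{(2-q)/2}`, and `m^{q/2} x^q =
(m x²)^{q/2} ≤ 1`. -/
lemma spectral_weight_bound_time {x T m h : ℝ} (hq : 0 < q) (hq2 : q < 2) (hx : 0 ≤ x)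
    (hm : 0 ≤ m) (hh : 0 ≤ h) (hhT : h ≤ T) (hmh : m ≤ h) (hmx : m * x ^ 2 ≤ 1) :
    m ≤ 2 * ((T + 1) * h ^ ((2 - q) / 2)) * (1 / (1 + x ^ q)) := by
  have hT : 0 ≤ T := hh.trans hhT
  have hhn : 0 ≤ h ^ ((2 - q) / 2) := Real.rpow_nonneg hh _
  have split : ∀ y : ℝ, 0 ≤ y → y = y ^ ((2 - q) / 2) * y ^ (q / 2) := by
    intro y hy
    rw [← Real.rpow_add_of_nonneg hy (by linarith) (by linarith)]
    ring_nf
    rw [Real.rpow_one]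
  rcases le_total x 1 with h1 | h1
  · refine le_two_mul_div_of_le_one hq hx h1 (by positivity) (hmh.trans ?_)
    have h2 : h ^ (q / 2) ≤ T + 1 := by
      refine (Real.rpow_le_rpow hh (by linarith : h ≤ T + 1) (by linarith)).trans ?_
      exact (Real.rpow_le_rpow_of_exponent_le (by linarith) (by linarith : q / 2 ≤ 1)).trans_eq
        (Real.rpow_one _)
    calc h = h ^ ((2 - q) / 2) * h ^ (q / 2) := split h hh
      _ ≤ (T + 1) * h ^ ((2 - q) / 2) := by nlinarith
  · refine le_two_mul_div_of_one_le hq h1 (by positivity) ?_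
    have e1 : m ^ ((2 - q) / 2) ≤ h ^ ((2 - q) / 2) := Real.rpow_le_rpow hm hmh (by linarith)
    have e2 : m ^ (q / 2) * x ^ q ≤ 1 := by
      have : x ^ q = (x ^ 2) ^ (q / 2) := by
        rw [← Real.rpow_two, ← Real.rpow_mul hx]; ring_nf
      rw [this, ← Real.mul_rpow hm (by positivity)]
      exact Real.rpow_le_one (by positivity) hmx (by linarith)
    have e3 : 0 ≤ m ^ ((2 - q) / 2) := Real.rpow_nonneg hm _
    have e4 : m * x ^ q = m ^ ((2 - q) / 2) * (m ^ (q / 2) * x ^ q) := by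
      rw [← mul_assoc, ← split m hm]
    rw [e4]
    nlinarith [mul_nonneg hT hhn]

/-- Tonelli with the time integral innermost: it suffices to estimate at each fixed frequency. -/
lemma eLpNorm_timeSpectral_le (hq : 0 < q) (h : spectralWeight q μ < ∞) {F : ℝ × Space d → ℂ}
    (hF : StronglyMeasurable F) {B : ℝ} (hB : 0 ≤ B)
    (hle : ∀ ξ, ∫⁻ s in Ioi (0 : ℝ), ‖F (s, ξ)‖ₑ ^ 2 ≤
      ENNReal.ofReal (B * (1 / (1 + ‖ξ‖ ^ q)))) :
    eLpNorm F 2 (timeSpectral μ) ≤ (ENNReal.ofReal B * spectralWeight q μ) ^ (1 / 2 : ℝ) := by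
  have := sigmaFinite_of_spectralWeight hq h
  rw [eLpNorm_eq_lintegral_rpow_enorm_toReal (by norm_num) (by norm_num)]
  refine ENNReal.rpow_le_rpow ?_ (by norm_num)
  simp only [ENNReal.toReal_ofNat, ENNReal.rpow_two]
  rw [lintegral_prod_symm _ (hF.enorm.pow_const 2).aemeasurable, spectralWeight,
    ← lintegral_const_mul' _ _ ENNReal.ofReal_ne_top]
  refine lintegral_mono fun ξ => (hle ξ).trans_eq ?_
  rw [ENNReal.ofReal_mul hB]

lemma measurable_heatIntegrand (t : ℝ) (x : Space d) :
    Measurable (Function.uncurry (heatIntegrand t x)) := by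
  have h : Measurable fun p : ℝ × Space d => heatKernel (t - p.1) (x - p.2) :=
    measurable_heatKernel.comp (by fun_prop : Measurable fun p : ℝ × Space d => (t - p.1, x - p.2))
  exact Measurable.ite (measurableSet_lt measurable_fst measurable_const) h measurable_const

lemma stronglyMeasurable_sliceFourier_heatIntegrand (t : ℝ) (x : Space d) :
    StronglyMeasurable (sliceFourier (heatIntegrand t x)) :=
  stronglyMeasurable_fourierL1 (measurable_heatIntegrand t x)

lemma sliceFourier_heatIntegrand_of_lt {s t : ℝ} (hs : s < t) (x ξ : Space d) :
    sliceFourier (heatIntegrand t x) (s, ξ) =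
      Complex.exp (-(Complex.I * ((inner ℝ ξ x : ℝ) : ℂ))) *
        ((Real.exp (-((t - s) * ‖ξ‖ ^ 2 / 2)) : ℝ) : ℂ) := by
  have : heatIntegrand t x s = fun y => heatKernel (t - s) (x - y) := by
    ext y; simp [heatIntegrand, hs]
  rw [sliceFourier, this, fourierL1_heatKernel (sub_pos.2 hs)]

lemma sliceFourier_heatIntegrand_of_le {s t : ℝ} (hs : t ≤ s) (x ξ : Space d) :
    sliceFourier (heatIntegrand t x) (s, ξ) = 0 := by
  have : heatIntegrand t x s = fun _ => 0 := by
    ext y; simp [heatIntegrand, not_lt.2 hs]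
  simp [sliceFourier, this, fourierL1]

lemma norm_cexp_neg_I_mul_ofReal (a : ℝ) : ‖Complex.exp (-(Complex.I * (a : ℂ)))‖ = 1 := by
  rw [show -(Complex.I * (a : ℂ)) = ((-a : ℝ) : ℂ) * Complex.I by push_cast; ring,
    Complex.norm_exp_ofReal_mul_I]

lemma norm_cexp_sub_cexp_le (a b : ℝ) :
    ‖Complex.exp (-(Complex.I * (a : ℂ))) - Complex.exp (-(Complex.I * (b : ℂ)))‖ ≤ |a - b| := by
  have h := Real.norm_exp_I_mul_ofReal_sub_one_le (x := b - a)
  have e : Complex.exp (-(Complex.I * (a : ℂ))) - Complex.exp (-(Complex.I * (b : ℂ))) =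
      Complex.exp (-(Complex.I * (b : ℂ))) * (Complex.exp (Complex.I * ((b - a : ℝ) : ℂ)) - 1) := by
    rw [mul_sub, ← Complex.exp_add, mul_one]
    congr 2; push_cast; ring
  rw [e, norm_mul, norm_cexp_neg_I_mul_ofReal, one_mul, abs_sub_comm]
  exact h

/-- Interpolation between the trivial bound `y ≤ 2` and the Lipschitz bound `y ≤ c`, for differences
of unit phases. -/
lemma sq_le_four_mul_rpow {y c κ : ℝ} (hy : 0 ≤ y) (hy2 : y ≤ 2) (hc : 0 ≤ c) (hyc : y ≤ c)
    (hκ0 : 0 ≤ κ) (hκ : κ ≤ 2) : y ^ 2 ≤ 4 * c ^ κ := by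
  rcases le_total c 1 with h | h
  · have h1 : c ^ 2 ≤ c ^ κ := by
      rw [← Real.rpow_two]
      rcases hc.eq_or_lt with rfl | h0
      · rw [Real.zero_rpow two_ne_zero]; exact Real.rpow_nonneg le_rfl _
      · exact Real.rpow_le_rpow_of_exponent_ge h0 h hκ
    nlinarith [Real.rpow_nonneg hc κ]
  · have := Real.one_le_rpow h hκ0
    nlinarith

lemma enorm_sq_eq_ofReal (z : ℂ) : ‖z‖ₑ ^ 2 = ENNReal.ofReal (‖z‖ ^ 2) := by
  rw [← ofReal_norm, ENNReal.ofReal_pow (norm_nonneg _)]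

lemma lintegral_indicator_exp_le {r t a c : ℝ} (hc : 0 ≤ c) (f : ℝ → ℝ≥0∞)
    (hf : ∀ s ∈ Ioo r t, f s ≤ ENNReal.ofReal (c * Real.exp (-((t - s) * a)))) {m : ℝ}
    (hm : ∫⁻ s in Ioc r t, ENNReal.ofReal (Real.exp (-((t - s) * a))) = ENNReal.ofReal m) :
    ∫⁻ s in Ioc r t, f s ≤ ENNReal.ofReal (c * m) := by
  rw [ENNReal.ofReal_mul hc, ← hm, ← lintegral_const_mul' _ _ ENNReal.ofReal_ne_top]
  -- The end point `s = t`, where the integrand vanishes instead of following the exponential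
  -- formula, is discarded.
  rw [← restrict_Ioo_eq_restrict_Ioc]
  refine setLIntegral_mono' measurableSet_Ioo fun s hs => ?_
  rw [← ENNReal.ofReal_mul hc]
  exact hf s hs

lemma lintegral_Ioi_eq_Ioc {r t : ℝ} (hrt : r ≤ t) {f : ℝ → ℝ≥0∞} (hf : ∀ s, t ≤ s → f s = 0) :
    ∫⁻ s in Ioi r, f s = ∫⁻ s in Ioc r t, f s := by
  rw [← Ioc_union_Ioi_eq_Ioi hrt, lintegral_union measurableSet_Ioi
    (Set.disjoint_left.2 fun s h1 h2 => not_lt.2 h1.2 h2)]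
  rw [setLIntegral_congr_fun measurableSet_Ioi (g := fun _ => 0) fun s hs => hf s (le_of_lt hs)]
  simp

lemma eLpNorm_heatIntegrand_le (hq : 0 < q) (hq2 : q < 2) (h : spectralWeight q μ < ∞)
    {t T : ℝ} (ht : 0 ≤ t) (htT : t ≤ T) (x : Space d) :
    eLpNorm (sliceFourier (heatIntegrand t x)) 2 (timeSpectral μ) ≤
      (ENNReal.ofReal (2 * (T + 1)) * spectralWeight q μ) ^ (1 / 2 : ℝ) := by
  refine eLpNorm_timeSpectral_le hq h (stronglyMeasurable_sliceFourier_heatIntegrand t x)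
    (by linarith) fun ξ => ?_
  obtain ⟨m, hm0, hm1, hm2, hm3⟩ := exists_lintegral_exp_eq ht (sq_nonneg ‖ξ‖)
  rw [lintegral_Ioi_eq_Ioc ht fun s hs => by simp [sliceFourier_heatIntegrand_of_le hs]]
  refine (lintegral_indicator_exp_le zero_le_one _ (fun s hs => ?_) hm3).trans
    (ENNReal.ofReal_le_ofReal ?_)
  · rw [sliceFourier_heatIntegrand_of_lt hs.2, enorm_sq_eq_ofReal, norm_mul,
      norm_cexp_neg_I_mul_ofReal, one_mul, one_mul, Complex.norm_real,
      Real.norm_of_nonneg (Real.exp_pos _).le, ← Real.exp_nat_mul]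
    apply le_of_eq
    congr 2; push_cast; ring
  · rw [one_mul]
    exact spectral_weight_bound hq hq2 (norm_nonneg ξ) hm0 (by linarith) hm2

/-- Only the phase depends on `x`. Its squared increment is at most `4(|ξ||x-x'|)^{2-q}`, and the
weight absorbs `|ξ|^{2-q}`. -/
lemma eLpNorm_heatIntegrand_space_le (hq : 0 < q) (hq2 : q < 2) (h : spectralWeight q μ < ∞)
    {t T : ℝ} (ht : 0 ≤ t) (htT : t ≤ T) (x x' : Space d) :
    eLpNorm (fun z => sliceFourier (heatIntegrand t x) z - sliceFourier (heatIntegrand t x') z) 2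
      (timeSpectral μ) ≤
      (ENNReal.ofReal (8 * (T + 1) * ‖x - x'‖ ^ (2 - q)) * spectralWeight q μ) ^ (1 / 2 : ℝ) := by
  have hT : 0 ≤ T := ht.trans htT
  have hη : 0 ≤ ‖x - x'‖ ^ (2 - q) := Real.rpow_nonneg (norm_nonneg _) _
  refine eLpNorm_timeSpectral_le hq h ((stronglyMeasurable_sliceFourier_heatIntegrand t x).sub
    (stronglyMeasurable_sliceFourier_heatIntegrand t x')) (by positivity) fun ξ => ?_
  obtain ⟨m, hm0, hm1, hm2, hm3⟩ := exists_lintegral_exp_eq ht (sq_nonneg ‖ξ‖)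
  rw [lintegral_Ioi_eq_Ioc ht fun s hs => by simp [sliceFourier_heatIntegrand_of_le hs]]
  have hin : |inner ℝ ξ x - inner ℝ ξ x'| ≤ ‖ξ‖ * ‖x - x'‖ := by
    rw [← inner_sub_right]; exact abs_real_inner_le_norm _ _
  refine (lintegral_indicator_exp_le (c := 4 * (‖ξ‖ * ‖x - x'‖) ^ (2 - q)) (by positivity) _
    (fun s hs => ?_) hm3).trans (ENNReal.ofReal_le_ofReal ?_)
  · rw [Pi.sub_apply, sliceFourier_heatIntegrand_of_lt hs.2, sliceFourier_heatIntegrand_of_lt hs.2,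
      enorm_sq_eq_ofReal, ← sub_mul, norm_mul, mul_pow]
    refine ENNReal.ofReal_le_ofReal (mul_le_mul ?_ ?_ (by positivity) (by positivity))
    · refine sq_le_four_mul_rpow (norm_nonneg _) ?_ (by positivity)
        ((norm_cexp_sub_cexp_le _ _).trans hin) (by linarith) (by linarith)
      refine (norm_sub_le _ _).trans ?_
      rw [norm_cexp_neg_I_mul_ofReal, norm_cexp_neg_I_mul_ofReal]; norm_num
    · rw [Complex.norm_real, Real.norm_of_nonneg (Real.exp_pos _).le, ← Real.exp_nat_mul]
      apply le_of_eq
      congr 1; push_cast; ring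
  · have := spectral_weight_bound_mul hq hq2 (norm_nonneg ξ) hm0 (by linarith : m ≤ T) hm2
    rw [Real.mul_rpow (norm_nonneg _) (norm_nonneg _)]
    nlinarith

lemma sq_one_sub_exp_le {a θ : ℝ} (ha : 0 ≤ a) (hθ : 0 ≤ θ) (hθ1 : θ ≤ 1) :
    (1 - Real.exp (-(a / 2))) ^ 2 ≤ a ^ θ := by
  have h1 : 0 ≤ 1 - Real.exp (-(a / 2)) := by
    have := Real.exp_le_one_iff.2 (by linarith : -(a / 2) ≤ 0)
    linarith
  have h2 : 1 - Real.exp (-(a / 2)) ≤ 1 := by linarith [Real.exp_pos (-(a / 2))]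
  have h3 : 1 - Real.exp (-(a / 2)) ≤ a / 2 := by linarith [Real.add_one_le_exp (-(a / 2))]
  rcases le_total a 1 with h | h
  · have : a ≤ a ^ θ := by
      rcases ha.eq_or_lt with rfl | h0
      · exact Real.rpow_nonneg le_rfl _
      · simpa using Real.rpow_le_rpow_of_exponent_ge h0 h hθ1
    nlinarith
  · have := Real.one_le_rpow h hθ
    nlinarith

lemma eLpNorm_heatIntegrand_time_le (hq : 0 < q) (hq2 : q < 2) (h : spectralWeight q μ < ∞)
    {t T η : ℝ} (ht : 0 ≤ t) (hη : 0 ≤ η) (htT : t + η ≤ T) (x : Space d) :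
    eLpNorm (fun z => sliceFourier (heatIntegrand (t + η) x) z -
      sliceFourier (heatIntegrand t x) z) 2 (timeSpectral μ) ≤
      (ENNReal.ofReal (4 * (T + 1) * η ^ ((2 - q) / 2)) * spectralWeight q μ) ^ (1 / 2 : ℝ) := by
  have hT : 0 ≤ T := by linarith
  have hηp : 0 ≤ η ^ ((2 - q) / 2) := Real.rpow_nonneg hη _
  refine eLpNorm_timeSpectral_le hq h ((stronglyMeasurable_sliceFourier_heatIntegrand _ x).sub
    (stronglyMeasurable_sliceFourier_heatIntegrand t x)) (by positivity) fun ξ => ?_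
  have hw : 0 ≤ 1 / (1 + ‖ξ‖ ^ q) := by
    have := Real.rpow_nonneg (norm_nonneg ξ) q
    positivity
  obtain ⟨m, hm0, hm1, hm2, hm3⟩ := exists_lintegral_exp_eq ht (sq_nonneg ‖ξ‖)
  obtain ⟨m', hm0', hm1', hm2', hm3'⟩ := exists_lintegral_exp_eq
    (by linarith : t ≤ t + η) (sq_nonneg ‖ξ‖)
  rw [lintegral_Ioi_eq_Ioc (by linarith : 0 ≤ t + η) fun s hs => by
    simp [sliceFourier_heatIntegrand_of_le hs,
      sliceFourier_heatIntegrand_of_le ((by linarith : t ≤ t + η).trans hs)],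
    ← Ioc_union_Ioc_eq_Ioc ht (by linarith : t ≤ t + η), lintegral_union measurableSet_Ioc
      (Set.disjoint_left.2 fun s h1 h2 => not_lt.2 h1.2 h2.1)]
  -- The two terms correspond to `(0,t]`, where the kernel is damped by a further `e^{-η|ξ|²/2}`,
  -- and to `(t,t+η]`, where only the later kernel is present.
  have hsplit : 4 * (T + 1) * η ^ ((2 - q) / 2) * (1 / (1 + ‖ξ‖ ^ q)) =
      2 * (T + 1) * (1 / (1 + ‖ξ‖ ^ q)) * η ^ ((2 - q) / 2) +
      2 * ((T + 1) * η ^ ((2 - q) / 2)) * (1 / (1 + ‖ξ‖ ^ q)) := by ring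
  rw [hsplit, ENNReal.ofReal_add (by positivity) (by positivity)]
  refine add_le_add ?_ ?_
  · refine (lintegral_indicator_exp_le (c := (η * ‖ξ‖ ^ 2) ^ ((2 - q) / 2)) (by positivity) _
      (fun s hs => ?_) hm3).trans (ENNReal.ofReal_le_ofReal ?_)
    · rw [Pi.sub_apply, sliceFourier_heatIntegrand_of_lt hs.2,
        sliceFourier_heatIntegrand_of_lt (by linarith [hs.2]),
        enorm_sq_eq_ofReal, ← mul_sub, norm_mul, norm_cexp_neg_I_mul_ofReal, one_mul,
        ← Complex.ofReal_sub, Complex.norm_real, Real.norm_eq_abs, sq_abs]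
      refine ENNReal.ofReal_le_ofReal ?_
      have e : Real.exp (-((t + η - s) * ‖ξ‖ ^ 2 / 2)) - Real.exp (-((t - s) * ‖ξ‖ ^ 2 / 2)) =
          -((1 - Real.exp (-(η * ‖ξ‖ ^ 2 / 2))) * Real.exp (-((t - s) * ‖ξ‖ ^ 2 / 2))) := by
        have : -((t + η - s) * ‖ξ‖ ^ 2 / 2) =
          -(η * ‖ξ‖ ^ 2 / 2) + -((t - s) * ‖ξ‖ ^ 2 / 2) := by ring
        rw [this, Real.exp_add]
        ring
      rw [e, neg_sq, mul_pow, ← Real.exp_nat_mul]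
      refine mul_le_mul (sq_one_sub_exp_le (by positivity) (by linarith) (by linarith))
        (le_of_eq ?_) (Real.exp_pos _).le (by positivity)
      congr 1; push_cast; ring
    · have := spectral_weight_bound_mul hq hq2 (norm_nonneg ξ) hm0 (by linarith : m ≤ T) hm2
      rw [Real.mul_rpow hη (by positivity), ← Real.rpow_two, ← Real.rpow_mul (norm_nonneg _),
        show (2 : ℝ) * ((2 - q) / 2) = 2 - q by ring]
      nlinarith
  · refine (lintegral_indicator_exp_le (c := 1) zero_le_one _
      (fun s hs => ?_) hm3').trans (ENNReal.ofReal_le_ofReal ?_)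
    · rw [Pi.sub_apply, sliceFourier_heatIntegrand_of_le hs.1.le, sub_zero, one_mul,
        sliceFourier_heatIntegrand_of_lt hs.2, enorm_sq_eq_ofReal, norm_mul,
        norm_cexp_neg_I_mul_ofReal, one_mul, Complex.norm_real,
        Real.norm_of_nonneg (Real.exp_pos _).le, ← Real.exp_nat_mul]
      apply le_of_eq
      congr 2; push_cast; ring
    · rw [one_mul]
      exact spectral_weight_bound_time hq hq2 (norm_nonneg ξ) hm0' hη (by linarith)
        (by linarith) hm2'

end SpectralIncrements

/-! ### `L^p` bounds tested by duality against bounded functions. -/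

section DualBound

variable {Ω : Type*} [MeasurableSpace Ω] {P : Measure Ω} {r : ℝ}

/-- `f` is bounded by `a` as a functional on the unit ball of `L^r`, tested on bounded functions. -/
def DualBound (P : Measure Ω) (r : ℝ) (f : Ω → ℝ≥0∞) (a : ℝ≥0∞) : Prop :=
  ∀ Y : Ω → ℝ≥0∞, Measurable Y → (∃ K : ℝ≥0, ∀ ω, Y ω ≤ K) →
    ∫⁻ ω, Y ω * f ω ∂P ≤ a * (∫⁻ ω, Y ω ^ r ∂P) ^ (1 / r)

lemma DualBound.mono {f g : Ω → ℝ≥0∞} {a b : ℝ≥0∞} (hg : DualBound P r g b)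
    (hfg : ∀ᵐ ω ∂P, f ω ≤ g ω) (hab : b ≤ a) : DualBound P r f a := fun Y hY hK =>
  (lintegral_mono_ae (hfg.mono fun _ h => mul_le_mul_right h _)).trans
    ((hg Y hY hK).trans (by gcongr))

lemma DualBound.add {f g : Ω → ℝ≥0∞} {a b : ℝ≥0∞} (hf : DualBound P r f a)
    (hg : DualBound P r g b) (hfm : AEMeasurable f P) :
    DualBound P r (fun ω => f ω + g ω) (a + b) := fun Y hY hK => by
  simp only [mul_add]
  have h1 : AEMeasurable (fun ω => Y ω * f ω) P := hY.aemeasurable.mul hfm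
  rw [lintegral_add_left' h1, add_mul]
  exact add_le_add (hf Y hY hK) (hg Y hY hK)

/-- Hölder's inequality. -/
lemma DualBound.of_lintegral_rpow_le {p : ℝ} (hpr : p.HolderConjugate r) {f : Ω → ℝ≥0∞}
    {a : ℝ≥0∞} (hf : AEMeasurable f P) (h : (∫⁻ ω, f ω ^ p ∂P) ^ (1 / p) ≤ a) :
    DualBound P r f a := fun Y hY _ => by
  have := ENNReal.lintegral_mul_le_Lp_mul_Lq P hpr hf hY.aemeasurable
  simp only [Pi.mul_apply, mul_comm (f _)] at this
  exact this.trans (by gcongr)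

lemma DualBound.of_eLpNorm_le {p : ℝ≥0} (hp : p ≠ 0) (hpr : (p : ℝ).HolderConjugate r) {X : Ω → ℝ}
    {a : ℝ≥0∞} (hX : AEStronglyMeasurable X P) (h : eLpNorm X p P ≤ a) :
    DualBound P r (fun ω => ‖X ω‖ₑ) a := by
  refine DualBound.of_lintegral_rpow_le hpr hX.enorm ?_
  rwa [eLpNorm_nnreal_eq_lintegral hp] at h

lemma DualBound.const [IsProbabilityMeasure P] {p : ℝ} (hpr : p.HolderConjugate r) (c : ℝ≥0∞) :
    DualBound P r (fun _ => c) c := by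
  refine DualBound.of_lintegral_rpow_le hpr aemeasurable_const ?_
  rw [lintegral_const, measure_univ, mul_one, ← ENNReal.rpow_mul, mul_one_div_cancel hpr.ne_zero,
    ENNReal.rpow_one]

lemma DualBound.const_mul {f : Ω → ℝ≥0∞} {a c : ℝ≥0∞} (hf : DualBound P r f a) (hc : c ≠ ∞) :
    DualBound P r (fun ω => c * f ω) (c * a) := fun Y hY hK => by
  simp only [mul_left_comm _ c]
  rw [lintegral_const_mul' _ _ hc, mul_assoc]
  gcongr
  exact hf Y hY hK

lemma lintegral_mul_lintegral_swap {Z : Type*} [MeasurableSpace Z] {ν : Measure Z} [SFinite ν]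
    [SFinite P] {f : Z → Ω → ℝ≥0∞} (hf : Measurable (Function.uncurry f)) {k : Z → ℝ≥0∞}
    (hk : Measurable k) {Y : Ω → ℝ≥0∞} (hY : Measurable Y) :
    ∫⁻ ω, Y ω * ∫⁻ z, f z ω * k z ∂ν ∂P = ∫⁻ z, (∫⁻ ω, Y ω * f z ω ∂P) * k z ∂ν := by
  have h1 : ∀ ω, Y ω * ∫⁻ z, f z ω * k z ∂ν = ∫⁻ z, Y ω * (f z ω * k z) ∂ν := fun ω =>
    (lintegral_const_mul _ ((hf.comp (measurable_id.prodMk measurable_const)).mul hk)).symm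
  have h2 : ∀ z, (∫⁻ ω, Y ω * f z ω ∂P) * k z = ∫⁻ ω, Y ω * (f z ω * k z) ∂P := fun z => by
    have h3 : Measurable fun ω => Y ω * f z ω :=
      hY.mul (hf.comp (measurable_const.prodMk measurable_id))
    rw [← lintegral_mul_const _ h3]
    simp only [mul_assoc]
  simp only [h1, h2]
  refine lintegral_lintegral_swap ?_
  have h3 : Measurable fun q : Ω × Z => f q.2 q.1 := hf.comp measurable_swap
  exact ((hY.comp measurable_fst).mul (h3.mul (hk.comp measurable_snd))).aemeasurable

/-- Minkowski's integral inequality in dual form. -/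
lemma DualBound.lintegral {Z : Type*} [MeasurableSpace Z] {ν : Measure Z} [SFinite ν]
    [SFinite P] {f : Z → Ω → ℝ≥0∞} (hf : Measurable (Function.uncurry f)) {k : Z → ℝ≥0∞}
    (hk : Measurable k) {a : ℝ≥0∞} (h : ∀ᵐ z ∂ν, DualBound P r (f z) a) :
    DualBound P r (fun ω => ∫⁻ z, f z ω * k z ∂ν) (a * ∫⁻ z, k z ∂ν) := fun Y hY hK => by
  rw [lintegral_mul_lintegral_swap hf hk hY, mul_right_comm, ← lintegral_const_mul _ hk]
  exact lintegral_mono_ae (h.mono fun z hz => mul_le_mul_left (hz Y hY hK) _)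

/-- A dual bound is a bound of the `L^p` norm. -/
lemma DualBound.lintegral_rpow_le [IsFiniteMeasure P] {p : ℝ} (hpr : p.HolderConjugate r)
    {f : Ω → ℝ≥0∞} {a : ℝ≥0∞} (hf : Measurable f) (h : DualBound P r f a) :
    ∫⁻ ω, f ω ^ p ∂P ≤ a ^ p := by
  have hp : 0 < p := hpr.pos
  have hp1 : 0 < p - 1 := hpr.sub_one_pos
  have key : ∀ K : ℕ, ∫⁻ ω, (min (f ω) K) ^ p ∂P ≤ a ^ p := by
    intro K
    set N := ∫⁻ ω, (min (f ω) K) ^ p ∂P with hN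
    have hNtop : N ≠ ∞ := by
      refine ((lintegral_mono (g := fun _ => (K : ℝ≥0∞) ^ p) fun ω =>
        ENNReal.rpow_le_rpow (min_le_right _ _) hp.le).trans_lt ?_).ne
      rw [lintegral_const]
      exact ENNReal.mul_lt_top (ENNReal.rpow_lt_top_of_nonneg hp.le (ENNReal.natCast_ne_top K))
        (measure_lt_top P _)
    rcases eq_or_ne N 0 with h0 | h0
    · rw [h0]; exact zero_le
    -- The extremal test function of duality, truncated to be bounded. Since `(p-1)r = p`, it yields
    -- `N ≤ a N^{1/r}`, and truncation makes `N` finite so that division is allowed.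
    have h1 := h (fun ω => (min (f ω) K) ^ (p - 1)) ((hf.min measurable_const).pow_const _)
      ⟨(K : ℝ≥0) ^ (p - 1), fun ω => by
        rw [ENNReal.coe_rpow_of_nonneg _ hp1.le]
        exact ENNReal.rpow_le_rpow (by simp) hp1.le⟩
    have h2 : N ≤ ∫⁻ ω, (min (f ω) K) ^ (p - 1) * f ω ∂P := by
      refine lintegral_mono fun ω => ?_
      calc (min (f ω) K) ^ p = (min (f ω) K) ^ (p - 1) * (min (f ω) K) := by
            conv_rhs => rw [← ENNReal.rpow_one (min (f ω) (K : ℝ≥0∞))]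
            rw [← ENNReal.rpow_mul, one_mul, ← ENNReal.rpow_add_of_nonneg _ _ hp1.le zero_le_one,
              sub_add_cancel]
        _ ≤ _ := by gcongr; exact min_le_left _ _
    have h3 : ∀ ω, ((min (f ω) K) ^ (p - 1)) ^ r = (min (f ω) K) ^ p := fun ω => by
      rw [← ENNReal.rpow_mul, hpr.sub_one_mul_conj]
    simp only [h3] at h1
    have h4 : N ≤ a * N ^ (1 / r) := h2.trans h1
    have h5 : N = N ^ (1 / p) * N ^ (1 / r) := by
      rw [← ENNReal.rpow_add _ _ h0 hNtop, one_div, one_div, hpr.inv_add_inv_eq_one,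
        ENNReal.rpow_one]
    have h6 : N ^ (1 / r) ≠ 0 := by simp [ENNReal.rpow_eq_zero_iff, h0, hNtop]
    have h7 : N ^ (1 / r) ≠ ∞ :=
      ENNReal.rpow_ne_top_of_nonneg (by have := hpr.symm.pos; positivity) hNtop
    have h8 : N ^ (1 / p) ≤ a := by
      rw [h5] at h4
      rw [← h5] at h4
      have : N ^ (1 / p) * N ^ (1 / r) ≤ a * N ^ (1 / r) := h5 ▸ h4
      exact (ENNReal.mul_le_mul_iff_left h6 h7).1 this
    have h9 := ENNReal.rpow_le_rpow h8 hp.le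
    rwa [← ENNReal.rpow_mul, one_div_mul_cancel hp.ne', ENNReal.rpow_one] at h9
  have hsup : ∀ ω, f ω ^ p = ⨆ K : ℕ, (min (f ω) K) ^ p := by
    intro ω
    refine le_antisymm ?_ (iSup_le fun K => ENNReal.rpow_le_rpow (min_le_left _ _) hp.le)
    have h1 : Tendsto (fun K : ℕ => min (f ω) (K : ℝ≥0∞)) atTop (𝓝 (min (f ω) ∞)) :=
      tendsto_const_nhds.min ENNReal.tendsto_nat_nhds_top
    rw [min_eq_left le_top] at h1
    exact le_of_tendsto' ((ENNReal.continuous_rpow_const.tendsto _).comp h1) fun K =>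
      le_iSup (fun K : ℕ => (min (f ω) (K : ℝ≥0∞)) ^ p) K
  simp only [hsup]
  rw [lintegral_iSup (fun K => (hf.min measurable_const).pow_const p)]
  · exact iSup_le key
  · intro K K' hKK' ω
    exact ENNReal.rpow_le_rpow (min_le_min le_rfl (by exact_mod_cast hKK')) hp.le

end DualBound

/-! ### Heat potentials and Gronwall's lemma. -/

section HeatPotential

variable {d : ℕ} {Ω : Type*} [MeasurableSpace Ω] {P : Measure Ω} {r : ℝ}

/-- The measure `ds ⊗ dy` on `(0,t] × ℝ^d`. -/
noncomputable abbrev slab (d : ℕ) (t : ℝ) : Measure (ℝ × Space d) :=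
  (volume.restrict (Ioc 0 t)).prod volume

/-- The heat kernel seen from `(t,x)`, with values in `[0,∞]`. -/
noncomputable def heatWeight (t : ℝ) (x : Space d) (z : ℝ × Space d) : ℝ≥0∞ :=
  ENNReal.ofReal (heatKernel (t - z.1) (x - z.2))

/-- The heat potential `∫_0^t ∫ v(s,y) G_{t-s}(x-y) dy ds` of a non-negative function. -/
noncomputable def heatPotential (v : ℝ × Space d → ℝ≥0∞) (t : ℝ) (x : Space d) : ℝ≥0∞ :=
  ∫⁻ z, v z * heatWeight t x z ∂(slab d t)

lemma measurable_heatWeight (t : ℝ) (x : Space d) : Measurable (heatWeight t x) :=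
  (measurable_heatKernel.comp
    (by fun_prop : Measurable fun p : ℝ × Space d => (t - p.1, x - p.2))).ennreal_ofReal

/-- The kernel has mass one in space. The slab may stop at `h < t`, as is needed for the early part
of a shifted drift. -/
lemma lintegral_mul_heatWeight {h : ℝ} (t : ℝ) (hht : h ≤ t) (x : Space d) {φ : ℝ → ℝ≥0∞}
    (hφ : Measurable φ) :
    ∫⁻ z, φ z.1 * heatWeight t x z ∂(slab d h) = ∫⁻ s in Ioc 0 h, φ s := by
  have hm : Measurable fun z : ℝ × Space d => φ z.1 * heatWeight t x z :=
    (hφ.comp measurable_fst).mul (measurable_heatWeight t x)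
  rw [lintegral_prod _ hm.aemeasurable, ← restrict_Ioo_eq_restrict_Ioc]
  refine setLIntegral_congr_fun measurableSet_Ioo fun s hs => ?_
  have hst : 0 < t - s := by linarith [hs.2]
  have hk : Measurable fun y : Space d => heatWeight t x (s, y) :=
    (measurable_heatWeight t x).comp (measurable_const.prodMk measurable_id)
  simp only
  rw [lintegral_const_mul _ hk]
  simp only [heatWeight]
  rw [lintegral_heatKernel hst, mul_one]

lemma lintegral_heatWeight {h : ℝ} (t : ℝ) (hht : h ≤ t) (x : Space d) :
    ∫⁻ z, heatWeight t x z ∂(slab d h) = ENNReal.ofReal h := by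
  have := lintegral_mul_heatWeight t hht x (φ := fun _ => 1) measurable_const
  simpa using this

lemma ae_slab_mem (d : ℕ) (t : ℝ) : ∀ᵐ z ∂(slab d t), z.1 ∈ Ioc 0 t := by
  have h : ∀ᵐ s ∂(volume.restrict (Ioc (0 : ℝ) t)), s ∈ Ioc 0 t :=
    ae_restrict_mem measurableSet_Ioc
  exact Measure.quasiMeasurePreserving_fst.ae h

lemma measurable_heatPotential {v : ℝ → Space d → Ω → ℝ≥0∞}
    (hv : Measurable fun z : (ℝ × Space d) × Ω => v z.1.1 z.1.2 z.2) (t : ℝ) (x : Space d) :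
    Measurable fun ω => heatPotential (fun z => v z.1 z.2 ω) t x := by
  have h : Measurable fun q : Ω × (ℝ × Space d) => v q.2.1 q.2.2 q.1 * heatWeight t x q.2 :=
    (hv.comp measurable_swap).mul ((measurable_heatWeight t x).comp measurable_snd)
  exact h.lintegral_prod_right'

/-- The expectation is at most `M h`, by Tonelli. -/
lemma ae_lintegral_heatWeight_lt_top [SFinite P] {v : ℝ → Space d → Ω → ℝ≥0∞}
    (hv : Measurable fun z : (ℝ × Space d) × Ω => v z.1.1 z.1.2 z.2) {h t : ℝ} (hht : h ≤ t)
    {M : ℝ≥0∞} (hM : M ≠ ∞) (hvM : ∀ s ∈ Icc 0 h, ∀ y, ∫⁻ ω, v s y ω ∂P ≤ M) (x : Space d) :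
    ∀ᵐ ω ∂P, ∫⁻ z, v z.1 z.2 ω * heatWeight t x z ∂(slab d h) < ∞ := by
  have hm : Measurable fun q : Ω × (ℝ × Space d) => v q.2.1 q.2.2 q.1 * heatWeight t x q.2 :=
    (hv.comp measurable_swap).mul ((measurable_heatWeight t x).comp measurable_snd)
  refine ae_lt_top hm.lintegral_prod_right' ?_
  have e := lintegral_mul_lintegral_swap (P := P) (ν := slab d h)
    (f := fun z ω => v z.1 z.2 ω) hv (measurable_heatWeight t x) (Y := fun _ => 1) measurable_const
  simp only [one_mul] at e
  rw [e]
  refine ((lintegral_mono_ae (g := fun z => M * heatWeight t x z) ?_).trans_lt ?_).ne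
  · filter_upwards [ae_slab_mem d h] with z hz
    exact mul_le_mul_left (hvM z.1 ⟨hz.1.le, hz.2⟩ z.2) _
  · rw [lintegral_const_mul _ (measurable_heatWeight t x), lintegral_heatWeight t hht]
    exact ENNReal.mul_lt_top hM.lt_top ENNReal.ofReal_lt_top

/-- Gronwall's lemma for heat potentials, in dual form. -/
lemma DualBound.gronwall [IsProbabilityMeasure P] {v w : ℝ → Space d → Ω → ℝ≥0∞}
    (hv : Measurable fun z : (ℝ × Space d) × Ω => v z.1.1 z.1.2 z.2) {τ : ℝ} {L : ℝ≥0}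
    {a M : ℝ≥0∞} (hM : M ≠ ∞) (hvM : ∀ t ∈ Icc 0 τ, ∀ x, ∫⁻ ω, v t x ω ∂P ≤ M)
    (hw : ∀ t ∈ Icc 0 τ, ∀ x, DualBound P r (w t x) a)
    (hle : ∀ t ∈ Icc 0 τ, ∀ x, ∀ᵐ ω ∂P,
      v t x ω ≤ w t x ω + L * heatPotential (fun z => v z.1 z.2 ω) t x)
    {t : ℝ} (ht : t ∈ Icc 0 τ) (x : Space d) :
    DualBound P r (v t x) (2 * ENNReal.ofReal (Real.exp ((2 * L + 1) * τ)) * a) := by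
  intro Y hY hK
  obtain ⟨K, hK'⟩ := id hK
  set A := a * (∫⁻ ω, Y ω ^ r ∂P) ^ (1 / r) with hA
  -- With the weight `e^{-lt}` the integral operator has norm at most `L/l ≤ 1/2`; the `+ 1` keeps
  -- `l` positive when `L = 0`.
  set l : ℝ := 2 * L + 1 with hl
  have hl0 : 0 < l := by have := L.2; positivity
  set g : ℝ → Space d → ℝ≥0∞ := fun t x => ∫⁻ ω, Y ω * v t x ω ∂P with hg
  set S : ℝ≥0∞ := ⨆ (t : Icc 0 τ) (x : Space d), ENNReal.ofReal (Real.exp (-(l * t))) * g t x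
    with hS
  have hgS : ∀ t ∈ Icc 0 τ, ∀ x, g t x ≤ ENNReal.ofReal (Real.exp (l * t)) * S := by
    intro t ht x
    have h1 : ENNReal.ofReal (Real.exp (-(l * t))) * g t x ≤ S :=
      le_iSup₂ (f := fun (t : Icc 0 τ) (x : Space d) =>
        ENNReal.ofReal (Real.exp (-(l * t))) * g t x) ⟨t, ht⟩ x
    calc g t x = ENNReal.ofReal (Real.exp (l * t)) *
          (ENNReal.ofReal (Real.exp (-(l * t))) * g t x) := by
          rw [← mul_assoc, ← ENNReal.ofReal_mul (Real.exp_pos _).le, ← Real.exp_add,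
            add_neg_cancel, Real.exp_zero, ENNReal.ofReal_one, one_mul]
      _ ≤ _ := by gcongr
  -- The only use of the bounds `K` on `Y` and `M` on the first moments: they allow `S/2` to be
  -- absorbed and do not enter the final constant.
  have hStop : S ≠ ∞ := by
    refine ((iSup₂_le fun t x => ?_ : S ≤ K * M).trans_lt
      (ENNReal.mul_lt_top ENNReal.coe_lt_top hM.lt_top)).ne
    have h1 : ENNReal.ofReal (Real.exp (-(l * t))) ≤ 1 := by
      rw [← ENNReal.ofReal_one]
      refine ENNReal.ofReal_le_ofReal (Real.exp_le_one_iff.2 ?_)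
      have := mul_nonneg hl0.le t.2.1
      linarith
    have h2 : g t x ≤ K * M := by
      refine (lintegral_mono fun ω => mul_le_mul_left (hK' ω) _).trans ?_
      rw [lintegral_const_mul' _ _ ENNReal.coe_ne_top]
      gcongr
      exact hvM t t.2 x
    calc _ ≤ 1 * (K * M) := by gcongr
      _ = _ := one_mul _
  have hstep : ∀ t ∈ Icc 0 τ, ∀ x, g t x ≤ A + ENNReal.ofReal (Real.exp (l * t)) * (S / 2) := by
    intro t ht x
    have hpot := measurable_heatPotential hv t x
    have h1 : g t x ≤ ∫⁻ ω, Y ω * w t x ω ∂P +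
        L * ∫⁻ ω, Y ω * heatPotential (fun z => v z.1 z.2 ω) t x ∂P := by
      have h2 : Measurable fun ω => Y ω * heatPotential (fun z => v z.1 z.2 ω) t x := hY.mul hpot
      rw [← lintegral_const_mul _ h2, ← lintegral_add_right _ (h2.const_mul _)]
      refine lintegral_mono_ae ((hle t ht x).mono fun ω h => ?_)
      calc Y ω * v t x ω ≤ Y ω * (w t x ω + L * heatPotential (fun z => v z.1 z.2 ω) t x) := by
            gcongr
        _ = _ := by ring
    refine h1.trans (add_le_add (hw t ht x Y hY hK) ?_)
    have h3 := lintegral_mul_lintegral_swap (P := P) (ν := slab d t)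
      (f := fun z ω => v z.1 z.2 ω) hv (measurable_heatWeight t x) hY
    unfold heatPotential
    rw [h3]
    have h4 : ∫⁻ z, (∫⁻ ω, Y ω * v z.1 z.2 ω ∂P) * heatWeight t x z ∂(slab d t) ≤
        S * ∫⁻ s in Ioc 0 t, ENNReal.ofReal (Real.exp (l * s)) := by
      have hφ : Measurable fun s : ℝ => ENNReal.ofReal (Real.exp (l * s)) := by fun_prop
      rw [← lintegral_mul_heatWeight t le_rfl x hφ, ← lintegral_const_mul' _ _ hStop]
      refine lintegral_mono_ae ?_
      filter_upwards [ae_slab_mem d t] with z hz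
      rw [← mul_assoc]
      refine mul_le_mul_left ?_ _
      rw [mul_comm]
      exact hgS z.1 ⟨hz.1.le, hz.2.trans ht.2⟩ z.2
    refine (mul_le_mul_right h4 _).trans ?_
    obtain ⟨m, hm0, -, hm2, hm3⟩ := exists_lintegral_exp_eq ht.1 hl0.le
    have h5 : ∫⁻ s in Ioc 0 t, ENNReal.ofReal (Real.exp (l * s)) =
        ENNReal.ofReal (Real.exp (l * t)) * ENNReal.ofReal m := by
      rw [← hm3, ← lintegral_const_mul' _ _ ENNReal.ofReal_ne_top]
      refine lintegral_congr fun s => ?_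
      rw [← ENNReal.ofReal_mul (Real.exp_pos _).le, ← Real.exp_add]
      congr 2; ring
    rw [h5]
    have h6 : (L : ℝ≥0∞) * ENNReal.ofReal m ≤ 2⁻¹ := by
      rw [← ENNReal.ofReal_coe_nnreal, ← ENNReal.ofReal_mul L.coe_nonneg,
        show (2⁻¹ : ℝ≥0∞) = ENNReal.ofReal 2⁻¹ by
          rw [ENNReal.ofReal_inv_of_pos two_pos]; simp]
      refine ENNReal.ofReal_le_ofReal ?_
      rw [hl] at hm2
      nlinarith
    calc (L : ℝ≥0∞) * (S * (ENNReal.ofReal (Real.exp (l * t)) * ENNReal.ofReal m))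
        = ENNReal.ofReal (Real.exp (l * t)) * (S * (L * ENNReal.ofReal m)) := by ring
      _ ≤ ENNReal.ofReal (Real.exp (l * t)) * (S * 2⁻¹) := by gcongr
      _ = _ := by rw [div_eq_mul_inv]
  have hSA : S ≤ A + S / 2 := by
    refine iSup₂_le fun t x => ?_
    have h1 : ENNReal.ofReal (Real.exp (-(l * t))) ≤ 1 := by
      rw [← ENNReal.ofReal_one]
      refine ENNReal.ofReal_le_ofReal (Real.exp_le_one_iff.2 ?_)
      have := mul_nonneg hl0.le t.2.1
      linarith
    refine (mul_le_mul_right (hstep t t.2 x) _).trans ?_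
    rw [mul_add, ← mul_assoc _ _ (S / 2), ← ENNReal.ofReal_mul (Real.exp_pos _).le, ← Real.exp_add,
      neg_add_cancel, Real.exp_zero, ENNReal.ofReal_one, one_mul]
    gcongr
    calc _ ≤ 1 * A := by gcongr
      _ = A := one_mul A
  have hS2 : S ≤ 2 * A := by
    have h1 : S / 2 ≤ A := by
      have h2 : S / 2 + S / 2 ≤ A + S / 2 := by rwa [ENNReal.add_halves]
      exact (ENNReal.add_le_add_iff_right (ENNReal.div_ne_top hStop two_ne_zero)).1 h2
    calc S = 2 * (S / 2) := (ENNReal.mul_div_cancel two_ne_zero ENNReal.ofNat_ne_top).symm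
      _ ≤ 2 * A := by gcongr
  calc ∫⁻ ω, Y ω * v t x ω ∂P ≤ ENNReal.ofReal (Real.exp (l * t)) * S := hgS t ht x
    _ ≤ ENNReal.ofReal (Real.exp (l * τ)) * (2 * A) := by
      gcongr
      exact ht.2
    _ = _ := by rw [hA]; ring

end HeatPotential

/-! ### The drift term and the effect of shifts on it. -/

section Drift

variable {d : ℕ}

/-- The drift `∫_0^t ∫ f(s,y) G_{t-s}(x-y) dy ds`. -/
noncomputable def heatDrift (f : ℝ × Space d → ℝ) (t : ℝ) (x : Space d) : ℝ :=
  ∫ s in (0 : ℝ)..t, ∫ y, f (s, y) * heatKernel (t - s) (x - y)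

lemma enorm_mul_heatKernel (f : ℝ × Space d → ℝ) {t : ℝ} (x : Space d) {z : ℝ × Space d}
    (hz : z.1 ≤ t) : ‖f z * heatKernel (t - z.1) (x - z.2)‖ₑ = ‖f z‖ₑ * heatWeight t x z := by
  rw [enorm_mul, heatWeight, Real.enorm_of_nonneg (heatKernel_nonneg (sub_nonneg.2 hz) _)]

lemma integrable_mul_heatKernel {f : ℝ × Space d → ℝ} (hf : Measurable f) {h t : ℝ} (hht : h ≤ t)
    {x : Space d} (hfin : ∫⁻ z, ‖f z‖ₑ * heatWeight t x z ∂(slab d h) < ∞) :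
    Integrable (fun z => f z * heatKernel (t - z.1) (x - z.2)) (slab d h) := by
  have hm : Measurable fun z : ℝ × Space d => heatKernel (t - z.1) (x - z.2) :=
    measurable_heatKernel.comp (by fun_prop : Measurable fun z : ℝ × Space d => (t - z.1, x - z.2))
  refine ⟨(hf.mul hm).aestronglyMeasurable, ?_⟩
  rw [hasFiniteIntegral_iff_enorm]
  refine (lintegral_congr_ae ?_).trans_lt hfin
  filter_upwards [ae_slab_mem d h] with z hz
  exact enorm_mul_heatKernel f x (hz.2.trans hht)

lemma intervalIntegral_eq_integral_slab {f : ℝ × Space d → ℝ} (hf : Measurable f) {h t : ℝ}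
    (h0 : 0 ≤ h) (hht : h ≤ t) {x : Space d}
    (hfin : ∫⁻ z, ‖f z‖ₑ * heatWeight t x z ∂(slab d h) < ∞) :
    ∫ s in (0 : ℝ)..h, ∫ y, f (s, y) * heatKernel (t - s) (x - y) =
      ∫ z, f z * heatKernel (t - z.1) (x - z.2) ∂(slab d h) := by
  rw [intervalIntegral.integral_of_le h0, integral_prod _ (integrable_mul_heatKernel hf hht hfin)]

lemma enorm_integral_slab_le (f : ℝ × Space d → ℝ) {h t : ℝ} (hht : h ≤ t) (x : Space d) :
    ‖∫ z, f z * heatKernel (t - z.1) (x - z.2) ∂(slab d h)‖ₑ ≤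
      ∫⁻ z, ‖f z‖ₑ * heatWeight t x z ∂(slab d h) := by
  refine (enorm_integral_le_lintegral_enorm _).trans (lintegral_mono_ae ?_)
  filter_upwards [ae_slab_mem d h] with z hz
  exact (enorm_mul_heatKernel f x (hz.2.trans hht)).le

lemma heatDrift_eq_integral_slab {f : ℝ × Space d → ℝ} (hf : Measurable f) {t : ℝ} (ht : 0 ≤ t)
    {x : Space d} (hfin : heatPotential (fun z => ‖f z‖ₑ) t x < ∞) :
    heatDrift f t x = ∫ z, f z * heatKernel (t - z.1) (x - z.2) ∂(slab d t) :=
  intervalIntegral_eq_integral_slab hf ht le_rfl hfin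

lemma enorm_heatDrift_le {f : ℝ × Space d → ℝ} (hf : Measurable f) {t : ℝ} (ht : 0 ≤ t)
    (x : Space d) : ‖heatDrift f t x‖ₑ ≤ heatPotential (fun z => ‖f z‖ₑ) t x := by
  rcases eq_or_ne (heatPotential (fun z => ‖f z‖ₑ) t x) ∞ with h | h
  · rw [h]; exact le_top
  · rw [heatDrift_eq_integral_slab hf ht h.lt_top]
    exact enorm_integral_slab_le f le_rfl x

/-- Finite potentials are required because a Bochner integral that does not converge has the value
`0`, and subtraction would fail. -/
lemma enorm_heatDrift_sub_le {f g : ℝ × Space d → ℝ} (hf : Measurable f) (hg : Measurable g)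
    {t : ℝ} (ht : 0 ≤ t) {x : Space d} (hfin : heatPotential (fun z => ‖f z‖ₑ) t x < ∞)
    (hgin : heatPotential (fun z => ‖g z‖ₑ) t x < ∞) :
    ‖heatDrift f t x - heatDrift g t x‖ₑ ≤ heatPotential (fun z => ‖f z - g z‖ₑ) t x := by
  rw [heatDrift_eq_integral_slab hf ht hfin, heatDrift_eq_integral_slab hg ht hgin,
    ← integral_sub (integrable_mul_heatKernel hf le_rfl hfin)
      (integrable_mul_heatKernel hg le_rfl hgin)]
  simp only [← sub_mul]
  exact enorm_integral_slab_le (fun z => f z - g z) le_rfl x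

lemma heatDrift_add_space (f : ℝ × Space d → ℝ) (t : ℝ) (x h : Space d) :
    heatDrift f t (x + h) = heatDrift (fun z => f (z.1, z.2 + h)) t x := by
  unfold heatDrift
  congr 1; ext s
  rw [← integral_add_right_eq_self (fun y => f (s, y) * heatKernel (t - s) (x + h - y)) h]
  simp only [add_sub_add_right_eq_sub]

/-- The shift passes from the kernel to `f`, so no regularity of the kernel is needed; the price is
the piece over `(0,h]`. -/
lemma heatDrift_add_time {f : ℝ × Space d → ℝ} (hf : Measurable f) {t h : ℝ} (ht : 0 ≤ t)
    (hh : 0 ≤ h) (x : Space d) (hfin : heatPotential (fun z => ‖f z‖ₑ) (t + h) x < ∞) :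
    heatDrift f (t + h) x =
      (∫ s in (0 : ℝ)..h, ∫ y, f (s, y) * heatKernel (t + h - s) (x - y)) +
        heatDrift (fun z => f (z.1 + h, z.2)) t x := by
  have hint := (integrable_mul_heatKernel hf le_rfl hfin).integral_prod_left
  have hI : ∀ a b, 0 ≤ a → a ≤ b → b ≤ t + h → IntervalIntegrable
      (fun s => ∫ y, f (s, y) * heatKernel (t + h - s) (x - y)) volume a b := by
    intro a b ha hab hb
    rw [intervalIntegrable_iff_integrableOn_Ioc_of_le hab]
    exact IntegrableOn.mono_set hint (Ioc_subset_Ioc ha hb)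
  unfold heatDrift
  rw [← intervalIntegral.integral_add_adjacent_intervals (hI 0 h le_rfl hh (by linarith))
    (hI h (t + h) hh (by linarith) le_rfl)]
  congr 1
  have := intervalIntegral.integral_comp_add_right (a := 0) (b := t)
    (fun s => ∫ y, f (s, y) * heatKernel (t + h - s) (x - y)) h
  rw [zero_add] at this
  rw [← this]
  simp only [add_sub_add_right_eq_sub]

end Drift

/-! ### Moment bounds for perturbed mild equations. -/

section Increments

variable {d : ℕ} {Ω : Type*} [MeasurableSpace Ω] {P : Measure Ω}
  {r : ℝ} {T : ℝ} {u w : ℝ → Space d → Ω → ℝ} {b : ℝ → ℝ} {L : ℝ≥0} {M : ℝ≥0∞}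

lemma enorm_lipschitz_le (hb : LipschitzWith L b) (y : ℝ) : ‖b y‖ₑ ≤ ‖b 0‖ₑ + L * ‖y‖ₑ := by
  have h1 : ‖b y - b 0‖ₑ ≤ L * ‖y‖ₑ := by
    have := hb.edist_le_mul y 0
    rwa [edist_eq_enorm_sub, edist_eq_enorm_sub, sub_zero] at this
  calc ‖b y‖ₑ = ‖b 0 + (b y - b 0)‖ₑ := by rw [add_sub_cancel]
    _ ≤ ‖b 0‖ₑ + ‖b y - b 0‖ₑ := enorm_add_le _ _
    _ ≤ _ := by gcongr

lemma enorm_lipschitz_sub_le (hb : LipschitzWith L b) (y y' : ℝ) :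
    ‖b y - b y'‖ₑ ≤ L * ‖y - y'‖ₑ := by
  have := hb.edist_le_mul y y'
  rwa [edist_eq_enorm_sub, edist_eq_enorm_sub] at this

lemma heatPotential_mono {v v' : ℝ × Space d → ℝ≥0∞} (h : ∀ z, v z ≤ v' z) (t : ℝ) (x : Space d) :
    heatPotential v t x ≤ heatPotential v' t x :=
  lintegral_mono fun z => mul_le_mul_left (h z) _

lemma heatPotential_const_mul {v : ℝ × Space d → ℝ≥0∞} (hv : Measurable v) (c : ℝ≥0∞) (t : ℝ)
    (x : Space d) : heatPotential (fun z => c * v z) t x = c * heatPotential v t x := by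
  unfold heatPotential
  have hm : Measurable fun z => v z * heatWeight t x z := hv.mul (measurable_heatWeight t x)
  rw [← lintegral_const_mul _ hm]
  simp only [mul_assoc]

lemma heatPotential_const_add {v : ℝ × Space d → ℝ≥0∞} (c : ℝ≥0∞) (t : ℝ)
    (x : Space d) : heatPotential (fun z => c + v z) t x =
      c * ENNReal.ofReal t + heatPotential v t x := by
  unfold heatPotential
  simp only [add_mul]
  rw [lintegral_add_left ((measurable_heatWeight t x).const_mul c),
    lintegral_const_mul _ (measurable_heatWeight t x), lintegral_heatWeight t le_rfl]

/-- The data of a mild equation with additive perturbation `w`: `u = w + G ⋆ b(u)`. -/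
structure IsPerturbedMild (P : Measure Ω) (b : ℝ → ℝ) (T : ℝ) (M : ℝ≥0∞)
    (w u : ℝ → Space d → Ω → ℝ) : Prop where
  measurable : Measurable fun z : (ℝ × Space d) × Ω => u z.1.1 z.1.2 z.2
  bound_ne_top : M ≠ ∞
  bound : ∀ t ∈ Icc 0 T, ∀ x, ∫⁻ ω, ‖u t x ω‖ₑ ∂P ≤ M
  mild : ∀ t ∈ Icc 0 T, ∀ x, ∀ᵐ ω ∂P,
    u t x ω = w t x ω + heatDrift (fun z => b (u z.1 z.2 ω)) t x

lemma IsPerturbedMild.measurable_slice (hu : IsPerturbedMild P b T M w u) (ω : Ω) :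
    Measurable fun z : ℝ × Space d => u z.1 z.2 ω :=
  hu.measurable.comp (measurable_id.prodMk measurable_const)

lemma IsPerturbedMild.measurable_apply (hu : IsPerturbedMild P b T M w u) (t : ℝ) (x : Space d) :
    Measurable (u t x) :=
  hu.measurable.comp (measurable_const.prodMk measurable_id : Measurable fun ω : Ω => ((t, x), ω))

lemma IsPerturbedMild.lintegral_sub_le (hu : IsPerturbedMild P b T M w u) {t t' : ℝ}
    (ht : t ∈ Icc 0 T) (ht' : t' ∈ Icc 0 T) (x x' : Space d) :
    ∫⁻ ω, ‖u t x ω - u t' x' ω‖ₑ ∂P ≤ M + M := by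
  refine (lintegral_mono fun ω => enorm_sub_le).trans ?_
  rw [lintegral_add_left (hu.measurable_apply t x).enorm]
  exact add_le_add (hu.bound t ht x) (hu.bound t' ht' x')

variable [IsProbabilityMeasure P]

lemma IsPerturbedMild.lintegral_enorm_comp_le (hu : IsPerturbedMild P b T M w u)
    (hb : LipschitzWith L b) {t : ℝ} (ht : t ∈ Icc 0 T) (x : Space d) :
    ∫⁻ ω, ‖b (u t x ω)‖ₑ ∂P ≤ ‖b 0‖ₑ + L * M := by
  refine (lintegral_mono fun ω => enorm_lipschitz_le hb _).trans ?_
  rw [lintegral_add_left measurable_const, lintegral_const, measure_univ, mul_one,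
    lintegral_const_mul' _ _ ENNReal.coe_ne_top]
  gcongr
  exact hu.bound t ht x

lemma IsPerturbedMild.ae_heatPotential_lt_top (hu : IsPerturbedMild P b T M w u)
    (hb : LipschitzWith L b) {h t : ℝ} (ht : t + h ≤ T) (hh : 0 ≤ h) (x k : Space d) :
    ∀ᵐ ω ∂P, heatPotential (fun z => ‖b (u (z.1 + h) (z.2 + k) ω)‖ₑ) t x < ∞ := by
  refine ae_lintegral_heatWeight_lt_top (v := fun s y ω => ‖b (u (s + h) (y + k) ω)‖ₑ) ?_ le_rfl
    (M := ‖b 0‖ₑ + L * M) ?_ (fun s hs y => ?_) x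
  · have : Measurable fun z : (ℝ × Space d) × Ω => u (z.1.1 + h) (z.1.2 + k) z.2 :=
      hu.measurable.comp (by fun_prop :
        Measurable fun z : (ℝ × Space d) × Ω => ((z.1.1 + h, z.1.2 + k), z.2))
    exact (hb.continuous.measurable.comp this).enorm
  · exact ENNReal.add_ne_top.2 ⟨enorm_ne_top, ENNReal.mul_ne_top ENNReal.coe_ne_top
      hu.bound_ne_top⟩
  · exact hu.lintegral_enorm_comp_le hb ⟨by linarith [hs.1], by linarith [hs.2]⟩ _

/-- The constant in Gronwall's lemma. -/
noncomputable def gronwallConst (L : ℝ≥0) (T : ℝ) : ℝ≥0∞ :=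
  2 * ENNReal.ofReal (Real.exp ((2 * L + 1) * T))

lemma IsPerturbedMild.dualBound (hu : IsPerturbedMild P b T M w u) (hb : LipschitzWith L b)
    {p : ℝ} (hpr : p.HolderConjugate r) {a : ℝ≥0∞}
    (hw : ∀ t ∈ Icc 0 T, ∀ x, DualBound P r (fun ω => ‖w t x ω‖ₑ) a)
    {t : ℝ} (ht : t ∈ Icc 0 T) (x : Space d) :
    DualBound P r (fun ω => ‖u t x ω‖ₑ)
      (gronwallConst L T * (‖b 0‖ₑ * ENNReal.ofReal T + a)) := by
  refine DualBound.gronwall (v := fun t x ω => ‖u t x ω‖ₑ)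
    (w := fun t x ω => ‖b 0‖ₑ * ENNReal.ofReal T + ‖w t x ω‖ₑ) hu.measurable.enorm
    hu.bound_ne_top hu.bound (fun t ht x => (DualBound.const hpr _).add (hw t ht x)
      aemeasurable_const) (fun t ht x => ?_) ht x
  filter_upwards [hu.mild t ht x] with ω hω
  have hm := hu.measurable_slice ω
  have h1 : ‖heatDrift (fun z => b (u z.1 z.2 ω)) t x‖ₑ ≤
      ‖b 0‖ₑ * ENNReal.ofReal T + L * heatPotential (fun z => ‖u z.1 z.2 ω‖ₑ) t x := by
    refine (enorm_heatDrift_le (hb.continuous.measurable.comp hm) ht.1 x).trans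
      ((heatPotential_mono (fun z => enorm_lipschitz_le hb (u z.1 z.2 ω)) t x).trans ?_)
    rw [heatPotential_const_add, heatPotential_const_mul hm.enorm]
    gcongr
    exact ht.2
  calc ‖u t x ω‖ₑ ≤ ‖w t x ω‖ₑ + ‖heatDrift (fun z => b (u z.1 z.2 ω)) t x‖ₑ := by
        conv_lhs => rw [hω]
        exact enorm_add_le _ _
    _ ≤ ‖w t x ω‖ₑ + (‖b 0‖ₑ * ENNReal.ofReal T +
        L * heatPotential (fun z => ‖u z.1 z.2 ω‖ₑ) t x) := by gcongr
    _ = _ := by ring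

/-- After the translation in space, the Lipschitz property bounds the drift increment by `L` times
the heat potential of `|u(·,·+k) - u|`, so Gronwall applies to the increment itself. -/
lemma IsPerturbedMild.dualBound_space (hu : IsPerturbedMild P b T M w u) (hb : LipschitzWith L b)
    {a : ℝ≥0∞} (k : Space d)
    (hw : ∀ t ∈ Icc 0 T, ∀ x, DualBound P r (fun ω => ‖w t (x + k) ω - w t x ω‖ₑ) a)
    {t : ℝ} (ht : t ∈ Icc 0 T) (x : Space d) :
    DualBound P r (fun ω => ‖u t (x + k) ω - u t x ω‖ₑ) (gronwallConst L T * a) := by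
  have hmk : Measurable fun z : (ℝ × Space d) × Ω => u z.1.1 (z.1.2 + k) z.2 :=
    hu.measurable.comp (by fun_prop :
      Measurable fun z : (ℝ × Space d) × Ω => ((z.1.1, z.1.2 + k), z.2))
  refine DualBound.gronwall (v := fun t x ω => ‖u t (x + k) ω - u t x ω‖ₑ)
    (w := fun t x ω => ‖w t (x + k) ω - w t x ω‖ₑ) (hmk.sub hu.measurable).enorm
    (ENNReal.add_ne_top.2 ⟨hu.bound_ne_top, hu.bound_ne_top⟩)
    (fun t ht x => hu.lintegral_sub_le ht ht _ _) hw (fun t ht x => ?_) ht x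
  have f1 := hu.ae_heatPotential_lt_top hb (h := 0) (t := t) (by linarith [ht.2]) le_rfl x k
  have f2 := hu.ae_heatPotential_lt_top hb (h := 0) (t := t) (by linarith [ht.2]) le_rfl x 0
  filter_upwards [hu.mild t ht x, hu.mild t ht (x + k), f1, f2] with ω h1 h2 h3 h4
  simp only [add_zero] at h3 h4
  have hm := hu.measurable_slice ω
  have hm' : Measurable fun z : ℝ × Space d => u z.1 (z.2 + k) ω :=
    hmk.comp (measurable_id.prodMk measurable_const)
  have h5 : ‖heatDrift (fun z => b (u z.1 z.2 ω)) t (x + k) -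
      heatDrift (fun z => b (u z.1 z.2 ω)) t x‖ₑ ≤
      L * heatPotential (fun z => ‖u z.1 (z.2 + k) ω - u z.1 z.2 ω‖ₑ) t x := by
    have hs : Measurable fun z : ℝ × Space d => ‖u z.1 (z.2 + k) ω - u z.1 z.2 ω‖ₑ :=
      (hm'.sub hm).enorm
    rw [heatDrift_add_space, ← heatPotential_const_mul hs]
    exact (enorm_heatDrift_sub_le (hb.continuous.measurable.comp hm')
      (hb.continuous.measurable.comp hm) ht.1 h3 h4).trans
      (heatPotential_mono (fun z => enorm_lipschitz_sub_le hb _ _) t x)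
  rw [h1, h2, add_sub_add_comm]
  exact (enorm_add_le _ _).trans (by gcongr)

lemma IsPerturbedMild.dualBound_time (hu : IsPerturbedMild P b T M w u) (hb : LipschitzWith L b)
    {a A : ℝ≥0∞} {h : ℝ} (hh : 0 ≤ h)
    (hA : ∀ t ∈ Icc 0 T, ∀ x, DualBound P r (fun ω => ‖b (u t x ω)‖ₑ) A)
    (hw : ∀ t ∈ Icc 0 (T - h), ∀ x, DualBound P r (fun ω => ‖w (t + h) x ω - w t x ω‖ₑ) a)
    {t : ℝ} (ht : t ∈ Icc 0 (T - h)) (x : Space d) :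
    DualBound P r (fun ω => ‖u (t + h) x ω - u t x ω‖ₑ)
      (gronwallConst L T * (A * ENNReal.ofReal h + a)) := by
  have hmk : Measurable fun z : (ℝ × Space d) × Ω => u (z.1.1 + h) z.1.2 z.2 :=
    hu.measurable.comp (by fun_prop :
      Measurable fun z : (ℝ × Space d) × Ω => ((z.1.1 + h, z.1.2), z.2))
  have hbm : Measurable fun z : (ℝ × Space d) × Ω => ‖b (u z.1.1 z.1.2 z.2)‖ₑ :=
    (hb.continuous.measurable.comp hu.measurable).enorm
  -- The drift over `(0,h]` left by the time shift. By Minkowski and the unit mass of the kernel it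
  -- contributes `A h`, and it joins the forcing in Gronwall's lemma on `[0,T-h]`.
  set E : ℝ → Space d → Ω → ℝ≥0∞ := fun t x ω =>
    ∫⁻ z, ‖b (u z.1 z.2 ω)‖ₑ * heatWeight (t + h) x z ∂(slab d h) with hE
  have hmono : gronwallConst L (T - h) ≤ gronwallConst L T := by
    unfold gronwallConst
    gcongr
    linarith
  have hEm : ∀ t x, Measurable (E t x) := fun t x => by
    have hm : Measurable fun q : Ω × (ℝ × Space d) =>
        ‖b (u q.2.1 q.2.2 q.1)‖ₑ * heatWeight (t + h) x q.2 :=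
      (hbm.comp measurable_swap).mul ((measurable_heatWeight (t + h) x).comp measurable_snd)
    exact hm.lintegral_prod_right'
  refine DualBound.mono (b := gronwallConst L (T - h) * (A * ENNReal.ofReal h + a)) ?_
    (ae_of_all _ fun _ => le_rfl) (by gcongr)
  refine DualBound.gronwall (v := fun t x ω => ‖u (t + h) x ω - u t x ω‖ₑ)
    (w := fun t x ω => E t x ω + ‖w (t + h) x ω - w t x ω‖ₑ) (hmk.sub hu.measurable).enorm
    (ENNReal.add_ne_top.2 ⟨hu.bound_ne_top, hu.bound_ne_top⟩)
    (fun t ht x => hu.lintegral_sub_le ⟨by linarith [ht.1], by linarith [ht.2]⟩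
      ⟨ht.1, by linarith [ht.2]⟩ _ _) (fun t ht x => ?_) (fun t ht x => ?_) ht x
  · refine DualBound.add ?_ (hw t ht x) (hEm t x).aemeasurable
    have := DualBound.lintegral (P := P) (r := r) (ν := slab d h)
      (f := fun z ω => ‖b (u z.1 z.2 ω)‖ₑ) hbm (measurable_heatWeight (t + h) x) (a := A) (by
        filter_upwards [ae_slab_mem d h] with z hz
        exact hA z.1 ⟨hz.1.le, by linarith [hz.2, ht.1, ht.2]⟩ z.2)
    rwa [lintegral_heatWeight (t + h) (by linarith [ht.1])] at this
  have htT : t ∈ Icc 0 T := ⟨ht.1, by linarith [ht.2]⟩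
  have hthT : t + h ∈ Icc 0 T := ⟨by linarith [ht.1], by linarith [ht.2]⟩
  have f1 := hu.ae_heatPotential_lt_top hb (h := h) (t := t) hthT.2 hh x 0
  have f2 := hu.ae_heatPotential_lt_top hb (h := 0) (t := t) (by linarith [htT.2]) le_rfl x 0
  have f3 := hu.ae_heatPotential_lt_top hb (h := 0) (t := t + h) (by linarith [hthT.2]) le_rfl x 0
  filter_upwards [hu.mild t htT x, hu.mild (t + h) hthT x, f1, f2, f3] with ω h1 h2 h3 h4 h5
  simp only [add_zero] at h3 h4 h5
  have hm := hu.measurable_slice ω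
  have hm' : Measurable fun z : ℝ × Space d => u (z.1 + h) z.2 ω :=
    hmk.comp (measurable_id.prodMk measurable_const)
  have hbu : Measurable fun z : ℝ × Space d => b (u z.1 z.2 ω) := hb.continuous.measurable.comp hm
  have h6 : ‖∫ s in (0 : ℝ)..h, ∫ y, b (u s y ω) * heatKernel (t + h - s) (x - y)‖ₑ ≤
      E t x ω := by
    rcases eq_or_ne (E t x ω) ∞ with h' | h'
    · rw [h']; exact le_top
    · have e := intervalIntegral_eq_integral_slab (f := fun z => b (u z.1 z.2 ω)) hbu hh
        (by linarith [ht.1] : h ≤ t + h) (x := x) (lt_top_iff_ne_top.2 h')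
      rw [e]
      exact enorm_integral_slab_le (fun z => b (u z.1 z.2 ω)) (by linarith [ht.1]) x
  have h7 : ‖heatDrift (fun z => b (u (z.1 + h) z.2 ω)) t x -
      heatDrift (fun z => b (u z.1 z.2 ω)) t x‖ₑ ≤
      L * heatPotential (fun z => ‖u (z.1 + h) z.2 ω - u z.1 z.2 ω‖ₑ) t x := by
    have hs : Measurable fun z : ℝ × Space d => ‖u (z.1 + h) z.2 ω - u z.1 z.2 ω‖ₑ :=
      (hm'.sub hm).enorm
    rw [← heatPotential_const_mul hs]
    exact (enorm_heatDrift_sub_le (hb.continuous.measurable.comp hm') hbu ht.1 h3 h4).trans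
      (heatPotential_mono (fun z => enorm_lipschitz_sub_le hb _ _) t x)
  rw [h1, h2, heatDrift_add_time hbu ht.1 hh x h5]
  have e : ∀ a b c e f : ℝ, a + (b + c) - (e + f) = b + (a - e) + (c - f) := by intros; ring
  rw [e]
  refine (enorm_add_le _ _).trans (add_le_add ((enorm_add_le _ _).trans ?_) h7)
  exact add_le_add h6 le_rfl

end Increments

/-! ### Averages over balls compared through the Hölder energy. -/

section Averages

set_option linter.unusedSectionVars false

variable {E : Type*} [NormedAddCommGroup E] [NormedSpace ℝ E] [MeasurableSpace E] [BorelSpace E]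
  [FiniteDimensional ℝ E] {ν : Measure E} {p κ : ℝ}

/-- The Hölder energy `∫_S ∫_S |f(z) - f(z')|^p / |z - z'|^κ`. -/
noncomputable def holderEnergy (ν : Measure E) (p κ : ℝ) (S : Set E) (f : E → ℝ) : ℝ≥0∞ :=
  ∫⁻ z in S, ∫⁻ z' in S, ‖f z - f z'‖ₑ ^ p / edist z z' ^ κ ∂ν ∂ν

/-- The normalized restriction of `ν` to the closed ball of radius `r` around `z`. -/
noncomputable abbrev ballMeasure (ν : Measure E) (z : E) (r : ℝ) : Measure E :=
  (ν (Metric.closedBall z r))⁻¹ • ν.restrict (Metric.closedBall z r)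

/-- The average of `f` over the closed ball of radius `r` around `z`. -/
noncomputable def ballAverage (ν : Measure E) (f : E → ℝ) (z : E) (r : ℝ) : ℝ :=
  ∫ w, f w ∂(ballMeasure ν z r)

/-- If `a ≥ ε` then `a = a^{1-p} a^p ≤ ε^{1-p} a^p`. This replaces Jensen's inequality and keeps the
estimates linear in the energy; `ε` will be a power of the scale. -/
lemma le_add_rpow_mul {ε a : ℝ≥0∞} (hε : ε ≠ 0) (hε' : ε ≠ ∞) (hp : 1 ≤ p) :
    a ≤ ε + ε ^ (1 - p) * a ^ p := by
  rcases le_total a ε with h | h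
  · exact h.trans le_self_add
  refine le_add_left ?_
  calc a = ε ^ (1 - p) * ε ^ (p - 1) * a := by
        rw [← ENNReal.rpow_add _ _ hε hε']; simp
    _ ≤ ε ^ (1 - p) * a ^ (p - 1) * a := by gcongr
    _ = ε ^ (1 - p) * a ^ p := by
        have : a ^ (p - 1) * a = a ^ p := by
          conv_lhs => rw [← ENNReal.rpow_one a]
          rw [← ENNReal.rpow_mul, one_mul, ← ENNReal.rpow_add_of_nonneg _ _ (by linarith)
            zero_le_one, sub_add_cancel]
        rw [mul_assoc, this]

variable [ν.IsAddHaarMeasure]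

lemma isProbabilityMeasure_ballMeasure (z : E) {r : ℝ} (hr : 0 < r) :
    IsProbabilityMeasure (ballMeasure ν z r) := by
  refine ⟨?_⟩
  rw [Measure.smul_apply, Measure.restrict_apply_univ, smul_eq_mul]
  exact ENNReal.inv_mul_cancel (Metric.measure_closedBall_pos ν z hr).ne'
    measure_closedBall_lt_top.ne

lemma ae_ballMeasure_mem (z : E) (r : ℝ) :
    ∀ᵐ w ∂(ballMeasure ν z r), w ∈ Metric.closedBall z r :=
  Measure.ae_smul_measure (ae_restrict_mem Metric.isClosed_closedBall.measurableSet) _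

lemma integrable_ballMeasure {f : E → ℝ} {z : E} {r : ℝ} (hr : 0 < r)
    (hf : IntegrableOn f (Metric.closedBall z r) ν) : Integrable f (ballMeasure ν z r) :=
  Integrable.smul_measure hf
    (ENNReal.inv_ne_top.2 (Metric.measure_closedBall_pos ν z hr).ne')

lemma enorm_ballAverage_sub_const_le {f : E → ℝ} {z : E} {r : ℝ} (hr : 0 < r)
    (hf : IntegrableOn f (Metric.closedBall z r) ν) (c : ℝ) :
    ‖ballAverage ν f z r - c‖ₑ ≤ ∫⁻ w, ‖f w - c‖ₑ ∂(ballMeasure ν z r) := by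
  have := isProbabilityMeasure_ballMeasure (ν := ν) z hr
  have e : ballAverage ν f z r - c = ∫ w, (f w - c) ∂(ballMeasure ν z r) := by
    rw [integral_sub (integrable_ballMeasure hr hf) (integrable_const c)]
    simp [ballAverage]
  rw [e]
  exact enorm_integral_le_lintegral_enorm _

/-- The difference is a double average of `f w - f w'`. The pointwise inequality `le_add_rpow_mul`
and `edist w w' ≤ ρ` bring in the energy density. -/
lemma enorm_ballAverage_sub_le {f : E → ℝ} {S : Set E} (hf : IntegrableOn f S ν) {z z' : E}
    {r r' : ℝ} (hr : 0 < r) (hr' : 0 < r') (hz : Metric.closedBall z r ⊆ S)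
    (hz' : Metric.closedBall z' r' ⊆ S) {ρ ε : ℝ≥0∞} (hρ' : ρ ≠ ∞)
    (hρ : ∀ w ∈ Metric.closedBall z r, ∀ w' ∈ Metric.closedBall z' r', edist w w' ≤ ρ)
    (hε : ε ≠ 0) (hε' : ε ≠ ∞) (hp : 1 ≤ p) (hκ : 0 ≤ κ) :
    ‖ballAverage ν f z r - ballAverage ν f z' r'‖ₑ ≤
      ε + ε ^ (1 - p) * ρ ^ κ * ((ν (Metric.closedBall z r))⁻¹ *
        (ν (Metric.closedBall z' r'))⁻¹ * holderEnergy ν p κ S f) := by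
  have h1 := isProbabilityMeasure_ballMeasure (ν := ν) z hr
  have h2 := isProbabilityMeasure_ballMeasure (ν := ν) z' hr'
  set C := ε ^ (1 - p) * ρ ^ κ with hC
  have hCtop : C ≠ ∞ := ENNReal.mul_ne_top (ENNReal.rpow_ne_top_of_ne_zero hε hε')
    (ENNReal.rpow_ne_top_of_nonneg hκ hρ')
  have hpt : ∀ w ∈ Metric.closedBall z r, ∀ w' ∈ Metric.closedBall z' r',
      ‖f w - f w'‖ₑ ≤ ε + C * (‖f w - f w'‖ₑ ^ p / edist w w' ^ κ) := by
    intro w hw w' hw'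
    refine (le_add_rpow_mul hε hε' hp).trans ?_
    rw [hC, mul_assoc]
    gcongr
    rcases eq_or_ne w w' with rfl | hne
    · rw [sub_self, enorm_zero, ENNReal.zero_rpow_of_pos (by linarith)]; exact zero_le
    · have hd : edist w w' ^ κ ≤ ρ ^ κ := ENNReal.rpow_le_rpow (hρ w hw w' hw') hκ
      have hd0 : edist w w' ^ κ ≠ 0 := by
        rw [Ne, ENNReal.rpow_eq_zero_iff]
        simp [edist_ne_top, edist_eq_zero, hne]
      have hdt : edist w w' ^ κ ≠ ∞ := ENNReal.rpow_ne_top_of_nonneg hκ (edist_ne_top _ _)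
      calc ‖f w - f w'‖ₑ ^ p = edist w w' ^ κ * (‖f w - f w'‖ₑ ^ p / edist w w' ^ κ) :=
            (ENNReal.mul_div_cancel hd0 hdt).symm
        _ ≤ _ := by gcongr
  calc ‖ballAverage ν f z r - ballAverage ν f z' r'‖ₑ
      ≤ ∫⁻ w, ‖f w - ballAverage ν f z' r'‖ₑ ∂(ballMeasure ν z r) :=
        enorm_ballAverage_sub_const_le hr (hf.mono_set hz) _
    _ ≤ ∫⁻ w, ∫⁻ w', ‖f w - f w'‖ₑ ∂(ballMeasure ν z' r') ∂(ballMeasure ν z r) := by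
        refine lintegral_mono fun w => ?_
        rw [← enorm_neg, neg_sub]
        refine (enorm_ballAverage_sub_const_le hr' (hf.mono_set hz') _).trans_eq ?_
        congr 1; ext w'
        rw [← enorm_neg, neg_sub]
    _ ≤ ∫⁻ w, ∫⁻ w', (ε + C * (‖f w - f w'‖ₑ ^ p / edist w w' ^ κ)) ∂(ballMeasure ν z' r')
          ∂(ballMeasure ν z r) := by
        refine lintegral_mono_ae ?_
        filter_upwards [ae_ballMeasure_mem (ν := ν) z r] with w hw
        refine lintegral_mono_ae ?_
        filter_upwards [ae_ballMeasure_mem (ν := ν) z' r'] with w' hw'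
        exact hpt w hw w' hw'
    _ = ε + C * ((ν (Metric.closedBall z r))⁻¹ * (ν (Metric.closedBall z' r'))⁻¹ *
          ∫⁻ w in Metric.closedBall z r, ∫⁻ w' in Metric.closedBall z' r',
            ‖f w - f w'‖ₑ ^ p / edist w w' ^ κ ∂ν ∂ν) := by
        have hi : (ν (Metric.closedBall z' r'))⁻¹ ≠ ∞ :=
          ENNReal.inv_ne_top.2 (Metric.measure_closedBall_pos ν z' hr').ne'
        have e1 : ∀ w, ∫⁻ w', (ε + C * (‖f w - f w'‖ₑ ^ p / edist w w' ^ κ))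
            ∂(ballMeasure ν z' r') = ε + C * ((ν (Metric.closedBall z' r'))⁻¹ *
            ∫⁻ w' in Metric.closedBall z' r', ‖f w - f w'‖ₑ ^ p / edist w w' ^ κ ∂ν) := by
          intro w
          rw [lintegral_add_left measurable_const, lintegral_const, measure_univ, mul_one,
            lintegral_const_mul' _ _ hCtop, lintegral_smul_measure, smul_eq_mul]
        simp only [e1]
        rw [lintegral_add_left measurable_const, lintegral_const, measure_univ, mul_one,
          lintegral_const_mul' _ _ hCtop, lintegral_const_mul' _ _ hi, lintegral_smul_measure,
          smul_eq_mul]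
        ring
    _ ≤ _ := by
        gcongr
        unfold holderEnergy
        refine (lintegral_mono_set hz).trans (lintegral_mono fun w => lintegral_mono_set hz')

/-- The constant in the estimate of the averages by the Hölder energy. -/
noncomputable def averageConst (ν : Measure E) (κ : ℝ) : ℝ≥0∞ :=
  4 ^ κ * 4 ^ (Module.finrank ℝ E : ℝ) * (ν (Metric.closedBall 0 1))⁻¹ ^ 2

lemma averageConst_ne_top (hκ : 0 ≤ κ) : averageConst ν κ ≠ ∞ := by
  unfold averageConst
  refine ENNReal.mul_ne_top (ENNReal.mul_ne_top ?_ ?_) (ENNReal.pow_ne_top ?_)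
  · exact ENNReal.rpow_ne_top_of_nonneg hκ (by norm_num)
  · exact ENNReal.rpow_ne_top_of_nonneg (by positivity) (by norm_num)
  · exact ENNReal.inv_ne_top.2 (Metric.measure_closedBall_pos ν 0 one_pos).ne'

/-- Averages at the dyadic scale `s` and at neighbouring points differ by at most a multiple of
`s ^ β`. -/
lemma enorm_ballAverage_sub_le_scale {f : E → ℝ} {S : Set E} (hf : IntegrableOn f S ν) {z z' : E}
    {s r r' β : ℝ} (hs : 0 < s) (hr : s / 2 ≤ r) (hr' : s / 2 ≤ r') (hrs : r ≤ s) (hrs' : r' ≤ s)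
    (hzz : dist z z' ≤ s)
    (hz : Metric.closedBall z r ⊆ S) (hz' : Metric.closedBall z' r' ⊆ S)
    (hp : 1 ≤ p) (hκ : 0 ≤ κ) (hβ : κ = β * p + 2 * Module.finrank ℝ E) :
    ‖ballAverage ν f z r - ballAverage ν f z' r'‖ₑ ≤
      ENNReal.ofReal (s ^ β) * (1 + averageConst ν κ * holderEnergy ν p κ S f) := by
  set D : ℝ := ((Module.finrank ℝ E : ℕ) : ℝ) with hD
  set V := ν (Metric.closedBall (0 : E) 1) with hV
  have hV0 : V ≠ 0 := (Metric.measure_closedBall_pos ν 0 one_pos).ne'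
  have hVt : V ≠ ∞ := measure_closedBall_lt_top.ne
  set σ : ℝ≥0∞ := ENNReal.ofReal s with hσ
  have hσ0 : σ ≠ 0 := by simpa [hσ] using hs
  have hσt : σ ≠ ∞ := ENNReal.ofReal_ne_top
  have hball : ∀ (z : E) (r : ℝ), s / 2 ≤ r → (ν (Metric.closedBall z r))⁻¹ ≤
      2 ^ D * σ ^ (-D) * V⁻¹ := by
    intro z r hr
    rw [Measure.addHaar_closedBall' ν z (by linarith), ← hV]
    have h1 : (σ / 2) ^ D ≤ ENNReal.ofReal (r ^ Module.finrank ℝ E) := by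
      rw [ENNReal.ofReal_pow (by linarith), ← ENNReal.rpow_natCast]
      refine ENNReal.rpow_le_rpow ?_ (by positivity)
      rw [hσ, show (2 : ℝ≥0∞) = ENNReal.ofReal 2 by simp, ← ENNReal.ofReal_div_of_pos two_pos]
      exact ENNReal.ofReal_le_ofReal hr
    rw [ENNReal.mul_inv (Or.inr hVt) (Or.inr hV0)]
    gcongr
    refine (ENNReal.inv_le_inv.2 h1).trans_eq ?_
    rw [div_eq_mul_inv, ENNReal.mul_rpow_of_nonneg _ _ (by positivity), ENNReal.mul_inv
      (Or.inl (by simp [ENNReal.rpow_eq_zero_iff, hσ0, hσt]))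
      (Or.inl (ENNReal.rpow_ne_top_of_nonneg (by positivity) hσt)), ← ENNReal.rpow_neg,
      ENNReal.inv_rpow, inv_inv, mul_comm]
  have hε : ENNReal.ofReal (s ^ β) = σ ^ β := by
    rw [hσ, ENNReal.ofReal_rpow_of_pos hs]
  have hε0 : σ ^ β ≠ 0 := by simp [ENNReal.rpow_eq_zero_iff, hσ0, hσt]
  have hεt : σ ^ β ≠ ∞ := ENNReal.rpow_ne_top_of_ne_zero hσ0 hσt
  -- Choice `ε = s^β`; points of the two balls are within `r + s + r' ≤ 3s`, hence within `4s`.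
  have h := enorm_ballAverage_sub_le (ν := ν) hf (by linarith) (by linarith) hz hz' (ρ := 4 * σ)
    (ENNReal.mul_ne_top (by norm_num) hσt) (fun w hw w' hw' => by
      rw [edist_dist, hσ, show (4 : ℝ≥0∞) = ENNReal.ofReal 4 by simp,
        ← ENNReal.ofReal_mul (by norm_num)]
      refine ENNReal.ofReal_le_ofReal ?_
      have a1 : dist w z ≤ r := hw
      have a2 : dist w' z' ≤ r' := hw'
      have a3 := dist_triangle4 w z z' w'
      rw [dist_comm z' w'] at a3
      linarith) hε0 hεt hp hκ
  rw [hε, mul_add, mul_one]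
  refine h.trans (add_le_add le_rfl ?_)
  calc (σ ^ β) ^ (1 - p) * (4 * σ) ^ κ * ((ν (Metric.closedBall z r))⁻¹ *
        (ν (Metric.closedBall z' r'))⁻¹ * holderEnergy ν p κ S f)
      ≤ (σ ^ β) ^ (1 - p) * (4 * σ) ^ κ * ((2 ^ D * σ ^ (-D) * V⁻¹) *
        (2 ^ D * σ ^ (-D) * V⁻¹) * holderEnergy ν p κ S f) := by
        gcongr
        · exact hball z r hr
        · exact hball z' r' hr'
    _ = (σ ^ (β * (1 - p)) * σ ^ κ * σ ^ (-D) * σ ^ (-D)) * (4 ^ κ * (2 ^ D * 2 ^ D) * V⁻¹ ^ 2 *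
          holderEnergy ν p κ S f) := by
        rw [← ENNReal.rpow_mul, ENNReal.mul_rpow_of_nonneg _ _ hκ]
        ring
    _ = _ := by
        -- The relation `κ = βp + 2D` is made for this: each ball volume costs `σ^{-D}`, and the
        -- total exponent is again `β`.
        have e1 : σ ^ (β * (1 - p)) * σ ^ κ * σ ^ (-D) * σ ^ (-D) = σ ^ β := by
          rw [← ENNReal.rpow_add _ _ hσ0 hσt, ← ENNReal.rpow_add _ _ hσ0 hσt,
            ← ENNReal.rpow_add _ _ hσ0 hσt, hβ]
          congr 1; ring
        have e2 : (2 : ℝ≥0∞) ^ D * 2 ^ D = 4 ^ D := by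
          rw [← ENNReal.mul_rpow_of_nonneg _ _ (by positivity)]
          norm_num
        rw [e1, e2]
        rfl

end Averages

/-! ### Chaining over dyadic scales. -/

section LimitAverage

set_option linter.unusedSectionVars false

variable {E : Type*} [NormedAddCommGroup E] [NormedSpace ℝ E] [MeasurableSpace E] [BorelSpace E]
  [FiniteDimensional ℝ E] {ν : Measure E} [ν.IsAddHaarMeasure] {p κ β R : ℝ}

/-- The limit of the averages of `f` over small balls around `z`. -/
noncomputable def limitAverage (ν : Measure E) (f : E → ℝ) (z : E) : ℝ :=
  limUnder atTop fun k : ℕ => ballAverage ν f z (2⁻¹ ^ k)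

/-- The Hölder constant given by the Hölder energy, up to a numerical factor. -/
noncomputable def energyBound (ν : Measure E) (p κ R : ℝ) (f : E → ℝ) : ℝ :=
  (1 + averageConst ν κ * holderEnergy ν p κ (Metric.closedBall 0 R) f).toReal

/-- The margin `1` in `‖z‖ + 1 ≤ R` keeps all balls of radius at most one inside the region where
the energy is measured. -/
lemma dist_ballAverage_le {f : E → ℝ} (hf : IntegrableOn f (Metric.closedBall 0 R) ν)
    (hB : holderEnergy ν p κ (Metric.closedBall 0 R) f ≠ ∞)
    (hp : 1 ≤ p) (hκ : 0 ≤ κ) (hβ : κ = β * p + 2 * Module.finrank ℝ E) {z z' : E}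
    (hz : ‖z‖ + 1 ≤ R) (hz' : ‖z'‖ + 1 ≤ R) {s r r' : ℝ} (hs : 0 < s) (hs1 : s ≤ 1)
    (hr : s / 2 ≤ r) (hr' : s / 2 ≤ r') (hrs : r ≤ s) (hrs' : r' ≤ s) (hzz : dist z z' ≤ s) :
    dist (ballAverage ν f z r) (ballAverage ν f z' r') ≤ energyBound ν p κ R f * s ^ β := by
  have hsub : ∀ (z : E) (r : ℝ), ‖z‖ + 1 ≤ R → r ≤ s →
      Metric.closedBall z r ⊆ Metric.closedBall 0 R := fun z r hz hr => by
    refine Metric.closedBall_subset_closedBall' ?_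
    rw [dist_zero_right]; linarith
  have h := enorm_ballAverage_sub_le_scale hf hs hr hr' hrs hrs' hzz (hsub z r hz hrs)
    (hsub z' r' hz' hrs') hp hκ hβ
  have hN : 1 + averageConst ν κ * holderEnergy ν p κ (Metric.closedBall 0 R) f ≠ ∞ :=
    ENNReal.add_ne_top.2 ⟨ENNReal.one_ne_top, ENNReal.mul_ne_top (averageConst_ne_top hκ) hB⟩
  have h2 := ENNReal.toReal_mono (ENNReal.mul_ne_top ENNReal.ofReal_ne_top hN) h
  rw [ENNReal.toReal_mul, ENNReal.toReal_ofReal (by positivity), mul_comm] at h2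
  rw [dist_eq_norm]
  simpa [energyBound] using h2

lemma inv_two_pow_rpow (β : ℝ) (k : ℕ) : ((2⁻¹ : ℝ) ^ k) ^ β = ((2⁻¹ : ℝ) ^ β) ^ k := by
  rw [← Real.rpow_natCast, ← Real.rpow_natCast, ← Real.rpow_mul (by norm_num),
    ← Real.rpow_mul (by norm_num), mul_comm]

lemma inv_two_rpow_lt_one (hβ : 0 < β) : (2⁻¹ : ℝ) ^ β < 1 :=
  Real.rpow_lt_one (by norm_num) (by norm_num) hβ

lemma dist_ballAverage_succ_le {f : E → ℝ} (hf : IntegrableOn f (Metric.closedBall 0 R) ν)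
    (hB : holderEnergy ν p κ (Metric.closedBall 0 R) f ≠ ∞)
    (hp : 1 ≤ p) (hκ : 0 ≤ κ) (hβ : κ = β * p + 2 * Module.finrank ℝ E) {z : E}
    (hz : ‖z‖ + 1 ≤ R) (k : ℕ) :
    dist (ballAverage ν f z (2⁻¹ ^ k)) (ballAverage ν f z (2⁻¹ ^ (k + 1))) ≤
      energyBound ν p κ R f * ((2⁻¹ : ℝ) ^ β) ^ k := by
  have h0 : 0 < (2⁻¹ : ℝ) ^ k := by positivity
  have h1 : (2⁻¹ : ℝ) ^ k ≤ 1 := pow_le_one₀ (by norm_num) (by norm_num)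
  rw [← inv_two_pow_rpow]
  refine dist_ballAverage_le hf hB hp hκ hβ hz hz h0 h1 ?_ ?_ le_rfl ?_ ?_
  · linarith
  · rw [pow_succ]; linarith
  · rw [pow_succ]; linarith
  · rw [dist_self]; exact h0.le

lemma tendsto_ballAverage {f : E → ℝ} (hf : IntegrableOn f (Metric.closedBall 0 R) ν)
    (hB : holderEnergy ν p κ (Metric.closedBall 0 R) f ≠ ∞)
    (hp : 1 ≤ p) (hκ : 0 ≤ κ) (hβ : κ = β * p + 2 * Module.finrank ℝ E) (hβ0 : 0 < β) {z : E}
    (hz : ‖z‖ + 1 ≤ R) :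
    Tendsto (fun k : ℕ => ballAverage ν f z (2⁻¹ ^ k)) atTop (𝓝 (limitAverage ν f z)) :=
  (cauchySeq_of_le_geometric _ _ (inv_two_rpow_lt_one hβ0)
    (dist_ballAverage_succ_le hf hB hp hκ hβ hz)).tendsto_limUnder

/-- The numerical factor in the Hölder estimate of the limits of averages. -/
noncomputable def holderFactor (β : ℝ) : ℝ := 2 ^ β * (1 + 2 / (1 - (2⁻¹ : ℝ) ^ β))

lemma holderFactor_nonneg (hβ : 0 < β) : 0 ≤ holderFactor β := by
  have := sub_pos.2 (inv_two_rpow_lt_one hβ)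
  unfold holderFactor
  positivity

lemma dist_limitAverage_le {f : E → ℝ} (hf : IntegrableOn f (Metric.closedBall 0 R) ν)
    (hB : holderEnergy ν p κ (Metric.closedBall 0 R) f ≠ ∞)
    (hp : 1 ≤ p) (hκ : 0 ≤ κ) (hβ : κ = β * p + 2 * Module.finrank ℝ E) (hβ0 : 0 < β) {z z' : E}
    (hz : ‖z‖ + 1 ≤ R) (hz' : ‖z'‖ + 1 ≤ R) (hzz : dist z z' ≤ 1) :
    dist (limitAverage ν f z) (limitAverage ν f z') ≤
      holderFactor β * energyBound ν p κ R f * dist z z' ^ β := by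
  rcases eq_or_ne z z' with rfl | hne
  · simp [Real.zero_rpow hβ0.ne']
  set q : ℝ := (2⁻¹ : ℝ) ^ β with hq
  set N := energyBound ν p κ R f with hN
  have hN0 : 0 ≤ N := ENNReal.toReal_nonneg
  have hq1 : 0 < 1 - q := sub_pos.2 (inv_two_rpow_lt_one hβ0)
  -- The scale `2^{-k}` is comparable to the distance. The limits are reached from it by geometric
  -- series, and the two averages are compared at this scale.
  obtain ⟨k, hk1, hk2⟩ := exists_nat_pow_near_of_lt_one (dist_pos.2 hne) hzz
    (by norm_num : (0 : ℝ) < 2⁻¹) (by norm_num)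
  have h1 : ∀ z : E, ‖z‖ + 1 ≤ R →
      dist (ballAverage ν f z (2⁻¹ ^ k)) (limitAverage ν f z) ≤ N * q ^ k / (1 - q) :=
    fun z hz => dist_le_of_le_geometric_of_tendsto _ _ (inv_two_rpow_lt_one hβ0)
      (dist_ballAverage_succ_le hf hB hp hκ hβ hz) (tendsto_ballAverage hf hB hp hκ hβ hβ0 hz) k
  have h0 : 0 < (2⁻¹ : ℝ) ^ k := by positivity
  have h2 : dist (ballAverage ν f z (2⁻¹ ^ k)) (ballAverage ν f z' (2⁻¹ ^ k)) ≤ N * q ^ k := by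
    rw [hq, ← inv_two_pow_rpow]
    exact dist_ballAverage_le hf hB hp hκ hβ hz hz' h0 (pow_le_one₀ (by norm_num) (by norm_num))
      (by linarith) (by linarith) le_rfl le_rfl hk2
  have h3 : q ^ k ≤ 2 ^ β * dist z z' ^ β := by
    rw [hq, ← inv_two_pow_rpow, ← Real.mul_rpow (by norm_num) dist_nonneg]
    refine Real.rpow_le_rpow h0.le ?_ hβ0.le
    rw [pow_succ] at hk1
    linarith
  have h4 := dist_triangle4 (limitAverage ν f z) (ballAverage ν f z (2⁻¹ ^ k))
    (ballAverage ν f z' (2⁻¹ ^ k)) (limitAverage ν f z')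
  rw [dist_comm (limitAverage ν f z) (ballAverage ν f z (2⁻¹ ^ k))] at h4
  calc dist (limitAverage ν f z) (limitAverage ν f z')
      ≤ N * q ^ k / (1 - q) + N * q ^ k + N * q ^ k / (1 - q) := by
        linarith [h1 z hz, h1 z' hz']
    _ = N * (1 + 2 / (1 - q)) * q ^ k := by ring
    _ ≤ N * (1 + 2 / (1 - q)) * (2 ^ β * dist z z' ^ β) := by gcongr
    _ = _ := by unfold holderFactor; ring

lemma tendsto_ballAverage_of_continuous {f : E → ℝ} (hf : Continuous f) (z : E) :
    Tendsto (fun k : ℕ => ballAverage ν f z (2⁻¹ ^ k)) atTop (𝓝 (f z)) := by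
  rw [Metric.tendsto_atTop]
  intro ε hε
  obtain ⟨δ, hδ, hfδ⟩ := Metric.continuous_iff.1 hf z (ε / 2) (half_pos hε)
  obtain ⟨n, hn⟩ := exists_pow_lt_of_lt_one hδ (by norm_num : (2⁻¹ : ℝ) < 1)
  refine ⟨n, fun k hk => ?_⟩
  have h0 : 0 < (2⁻¹ : ℝ) ^ k := by positivity
  have hlt : (2⁻¹ : ℝ) ^ k < δ :=
    (pow_le_pow_of_le_one (by norm_num) (by norm_num) hk).trans_lt hn
  have hp := isProbabilityMeasure_ballMeasure (ν := ν) z h0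
  have hint : IntegrableOn f (Metric.closedBall z (2⁻¹ ^ k)) ν :=
    hf.continuousOn.integrableOn_compact (isCompact_closedBall _ _)
  have e : ballAverage ν f z (2⁻¹ ^ k) - f z =
      ∫ w, (f w - f z) ∂(ballMeasure ν z (2⁻¹ ^ k)) := by
    rw [integral_sub (integrable_ballMeasure h0 hint) (integrable_const _), integral_const, probReal_univ,
      one_smul]
    rfl
  rw [dist_eq_norm, e]
  have := norm_integral_le_of_norm_le_const (μ := ballMeasure ν z (2⁻¹ ^ k))
    (f := fun w => f w - f z) (C := ε / 2) (by
      filter_upwards [ae_ballMeasure_mem (ν := ν) z (2⁻¹ ^ k)] with w hw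
      exact (hfδ w (lt_of_le_of_lt hw hlt)).le)
  simp only [measureReal_def, measure_univ, ENNReal.toReal_one, mul_one] at this
  linarith

lemma limitAverage_of_continuous {f : E → ℝ} (hf : Continuous f) (z : E) :
    limitAverage ν f z = f z :=
  (tendsto_ballAverage_of_continuous hf z).limUnder_eq

/-- Garsia–Rodemich–Rumsey type inequality. -/
lemma dist_le_of_holderEnergy {f : E → ℝ} (hf : Continuous f)
    (hB : holderEnergy ν p κ (Metric.closedBall 0 R) f ≠ ∞)
    (hp : 1 ≤ p) (hκ : 0 ≤ κ) (hβ : κ = β * p + 2 * Module.finrank ℝ E) (hβ0 : 0 < β) {z z' : E}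
    (hz : ‖z‖ + 1 ≤ R) (hz' : ‖z'‖ + 1 ≤ R) (hzz : dist z z' ≤ 1) :
    dist (f z) (f z') ≤ holderFactor β * energyBound ν p κ R f * dist z z' ^ β := by
  have h := dist_limitAverage_le (hf.continuousOn.integrableOn_compact
    (isCompact_closedBall _ _)) hB hp hκ hβ hβ0 hz hz' hzz
  rwa [limitAverage_of_continuous hf, limitAverage_of_continuous hf] at h

end LimitAverage

/-! ### Continuous modifications. -/

section Kolmogorov

set_option linter.unusedSectionVars false

variable {E : Type*} [NormedAddCommGroup E] [NormedSpace ℝ E] [MeasurableSpace E] [BorelSpace E]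
  [FiniteDimensional ℝ E] {ν : Measure E} [ν.IsAddHaarMeasure] {p κ β R : ℝ}
  {Ω : Type*} [MeasurableSpace Ω] {P : Measure Ω} [IsProbabilityMeasure P] {v : E → Ω → ℝ}
  {C M : ℝ≥0∞}

lemma measurable_energy_integrand [SecondCountableTopology E]
    (hv : Measurable (Function.uncurry v)) :
    Measurable fun q : (Ω × E) × E => ‖v q.1.2 q.1.1 - v q.2 q.1.1‖ₑ ^ p / edist q.1.2 q.2 ^ κ := by
  have h1 : Measurable fun q : (Ω × E) × E => v q.1.2 q.1.1 :=
    hv.comp (by fun_prop : Measurable fun q : (Ω × E) × E => (q.1.2, q.1.1))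
  have h2 : Measurable fun q : (Ω × E) × E => v q.2 q.1.1 :=
    hv.comp (by fun_prop : Measurable fun q : (Ω × E) × E => (q.2, q.1.1))
  have h3 : Measurable fun q : (Ω × E) × E => edist q.1.2 q.2 :=
    (measurable_snd.comp measurable_fst).edist measurable_snd
  exact ((h1.sub h2).enorm.pow_const p).div (h3.pow_const κ)

lemma measurable_holderEnergy [SecondCountableTopology E] [SFinite ν]
    (hv : Measurable (Function.uncurry v)) (S : Set E) :
    Measurable fun ω => holderEnergy ν p κ S (fun z => v z ω) := by
  have h1 := (measurable_energy_integrand (p := p) (κ := κ) hv).lintegral_prod_right'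
    (ν := ν.restrict S)
  exact h1.lintegral_prod_right' (ν := ν.restrict S)

/-- By Tonelli the moment bound cancels the denominator `edist z z' ^ κ`, so no singularity is left
to integrate. -/
lemma lintegral_holderEnergy_le [SecondCountableTopology E] [SFinite ν]
    (hv : Measurable (Function.uncurry v))
    (hK : ∀ z z', ∫⁻ ω, ‖v z ω - v z' ω‖ₑ ^ p ∂P ≤ C * edist z z' ^ κ) (S : Set E) :
    ∫⁻ ω, holderEnergy ν p κ S (fun z => v z ω) ∂P ≤ C * ν S * ν S := by
  have hm := measurable_energy_integrand (p := p) (κ := κ) hv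
  unfold holderEnergy
  have h1 := hm.lintegral_prod_right' (ν := ν.restrict S)
  rw [lintegral_lintegral_swap h1.aemeasurable]
  have h2 : ∀ z, ∫⁻ ω, ∫⁻ z' in S, ‖v z ω - v z' ω‖ₑ ^ p / edist z z' ^ κ ∂ν ∂P ≤ C * ν S := by
    intro z
    have hm2 : Measurable fun q : Ω × E => ‖v z q.1 - v q.2 q.1‖ₑ ^ p / edist z q.2 ^ κ :=
      hm.comp (by fun_prop : Measurable fun q : Ω × E => ((q.1, z), q.2))
    rw [lintegral_lintegral_swap hm2.aemeasurable]
    refine (lintegral_mono (g := fun _ => C) fun z' => ?_).trans_eq (by simp)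
    have hm3 : Measurable fun ω => ‖v z ω - v z' ω‖ₑ ^ p :=
      ((hv.comp (measurable_const.prodMk measurable_id)).sub
        (hv.comp (measurable_const.prodMk measurable_id))).enorm.pow_const p
    simp only [div_eq_mul_inv]
    rw [lintegral_mul_const _ hm3]
    calc _ ≤ C * edist z z' ^ κ * (edist z z' ^ κ)⁻¹ := by gcongr; exact hK z z'
      _ = C * (edist z z' ^ κ / edist z z' ^ κ) := by rw [mul_assoc, div_eq_mul_inv]
      _ ≤ C * 1 := by gcongr; exact ENNReal.div_self_le_one
      _ = C := mul_one C
  refine (lintegral_mono h2).trans_eq ?_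
  simp

/-- Kolmogorov's continuity theorem. -/
lemma exists_continuous_modification [SecondCountableTopology E] [SFinite ν]
    (hv : Measurable (Function.uncurry v))
    (hK : ∀ z z', ∫⁻ ω, ‖v z ω - v z' ω‖ₑ ^ p ∂P ≤ C * edist z z' ^ κ) (hC : C ≠ ∞)
    (hM : ∀ z, ∫⁻ ω, ‖v z ω‖ₑ ∂P ≤ M) (hM' : M ≠ ∞)
    (hp : 1 ≤ p) (hκ : 0 ≤ κ) (hβ : κ = β * p + 2 * Module.finrank ℝ E) (hβ0 : 0 < β) :
    ∃ V : E → Ω → ℝ, (∀ ω, Continuous fun z => V z ω) ∧ (∀ z, Measurable (V z)) ∧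
      ∀ z, V z =ᵐ[P] v z := by
  classical
  have hvz : ∀ z, Measurable (v z) := fun z => hv.comp (measurable_const.prodMk measurable_id)
  have hvω : ∀ ω, Measurable fun z => v z ω := fun ω =>
    hv.comp (measurable_id.prodMk measurable_const)
  have hvs : Measurable fun q : Ω × E => v q.2 q.1 := hv.comp measurable_swap
  set B : ℕ → Set E := fun n => Metric.closedBall 0 n with hBdef
  have hBfin : ∀ n, ν (B n) ≠ ∞ := fun n => measure_closedBall_lt_top.ne
  -- The measurable event of probability one on which all averages converge. Off it the modification
  -- is set to `0`, so that every path is continuous.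
  set G : Set Ω := {ω | ∀ n : ℕ, holderEnergy ν p κ (B n) (fun z => v z ω) < ∞ ∧
    ∫⁻ z in B n, ‖v z ω‖ₑ ∂ν < ∞} with hG
  have hmI : ∀ n, Measurable fun ω => ∫⁻ z in B n, ‖v z ω‖ₑ ∂ν := fun n =>
    hvs.enorm.lintegral_prod_right' (ν := ν.restrict (B n))
  have hGm : MeasurableSet G := by
    simp only [hG, Set.ofPred_forall, Set.ofPred_and]
    exact MeasurableSet.iInter fun n =>
      (measurableSet_lt (measurable_holderEnergy hv (B n)) measurable_const).inter
        (measurableSet_lt (hmI n) measurable_const)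
  have hGae : ∀ᵐ ω ∂P, ω ∈ G := by
    simp only [hG, mem_ofPred_eq]
    rw [ae_all_iff]
    intro n
    have h1 : ∀ᵐ ω ∂P, holderEnergy ν p κ (B n) (fun z => v z ω) < ∞ :=
      ae_lt_top (measurable_holderEnergy hv (B n)) ((lintegral_holderEnergy_le hv hK (B n)).trans_lt
        (ENNReal.mul_lt_top (ENNReal.mul_lt_top hC.lt_top (hBfin n).lt_top)
          (hBfin n).lt_top)).ne
    have h2 : ∀ᵐ ω ∂P, ∫⁻ z in B n, ‖v z ω‖ₑ ∂ν < ∞ := by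
      refine ae_lt_top (hmI n) ?_
      rw [lintegral_lintegral_swap hvs.enorm.aemeasurable]
      refine ((lintegral_mono (g := fun _ => M) hM).trans_lt ?_).ne
      rw [lintegral_const, Measure.restrict_apply_univ]
      exact ENNReal.mul_lt_top hM'.lt_top (hBfin n).lt_top
    exact h1.and h2
  have hint : ∀ ω ∈ G, ∀ n : ℕ, IntegrableOn (fun z => v z ω) (Metric.closedBall 0 (n : ℝ)) ν :=
    fun ω hω n => ⟨(hvω ω).aestronglyMeasurable, by
      rw [hasFiniteIntegral_iff_enorm]; exact (hω n).2⟩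
  have hlim : ∀ ω ∈ G, ∀ z, Tendsto (fun k : ℕ => ballAverage ν (fun z => v z ω) z (2⁻¹ ^ k))
      atTop (𝓝 (limitAverage ν (fun z => v z ω) z)) := by
    intro ω hω z
    obtain ⟨n, hn⟩ := exists_nat_ge (‖z‖ + 1)
    exact tendsto_ballAverage (hint ω hω n) (hω n).1.ne hp hκ hβ hβ0 hn
  have hAm : ∀ z r, Measurable fun ω => ballAverage ν (fun z => v z ω) z r := by
    intro z r
    have h : Measurable fun ω => ∫ w in Metric.closedBall z r, v w ω ∂ν :=
      (hvs.stronglyMeasurable.integral_prod_right' (ν :=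
        ν.restrict (Metric.closedBall z r))).measurable
    simp only [ballAverage, integral_smul_measure, smul_eq_mul]
    exact h.const_mul _
  set V : E → Ω → ℝ := fun z ω => if ω ∈ G then limitAverage ν (fun z => v z ω) z else 0 with hV
  refine ⟨V, fun ω => ?_, fun z => ?_, fun z => ?_⟩
  · by_cases hω : ω ∈ G
    · simp only [hV, hω, if_true]
      rw [continuous_iff_continuousAt]
      intro z₀
      obtain ⟨n, hn⟩ := exists_nat_ge (‖z₀‖ + 2)
      rw [ContinuousAt, tendsto_iff_dist_tendsto_zero]
      set H := holderFactor β * energyBound ν p κ n (fun z => v z ω) with hH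
      have h1 : Tendsto (fun z => H * dist z z₀ ^ β) (𝓝 z₀) (𝓝 0) := by
        have h2 : Tendsto (fun z => dist z z₀) (𝓝 z₀) (𝓝 0) := by
          have := (continuous_id.dist continuous_const : Continuous fun z => dist z z₀).tendsto z₀
          simpa using this
        have h3 := (h2.rpow_const (p := β) (Or.inr hβ0.le)).const_mul H
        rwa [Real.zero_rpow hβ0.ne', mul_zero] at h3
      refine squeeze_zero' (Eventually.of_forall fun _ => dist_nonneg) ?_ h1
      filter_upwards [Metric.closedBall_mem_nhds z₀ one_pos] with z hz
      have hz' : dist z z₀ ≤ 1 := hz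
      have hzn : ‖z‖ ≤ ‖z₀‖ + 1 := by
        have := norm_le_norm_add_norm_sub' z z₀
        rw [dist_eq_norm] at hz'
        linarith
      exact dist_limitAverage_le (hint ω hω n) (hω n).1.ne hp hκ hβ hβ0 (by linarith)
        (by linarith) hz'
    · simp only [hV, hω, if_false]
      exact continuous_const
  · refine measurable_of_tendsto_metrizable (f := fun (k : ℕ) ω => if ω ∈ G then
      ballAverage ν (fun z => v z ω) z (2⁻¹ ^ k) else 0)
      (fun k => Measurable.ite hGm (hAm z _) measurable_const) ?_
    rw [tendsto_pi_nhds]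
    intro ω
    by_cases hω : ω ∈ G
    · simpa only [hV, hω, if_true] using hlim ω hω z
    · simp only [hV, hω, if_false]
      exact tendsto_const_nhds
  -- The averages tend to `V z` almost surely and to `v z` in `L¹(P)`; Fatou's lemma identifies the
  -- two.
  · have h1 : ∫⁻ ω, ‖V z ω - v z ω‖ₑ ∂P = 0 := by
      have hVω : ∀ᵐ ω ∂P, ‖V z ω - v z ω‖ₑ = liminf (fun k : ℕ =>
          ‖ballAverage ν (fun z => v z ω) z (2⁻¹ ^ k) - v z ω‖ₑ) atTop := by
        filter_upwards [hGae] with ω hω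
        simp only [hV, hω, if_true]
        exact (((continuous_enorm.tendsto _).comp
          ((hlim ω hω z).sub tendsto_const_nhds)).liminf_eq).symm
      rw [lintegral_congr_ae hVω]
      refine le_antisymm ((lintegral_liminf_le fun k =>
        ((hAm z _).sub (hvz z)).enorm).trans ?_) zero_le
      have hbound : ∀ k : ℕ, ∫⁻ ω, ‖ballAverage ν (fun z => v z ω) z (2⁻¹ ^ k) - v z ω‖ₑ ∂P ≤
          ENNReal.ofReal (((2⁻¹ : ℝ) ^ β) ^ k) * (1 + C) := by
        intro k
        have h0 : 0 < (2⁻¹ : ℝ) ^ k := by positivity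
        have hpm := isProbabilityMeasure_ballMeasure (ν := ν) z h0
        obtain ⟨n, hn⟩ := exists_nat_ge (‖z‖ + 1)
        have hsub : Metric.closedBall z (2⁻¹ ^ k) ⊆ Metric.closedBall 0 (n : ℝ) := by
          refine Metric.closedBall_subset_closedBall' ?_
          rw [dist_zero_right]
          have : (2⁻¹ : ℝ) ^ k ≤ 1 := pow_le_one₀ (by norm_num) (by norm_num)
          linarith
        have h2 : ∀ᵐ ω ∂P, ‖ballAverage ν (fun z => v z ω) z (2⁻¹ ^ k) - v z ω‖ₑ ≤
            ∫⁻ w, ‖v w ω - v z ω‖ₑ ∂(ballMeasure ν z (2⁻¹ ^ k)) := by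
          filter_upwards [hGae] with ω hω
          exact enorm_ballAverage_sub_const_le h0 ((hint ω hω n).mono_set hsub) _
        refine (lintegral_mono_ae h2).trans ?_
        have hm : Measurable fun q : Ω × E => ‖v q.2 q.1 - v z q.1‖ₑ :=
          (hvs.sub ((hvz z).comp measurable_fst)).enorm
        rw [lintegral_lintegral_swap hm.aemeasurable]
        set σ : ℝ≥0∞ := ENNReal.ofReal (2⁻¹ ^ k) with hσ
        have hσ0 : σ ≠ 0 := by simp [hσ]
        have hσt : σ ≠ ∞ := ENNReal.ofReal_ne_top
        have hσ1 : σ ≤ 1 := by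
          rw [hσ, ← ENNReal.ofReal_one]
          exact ENNReal.ofReal_le_ofReal (pow_le_one₀ (by norm_num) (by norm_num))
        have e0 : ENNReal.ofReal (((2⁻¹ : ℝ) ^ β) ^ k) = σ ^ β := by
          rw [← inv_two_pow_rpow, hσ, ENNReal.ofReal_rpow_of_pos h0]
        have hε0 : σ ^ β ≠ 0 := by simp [ENNReal.rpow_eq_zero_iff, hσ0, hσt]
        have hεt : σ ^ β ≠ ∞ := ENNReal.rpow_ne_top_of_ne_zero hσ0 hσt
        have hεpt : (σ ^ β) ^ (1 - p) ≠ ∞ := ENNReal.rpow_ne_top_of_ne_zero hε0 hεt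
        refine (lintegral_mono_ae (g := fun _ => σ ^ β * (1 + C)) ?_).trans_eq ?_
        · filter_upwards [ae_ballMeasure_mem (ν := ν) z (2⁻¹ ^ k)] with w hw
          have hd : edist w z ≤ σ := by
            rw [edist_dist]; exact ENNReal.ofReal_le_ofReal hw
          calc ∫⁻ ω, ‖v w ω - v z ω‖ₑ ∂P
              ≤ ∫⁻ ω, (σ ^ β + (σ ^ β) ^ (1 - p) * ‖v w ω - v z ω‖ₑ ^ p) ∂P :=
                lintegral_mono fun ω => le_add_rpow_mul hε0 hεt hp
            _ = σ ^ β + (σ ^ β) ^ (1 - p) * ∫⁻ ω, ‖v w ω - v z ω‖ₑ ^ p ∂P := by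
                rw [lintegral_add_left measurable_const, lintegral_const, measure_univ, mul_one,
                  lintegral_const_mul' _ _ hεpt]
            _ ≤ σ ^ β + (σ ^ β) ^ (1 - p) * (C * σ ^ κ) := by
                gcongr
                exact (hK w z).trans (by gcongr)
            _ = σ ^ β + σ ^ (β * (1 - p)) * σ ^ κ * C := by rw [← ENNReal.rpow_mul]; ring
            _ ≤ σ ^ β + σ ^ β * C := by
                gcongr
                rw [← ENNReal.rpow_add _ _ hσ0 hσt]
                -- The exponent `β(1-p) + κ` is `β + 2 dim E`, at least `β`, and `σ ≤ 1`.
                refine ENNReal.rpow_le_rpow_of_exponent_ge hσ1 ?_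
                rw [hβ]
                have : (0 : ℝ) ≤ 2 * Module.finrank ℝ E := by positivity
                linarith
            _ = σ ^ β * (1 + C) := by ring
        · rw [lintegral_const, measure_univ, mul_one, e0]
      have hto : Tendsto (fun k : ℕ => ENNReal.ofReal (((2⁻¹ : ℝ) ^ β) ^ k) * (1 + C)) atTop
          (𝓝 0) := by
        have h3 := tendsto_pow_atTop_nhds_zero_of_lt_one (by positivity : 0 ≤ (2⁻¹ : ℝ) ^ β)
          (inv_two_rpow_lt_one hβ0)
        have h4 := ENNReal.Tendsto.mul_const (b := 1 + C) (ENNReal.tendsto_ofReal h3)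
          (Or.inr (ENNReal.add_ne_top.2 ⟨ENNReal.one_ne_top, hC⟩))
        simpa using h4
      rw [← hto.liminf_eq]
      exact liminf_le_liminf (Eventually.of_forall hbound)
    have hVm : AEMeasurable (fun ω => ‖V z ω - v z ω‖ₑ) P := by
      have hlimae : AEMeasurable (V z) P := by
        refine aemeasurable_of_tendsto_metrizable_ae atTop (fun k : ℕ =>
          (hAm z (2⁻¹ ^ k)).aemeasurable) ?_
        filter_upwards [hGae] with ω hω
        simpa only [hV, hω, if_true] using hlim ω hω z
      exact (hlimae.sub (hvz z).aemeasurable).enorm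
    rw [lintegral_eq_zero_iff' hVm] at h1
    filter_upwards [h1] with ω hω
    have : V z ω - v z ω = 0 := by simpa using hω
    linarith

end Kolmogorov

/-! ### Measurability, compactness and tightness in spaces of continuous functions. -/

section ContinuousPaths

variable {X : Type*} {Ω : Type*} [MeasurableSpace Ω]

/-- A random continuous function is measurable as soon as its values are. -/
lemma measurable_continuousMap_of_apply [TopologicalSpace X] [SecondCountableTopology X]
    [LocallyCompactSpace X] [MeasurableSpace C(X, ℝ)] [BorelSpace C(X, ℝ)] {U : Ω → C(X, ℝ)}
    (h : ∀ x, Measurable fun ω => U ω x) : Measurable U := by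
  rw [BorelSpace.measurable_eq (α := C(X, ℝ)),
    borel_eq_generateFrom_of_subbasis ContinuousMap.compactOpen_eq]
  refine measurable_generateFrom ?_
  rintro _ ⟨K, hK, O, hO, rfl⟩
  have hK : IsCompact K := hK
  have hO : IsOpen O := hO
  obtain ⟨D, hDc, hDd⟩ := TopologicalSpace.exists_countable_dense K
  -- By compactness, mapping `K` into `O` means staying at distance at least some `1/n` from the
  -- complement, and a countable dense subset of `K` tests this. For `n = 0` the bound is `∞`, which
  -- is harmless.
  have key : U ⁻¹' {f | MapsTo f K O} = ⋃ n : ℕ, ⋂ x ∈ D,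
      {ω | (n : ℝ≥0∞)⁻¹ ≤ Metric.infEDist (U ω x) Oᶜ} := by
    ext ω
    simp only [mem_preimage, mem_ofPred_eq, mem_iUnion, mem_iInter]
    have hcont : Continuous fun x => Metric.infEDist (U ω x) Oᶜ :=
      Metric.continuous_infEDist.comp (U ω).continuous
    constructor
    · intro hmap
      rcases K.eq_empty_or_nonempty with rfl | hne
      · exact ⟨0, fun x => x.2.elim⟩
      obtain ⟨x₀, hx₀, hmin⟩ := hK.exists_isMinOn hne hcont.continuousOn
      have hpos : Metric.infEDist (U ω x₀) Oᶜ ≠ 0 := fun h0 =>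
        (Metric.mem_iff_infEDist_zero_of_closed hO.isClosed_compl).2 h0 (hmap hx₀)
      obtain ⟨n, hn⟩ := ENNReal.exists_inv_nat_lt hpos
      exact ⟨n, fun x _ => hn.le.trans (hmin x.2)⟩
    · rintro ⟨n, hn⟩ x hx
      have hcl : IsClosed {x : K | (n : ℝ≥0∞)⁻¹ ≤ Metric.infEDist (U ω x) Oᶜ} :=
        isClosed_le continuous_const (hcont.comp continuous_subtype_val)
      have hmem : (⟨x, hx⟩ : K) ∈ {x : K | (n : ℝ≥0∞)⁻¹ ≤ Metric.infEDist (U ω x) Oᶜ} :=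
        closure_minimal (fun y hy => hn y hy) hcl (hDd ⟨x, hx⟩)
      by_contra hxO
      have h0 := Metric.infEDist_zero_of_mem (s := Oᶜ) hxO
      rw [mem_ofPred_eq, h0] at hmem
      simp at hmem
  rw [key]
  exact MeasurableSet.iUnion fun n => MeasurableSet.biInter hDc fun x _ =>
    measurableSet_le measurable_const (Metric.continuous_infEDist.measurable.comp (h x))

/-- Functions which are uniformly Hölder continuous on the sets `B j` and bounded at the points
`x i`. -/
def holderSet [PseudoMetricSpace X] (β : ℝ) (x : ℕ → X) (A : ℕ → ℝ) (B : ℕ → Set X) (H : ℕ → ℝ) :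
    Set C(X, ℝ) :=
  {g | (∀ i, |g (x i)| ≤ A i) ∧ ∀ j, ∀ y ∈ B j, ∀ y' ∈ B j, dist y y' ≤ 1 →
    dist (g y) (g y') ≤ H j * dist y y' ^ β}

/-- Arzelà–Ascoli. Bounds at the dense points spread to every point through the local Hölder
estimates, which also give equicontinuity and survive pointwise limits. -/
lemma isCompact_holderSet [PseudoMetricSpace X] {β : ℝ} (hβ : 0 < β) {x : ℕ → X}
    (hx : DenseRange x) {A : ℕ → ℝ} {B : ℕ → Set X} (hB : ∀ y, ∃ j, B j ∈ 𝓝 y) {H : ℕ → ℝ}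
    (hH : ∀ j, 0 ≤ H j) :
    IsCompact (holderSet β x A B H) := by
  have hbound : ∀ y, ∃ R : ℝ, ∀ g ∈ holderSet β x A B H, |g y| ≤ R := by
    intro y
    obtain ⟨j, hj⟩ := hB y
    obtain ⟨i, hi⟩ := hx.exists_mem_open isOpen_interior
      ⟨y, mem_interior_iff_mem_nhds.2 (inter_mem hj (Metric.closedBall_mem_nhds y one_pos))⟩
    have hi := interior_subset hi
    refine ⟨A i + H j, fun g hg => ?_⟩
    have h1 := hg.2 j _ hi.1 y (mem_of_mem_nhds hj) hi.2
    have h2 : H j * dist (x i) y ^ β ≤ H j * 1 := by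
      have := hH j
      gcongr
      exact Real.rpow_le_one dist_nonneg hi.2 hβ.le
    have h3 := hg.1 i
    rw [Real.dist_eq, abs_sub_comm] at h1
    have h4 := abs_sub_abs_le_abs_sub (g y) (g (x i))
    linarith
  choose R hR using hbound
  refine ArzelaAscoli.isCompact_of_equicontinuous _ ?_ ?_
  -- Continuity need not be imposed on the right, since the Hölder bounds force it. The image is
  -- thus a closed subset of a product of compact intervals.
  · have himage : ContinuousMap.toFun '' holderSet β x A B H =
        {f : X → ℝ | (∀ y, f y ∈ Icc (-R y) (R y)) ∧ (∀ i, |f (x i)| ≤ A i) ∧ ∀ j, ∀ y ∈ B j,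
          ∀ y' ∈ B j, dist y y' ≤ 1 → dist (f y) (f y') ≤ H j * dist y y' ^ β} := by
      ext f
      constructor
      · rintro ⟨g, hg, rfl⟩
        exact ⟨fun y => abs_le.1 (hR y g hg), hg⟩
      · rintro ⟨-, h1, h2⟩
        have hc : Continuous f := by
          rw [continuous_iff_continuousAt]
          intro y
          obtain ⟨j, hj⟩ := hB y
          rw [ContinuousAt, tendsto_iff_dist_tendsto_zero]
          have h3 : Tendsto (fun z => dist z y) (𝓝 y) (𝓝 0) := by
            simpa using (continuous_id.dist continuous_const : Continuous fun z => dist z y).tendsto y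
          have h4 := (h3.rpow_const (p := β) (Or.inr hβ.le)).const_mul (H j)
          rw [Real.zero_rpow hβ.ne', mul_zero] at h4
          refine squeeze_zero' (Eventually.of_forall fun _ => dist_nonneg) ?_ h4
          filter_upwards [hj, Metric.closedBall_mem_nhds y one_pos] with z hz hz'
          exact h2 j z hz y (mem_of_mem_nhds hj) hz'
        exact ⟨⟨f, hc⟩, ⟨h1, h2⟩, rfl⟩
    rw [himage]
    refine (isCompact_pi_infinite fun y => isCompact_Icc (a := -R y) (b := R y)).inter_right ?_
    change IsClosed {f : X → ℝ | _ ∧ _}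
    simp only [Set.ofPred_and, Set.ofPred_forall]
    refine IsClosed.inter (isClosed_iInter fun i => isClosed_le (by fun_prop) continuous_const)
      (isClosed_iInter fun j => isClosed_iInter fun y => isClosed_iInter fun _ =>
        isClosed_iInter fun y' => isClosed_iInter fun _ => isClosed_iInter fun _ =>
        isClosed_le ?_ continuous_const)
    exact (continuous_apply y).dist (continuous_apply y')
  · intro y
    rw [Metric.equicontinuousAt_iff_right]
    intro ε hε
    obtain ⟨j, hj⟩ := hB y
    have h3 : Tendsto (fun z => dist y z) (𝓝 y) (𝓝 0) := by
      simpa using (continuous_const.dist continuous_id : Continuous fun z => dist y z).tendsto y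
    have h4 := (h3.rpow_const (p := β) (Or.inr hβ.le)).const_mul (H j)
    rw [Real.zero_rpow hβ.ne', mul_zero] at h4
    filter_upwards [hj, Metric.closedBall_mem_nhds y one_pos, h4.eventually (gt_mem_nhds hε)]
      with z hz hz' hlt g
    exact (g.2.2 j y (mem_of_mem_nhds hj) z hz (by rwa [dist_comm])).trans_lt hlt

/-- Markov's inequality. The level is chosen before `f`, hence serves all indices `n` at once. -/
lemma exists_level {P : Measure Ω} {B : ℝ≥0∞} (hB : B ≠ ∞) {ε : ℝ≥0} (hε : 0 < ε) :
    ∃ A : ℝ≥0, ∀ f : Ω → ℝ≥0∞, Measurable f → ∫⁻ ω, f ω ∂P ≤ B → P {ω | A < f ω} ≤ ε := by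
  lift B to ℝ≥0 using hB
  refine ⟨(B + 1) / ε, fun f hf h => ?_⟩
  have hpos : (((B + 1) / ε : ℝ≥0) : ℝ≥0∞) ≠ 0 := by
    have : 0 < (B + 1) / ε := by positivity
    exact_mod_cast this.ne'
  have h1 := (mul_meas_ge_le_lintegral₀ (μ := P) hf.aemeasurable
    (((B + 1) / ε : ℝ≥0) : ℝ≥0∞)).trans h
  have h2 : (B : ℝ≥0∞) ≤ (((B + 1) / ε : ℝ≥0) : ℝ≥0∞) * ε := by
    rw [← ENNReal.coe_mul, div_mul_cancel₀ _ hε.ne']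
    exact_mod_cast le_self_add
  have h3 : P {ω | (((B + 1) / ε : ℝ≥0) : ℝ≥0∞) < f ω} ≤
      P {ω | (((B + 1) / ε : ℝ≥0) : ℝ≥0∞) ≤ f ω} :=
    measure_mono fun ω hω => le_of_lt (mem_ofPred_eq ▸ hω)
  exact h3.trans ((ENNReal.mul_le_mul_iff_right hpos ENNReal.coe_ne_top).1 (h1.trans h2))

variable {E : Type*} [NormedAddCommGroup E] [NormedSpace ℝ E] [MeasurableSpace E] [BorelSpace E]
  [FiniteDimensional ℝ E] [SecondCountableTopology E] {p κ β : ℝ} {P : Measure Ω} [IsProbabilityMeasure P] {C M : ℝ≥0∞}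

/-- Kolmogorov's tightness criterion. -/
theorem isTightMeasureSet_of_moments (ν : Measure E) [ν.IsAddHaarMeasure] [SFinite ν] [MetricSpace X] [SecondCountableTopology X]
    [LocallyCompactSpace X] [MeasurableSpace C(X, ℝ)] [BorelSpace C(X, ℝ)] [Nonempty X]
    {j : X → E} (hj : Isometry j) {π : E → X} (hπ : Continuous π)
    (hπj : Function.LeftInverse π j) {κ' : Type*} {U : κ' → Ω → C(X, ℝ)}
    (hU : ∀ n, Measurable (U n))
    (hK : ∀ n z z', ∫⁻ ω, ‖U n ω (π z) - U n ω (π z')‖ₑ ^ p ∂P ≤ C * edist z z' ^ κ) (hC : C ≠ ∞)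
    (hM : ∀ n x, ∫⁻ ω, ‖U n ω x‖ₑ ∂P ≤ M) (hM' : M ≠ ∞)
    (hp : 1 ≤ p) (hκ : 0 ≤ κ) (hβ : κ = β * p + 2 * Module.finrank ℝ E) (hβ0 : 0 < β) :
    IsTightMeasureSet (range fun n => P.map (U n)) := by
  rw [isTightMeasureSet_iff_exists_isCompact_measure_compl_le]
  intro ε hε
  -- The summable budget `ε/2` is spent twice: on the values at a dense sequence and on the energies
  -- over balls of integer radius.
  obtain ⟨δ, hδ, hδε⟩ := ENNReal.exists_pos_sum_of_countable (ENNReal.half_pos hε.ne').ne' ℕ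
  set S : ℕ → Set E := fun k => Metric.closedBall 0 k with hS
  have hSfin : ∀ k, C * ν (S k) * ν (S k) ≠ ∞ := fun k =>
    ENNReal.mul_ne_top (ENNReal.mul_ne_top hC measure_closedBall_lt_top.ne)
      measure_closedBall_lt_top.ne
  choose A hA using fun i => exists_level (P := P) hM' (hδ i)
  choose e he using fun k => exists_level (P := P) (hSfin k) (hδ k)
  set x := TopologicalSpace.denseSeq X
  have hUx : ∀ n y, Measurable fun ω => U n ω y := fun n y =>
    (continuous_eval_const y).measurable.comp (hU n)
  -- Paths are extended to the whole vector space along the retraction `π`, since the energy is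
  -- integrated over balls there; `j` transports the estimate back.
  have hUu : ∀ n, Measurable (Function.uncurry fun z ω => U n ω (π z)) := fun n =>
    measurable_uncurry_of_continuous_of_measurable (fun ω => (U n ω).continuous.comp hπ)
      fun z => hUx n (π z)
  have hNtop : ∀ k, 1 + averageConst ν κ * (e k : ℝ≥0∞) ≠ ∞ := fun k =>
    ENNReal.add_ne_top.2 ⟨ENNReal.one_ne_top,
      ENNReal.mul_ne_top (averageConst_ne_top hκ) ENNReal.coe_ne_top⟩
  set H : ℕ → ℝ := fun k => holderFactor β * (1 + averageConst ν κ * (e k : ℝ≥0∞)).toReal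
  have hH : ∀ k, 0 ≤ H k := fun k => mul_nonneg (holderFactor_nonneg hβ0) ENNReal.toReal_nonneg
  set B : ℕ → Set X := fun k => {y | ‖j y‖ + 1 ≤ k}
  have hB : ∀ y, ∃ k, B k ∈ 𝓝 y := fun y => by
    obtain ⟨k, hk⟩ := exists_nat_gt (‖j y‖ + 1)
    exact ⟨k, ((hj.continuous.norm.add continuous_const).tendsto y).eventually_le_const hk⟩
  have hcomp := isCompact_holderSet hβ0 (TopologicalSpace.denseRange_denseSeq X)
    (A := fun i => A i) hB hH
  refine ⟨_, hcomp, ?_⟩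
  rintro _ ⟨n, rfl⟩
  rw [Measure.map_apply (hU n) hcomp.isClosed.measurableSet.compl]
  have hsub : U n ⁻¹' (holderSet β x (fun i => A i) B H)ᶜ ⊆
      (⋃ i, {ω | (A i : ℝ≥0∞) < ‖U n ω (x i)‖ₑ}) ∪
        ⋃ k, {ω | (e k : ℝ≥0∞) < holderEnergy ν p κ (S k) fun z => U n ω (π z)} := by
    intro ω hω
    by_contra hno
    simp only [mem_union, mem_iUnion, mem_ofPred_eq, not_or, not_exists, not_lt] at hno
    refine hω ⟨fun i => ?_, fun k y hy y' hy' hyy => ?_⟩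
    · have h1 := hno.1 i
      rw [enorm_eq_nnnorm, ENNReal.coe_le_coe] at h1
      exact_mod_cast h1
    · have h2 := dist_le_of_holderEnergy (ν := ν) ((U n ω).continuous.comp hπ)
        (lt_of_le_of_lt (hno.2 k) ENNReal.coe_lt_top).ne hp hκ hβ hβ0 (z := j y) (z' := j y') hy hy'
        (by rwa [hj.dist_eq])
      simp only [Function.comp_apply, hπj y, hπj y', hj.dist_eq] at h2
      refine h2.trans ?_
      have h3 : energyBound ν p κ k (U n ω ∘ π) ≤
          (1 + averageConst ν κ * (e k : ℝ≥0∞)).toReal := by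
        refine ENNReal.toReal_mono (hNtop k) ?_
        gcongr
        exact hno.2 k
      have := holderFactor_nonneg hβ0
      simp only [H]
      gcongr
  calc P (U n ⁻¹' (holderSet β x (fun i => A i) B H)ᶜ)
      ≤ ∑' i, P {ω | (A i : ℝ≥0∞) < ‖U n ω (x i)‖ₑ} +
        ∑' k, P {ω | (e k : ℝ≥0∞) < holderEnergy ν p κ (S k) fun z => U n ω (π z)} :=
        (measure_mono hsub).trans ((measure_union_le _ _).trans
          (add_le_add (measure_iUnion_le _) (measure_iUnion_le _)))
    _ ≤ ∑' i, (δ i : ℝ≥0∞) + ∑' k, (δ k : ℝ≥0∞) := by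
        refine add_le_add (ENNReal.tsum_le_tsum fun i => hA i _ (hUx n _).enorm (hM n _))
          (ENNReal.tsum_le_tsum fun k => he k _ (measurable_holderEnergy (hUu n) _)
            (lintegral_holderEnergy_le (hUu n) (hK n) _))
    _ ≤ ε / 2 + ε / 2 := add_le_add hδε.le hδε.le
    _ = ε := ENNReal.add_halves ε

end ContinuousPaths

/-! ### Uniform moment bounds for the forcing and for the solutions. -/

section Forcing

set_option linter.unusedSectionVars false

variable {d : ℕ} {Ω : Type*} [MeasurableSpace Ω] {P : Measure Ω} [IsProbabilityMeasure P]
  {μ : Measure (Space d)} {W : SpaceTimeTest d → Ω → ℝ} {b : ℝ → ℝ} {u₀ : Space d → ℝ} {T : ℝ}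
  {u : ℝ → Space d → Ω → ℝ} {q δ M r : ℝ} {K : ℝ≥0∞} {L α C : ℝ≥0} {p : ℝ≥0}

lemma rpow_le_rpow_of_le_one {h ρ γ : ℝ} (h0 : 0 ≤ h) (hρ : h ≤ ρ) (hρ1 : ρ ≤ 1) (hδ : 0 ≤ δ)
    (hγ : δ ≤ γ) : h ^ γ ≤ ρ ^ δ :=
  (Real.rpow_le_rpow h0 hρ (hδ.trans hγ)).trans
    (Real.rpow_le_rpow_of_exponent_ge' (h0.trans hρ) hρ1 hδ hγ)

/-- The spectral estimates bound squared norms: an increment `y ≤ η²` there gives a factor `η` in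
the norm, with `η = ρ^δ`. -/
lemma rpow_half_mul_le {c c' y η : ℝ} {k : ℝ≥0∞} (hc : 0 ≤ c) (hcc : c ≤ c') (hη : 0 ≤ η)
    (hy : y ≤ η ^ 2) (hk : k ≤ K) :
    (ENNReal.ofReal (c * y) * k) ^ (1 / 2 : ℝ) ≤
      (ENNReal.ofReal c' * K) ^ (1 / 2 : ℝ) * ENNReal.ofReal η := by
  have h1 : ENNReal.ofReal (c * y) * k ≤ ENNReal.ofReal c' * K * ENNReal.ofReal η ^ (2 : ℝ) := by
    calc ENNReal.ofReal (c * y) * k ≤ ENNReal.ofReal (c' * η ^ 2) * K := by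
          gcongr ENNReal.ofReal ?_ * ?_
          exact (mul_le_mul_of_nonneg_left hy hc).trans
            (mul_le_mul_of_nonneg_right hcc (sq_nonneg η))
      _ = ENNReal.ofReal c' * K * ENNReal.ofReal η ^ (2 : ℝ) := by
          rw [ENNReal.ofReal_mul (hc.trans hcc), ENNReal.rpow_two, ENNReal.ofReal_pow hη]
          ring
  refine (ENNReal.rpow_le_rpow h1 (by norm_num)).trans_eq ?_
  rw [ENNReal.mul_rpow_of_nonneg _ _ (by norm_num), ← ENNReal.rpow_mul]
  norm_num

lemma DualBound.lintegral_le {f : Ω → ℝ≥0∞} {a : ℝ≥0∞} (h : DualBound P r f a) :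
    ∫⁻ ω, f ω ∂P ≤ a := by
  have := h (fun _ => 1) measurable_const ⟨1, fun _ => by simp⟩
  simpa using this

lemma DualBound.const_add (hp : p ≠ 0) (hpr : (p : ℝ).HolderConjugate r) {X : Ω → ℝ} {c : ℝ}
    {C' a' a : ℝ≥0∞} (hX : AEStronglyMeasurable X P) (hc : ‖c‖ₑ ≤ C') (ha : eLpNorm X p P ≤ a')
    (h : C' + a' ≤ a) : DualBound P r (fun ω => ‖c + X ω‖ₑ) a :=
  ((DualBound.const hpr C').add (DualBound.of_eLpNorm_le hp hpr hX ha) aemeasurable_const).mono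
    (ae_of_all _ fun ω => (enorm_add_le _ _).trans (by gcongr)) h

lemma enorm_le_ofReal {c C' : ℝ} (h : |c| ≤ C') : ‖c‖ₑ ≤ ENNReal.ofReal C' := by
  rw [Real.enorm_eq_ofReal_abs]
  exact ENNReal.ofReal_le_ofReal h

/-- Bounds of the size and of the increments of the forcing term of the mild equation, uniform in
the noise. -/
lemma exists_dualBound_forcing (P : Measure Ω) [IsProbabilityMeasure P] (hT : 0 < T)
    (hM : ∀ x, |u₀ x| ≤ M) (hα₀ : 0 < α)
    (hα₁ : α < 1) (hu₀ : HolderWith C α u₀) (hq : 0 < q) (hq2 : q < 2) (hK : K ≠ ∞)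
    (hδ : 0 ≤ δ) (hδα : δ ≤ α / 2) (hδq : δ ≤ (2 - q) / 4) (hp : p ≠ 0)
    (hpr : (p : ℝ).HolderConjugate r) :
    ∃ a : ℝ≥0∞, a ≠ ∞ ∧ ∀ (μ : Measure (Space d)) (W : SpaceTimeTest d → Ω → ℝ)
      (I : ℝ → Space d → Ω → ℝ), IsHomogeneousNoise P μ W → spectralWeight q μ ≤ K →
      (∀ t ∈ Icc 0 T, ∀ x, IsWienerIntegral P μ W (heatIntegrand t x) (I t x)) →
      (∀ t ∈ Icc 0 T, ∀ x, DualBound P r (fun ω => ‖heatInitial u₀ t x + I t x ω‖ₑ) a) ∧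
      (∀ ρ, 0 ≤ ρ → ρ ≤ 1 → ∀ k, ‖k‖ ≤ ρ → ∀ t ∈ Icc 0 T, ∀ x, DualBound P r
        (fun ω => ‖heatInitial u₀ t (x + k) + I t (x + k) ω - (heatInitial u₀ t x + I t x ω)‖ₑ)
        (a * ENNReal.ofReal (ρ ^ δ))) ∧
      (∀ ρ, 0 ≤ ρ → ρ ≤ 1 → ∀ h, 0 ≤ h → h ≤ ρ → ∀ t ∈ Icc 0 (T - h), ∀ x, DualBound P r
        (fun ω => ‖heatInitial u₀ (t + h) x + I (t + h) x ω - (heatInitial u₀ t x + I t x ω)‖ₑ)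
        (a * ENNReal.ofReal (ρ ^ δ))) := by
  obtain ⟨K₀, hK₀, hspace, htime⟩ := exists_heatInitial_holder hM hα₀ hα₁ hu₀
  -- The constant `8(T+1)` is the largest of those in the size, space and time estimates.
  set N : ℝ≥0∞ := gaussianMomentRatio p * (ENNReal.ofReal (8 * (T + 1)) * K) ^ (1 / 2 : ℝ) with hN
  have hNtop : N ≠ ∞ := ENNReal.mul_ne_top (gaussianMomentRatio_ne_top p)
    (ENNReal.rpow_ne_top_of_nonneg (by norm_num) (ENNReal.mul_ne_top ENNReal.ofReal_ne_top hK))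
  refine ⟨ENNReal.ofReal M + ENNReal.ofReal K₀ + N, by finiteness, fun μ W I hW hμ hI => ?_⟩
  have hμ' : spectralWeight q μ < ∞ := hμ.trans_lt hK.lt_top
  have hα' : (0 : ℝ) < α := hα₀
  refine ⟨fun t ht x => ?_, fun ρ hρ0 hρ1 k hk t ht x => ?_, fun ρ hρ0 hρ1 h hh0 hh t ht x => ?_⟩
  · refine DualBound.const_add (C' := ENNReal.ofReal M) (a' := N) hp hpr
      (hI t ht x).2.1.aestronglyMeasurable (enorm_le_ofReal (abs_heatInitial_le hM ht.1 x)) ?_ ?_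
    · refine ((hI t ht x).eLpNorm_le hW hq hq2 hμ'
        (stronglyMeasurable_sliceFourier_heatIntegrand t x) p).trans ?_
      rw [hN]
      refine mul_le_mul_right ((eLpNorm_heatIntegrand_le hq hq2 hμ' ht.1 ht.2 x).trans ?_) _
      have := ht.1.trans ht.2
      gcongr
      norm_num
    · gcongr
      exact le_self_add
  · have hη : 0 ≤ ρ ^ δ := Real.rpow_nonneg hρ0 _
    have h1 := hI t ht (x + k)
    have h2 := hI t ht x
    have key : DualBound P r (fun ω => ‖(heatInitial u₀ t (x + k) - heatInitial u₀ t x) +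
        (I t (x + k) ω - I t x ω)‖ₑ)
        ((ENNReal.ofReal M + ENNReal.ofReal K₀ + N) * ENNReal.ofReal (ρ ^ δ)) := by
      refine DualBound.const_add (C' := ENNReal.ofReal (K₀ * ρ ^ δ))
        (a' := N * ENNReal.ofReal (ρ ^ δ)) hp hpr
        (h1.2.1.aestronglyMeasurable.sub h2.2.1.aestronglyMeasurable) (enorm_le_ofReal ?_) ?_ ?_
      · refine (hspace t ht.1 x k).trans ?_
        gcongr
        exact rpow_le_rpow_of_le_one (norm_nonneg _) hk hρ1 hδ (by linarith)
      · refine (h1.eLpNorm_sub_le hW hq hq2 hμ' h2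
          (stronglyMeasurable_sliceFourier_heatIntegrand t _)
          (stronglyMeasurable_sliceFourier_heatIntegrand t x) p).trans ?_
        rw [hN, mul_assoc]
        refine mul_le_mul_right ((eLpNorm_heatIntegrand_space_le hq hq2 hμ' ht.1 ht.2 _ x).trans
          (rpow_half_mul_le (by linarith) le_rfl hη ?_ hμ)) _
        rw [add_sub_cancel_left, ← Real.rpow_natCast, ← Real.rpow_mul hρ0]
        exact rpow_le_rpow_of_le_one (norm_nonneg _) hk hρ1 (by positivity)
          (by push_cast; linarith)
      · rw [ENNReal.ofReal_mul hK₀, add_mul, add_mul]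
        gcongr
        exact le_add_self
    refine key.mono (ae_of_all _ fun ω => le_of_eq ?_) le_rfl
    congr 1; ring
  · have hη : 0 ≤ ρ ^ δ := Real.rpow_nonneg hρ0 _
    have h1 := hI (t + h) ⟨by linarith [ht.1], by linarith [ht.2]⟩ x
    have h2 := hI t ⟨ht.1, by linarith [ht.2]⟩ x
    have key : DualBound P r (fun ω => ‖(heatInitial u₀ (t + h) x - heatInitial u₀ t x) +
        (I (t + h) x ω - I t x ω)‖ₑ)
        ((ENNReal.ofReal M + ENNReal.ofReal K₀ + N) * ENNReal.ofReal (ρ ^ δ)) := by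
      refine DualBound.const_add (C' := ENNReal.ofReal (K₀ * ρ ^ δ))
        (a' := N * ENNReal.ofReal (ρ ^ δ)) hp hpr
        (h1.2.1.aestronglyMeasurable.sub h2.2.1.aestronglyMeasurable) (enorm_le_ofReal ?_) ?_ ?_
      · refine (htime t ht.1 h hh0 x).trans ?_
        gcongr
        exact rpow_le_rpow_of_le_one hh0 hh hρ1 hδ hδα
      · refine (h1.eLpNorm_sub_le hW hq hq2 hμ' h2
          (stronglyMeasurable_sliceFourier_heatIntegrand _ x)
          (stronglyMeasurable_sliceFourier_heatIntegrand t x) p).trans ?_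
        rw [hN, mul_assoc]
        refine mul_le_mul_right ((eLpNorm_heatIntegrand_time_le hq hq2 hμ' ht.1 hh0
          (T := T) (by linarith [ht.2]) x).trans
          (rpow_half_mul_le (by linarith) (by linarith) hη ?_ hμ)) _
        rw [← Real.rpow_natCast, ← Real.rpow_mul hρ0]
        -- Here `2δ ≤ (2-q)/2` is needed: time increments are what impose `δ ≤ (2-q)/4`.
        exact rpow_le_rpow_of_le_one hh0 hh hρ1 (by positivity) (by push_cast; linarith)
      · rw [ENNReal.ofReal_mul hK₀, add_mul, add_mul]
        gcongr
        exact le_add_self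
    refine key.mono (ae_of_all _ fun ω => le_of_eq ?_) le_rfl
    congr 1; ring

/-- The field `u`, extended to all times by its values at the end points. -/
noncomputable def clampTime (hT : 0 ≤ T) (u : ℝ → Space d → Ω → ℝ) (z : ℝ × Space d) (ω : Ω) : ℝ :=
  u (projIcc 0 T hT z.1) z.2 ω

lemma clampTime_of_mem (hT : 0 ≤ T) {t : ℝ} (ht : t ∈ Icc 0 T) (x : Space d) :
    clampTime hT u (t, x) = u t x := by
  ext ω
  simp [clampTime, projIcc_of_mem hT ht]

lemma clampTime_eq (hT : 0 ≤ T) (z : ℝ × Space d) :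
    clampTime hT u z = clampTime hT u ((projIcc 0 T hT z.1 : ℝ), z.2) := by
  rw [clampTime_of_mem hT (projIcc 0 T hT z.1).2]
  rfl

lemma IsMildHeatSolution.measurable_clampTime (hT : 0 ≤ T)
    (hu : IsMildHeatSolution P μ W b u₀ T u) :
    Measurable (Function.uncurry (clampTime hT u)) := by
  have h : Measurable fun z : (ℝ × Space d) × Ω => (projIcc 0 T hT z.1.1, z.1.2, z.2) :=
    (continuous_projIcc.measurable.comp (measurable_fst.comp measurable_fst)).prodMk
      ((measurable_snd.comp measurable_fst).prodMk measurable_snd)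
  exact hu.jointly_measurable.comp h

/-- The drift up to `t` sees only times in `[0,t]`, so clamping leaves the equation unchanged while
making the field jointly measurable on all of `ℝ × ℝ^d`. -/
lemma IsMildHeatSolution.exists_isPerturbedMild (hT : 0 ≤ T)
    (hu : IsMildHeatSolution P μ W b u₀ T u) :
    ∃ (m : ℝ≥0∞) (I : ℝ → Space d → Ω → ℝ),
      (∀ t ∈ Icc 0 T, ∀ x, IsWienerIntegral P μ W (heatIntegrand t x) (I t x)) ∧
      IsPerturbedMild P b T m (fun t x ω => heatInitial u₀ t x + I t x ω)
        (fun t x => clampTime hT u (t, x)) := by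
  obtain ⟨m, hm⟩ := hu.bounded_moments
  have hmeas := hu.measurable_clampTime hT
  choose! I hI hmild using hu.mild
  refine ⟨m, I, hI, hmeas, ENNReal.coe_ne_top, fun t ht x => ?_, fun t ht x => ?_⟩
  · have hmt : Measurable (u t x) := by
      rw [← clampTime_of_mem (u := u) hT ht x]
      exact hmeas.comp (measurable_const.prodMk measurable_id)
    rw [clampTime_of_mem hT ht, ← eLpNorm_one_eq_lintegral_enorm]
    exact (eLpNorm_le_eLpNorm_of_exponent_le one_le_two hmt.aestronglyMeasurable).trans (hm t ht x)
  · filter_upwards [hmild t ht x] with ω hω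
    rw [clampTime_of_mem hT ht, hω]
    congr 1
    unfold heatDrift
    refine intervalIntegral.integral_congr fun s hs => ?_
    rw [uIcc_of_le ht.1] at hs
    have hs' : s ∈ Icc 0 T := ⟨hs.1, hs.2.trans ht.2⟩
    simp only [clampTime_of_mem hT hs']

/-- Bounds of the size and of the increments of the solutions, uniform in the noise. -/
lemma exists_dualBound_solution (P : Measure Ω) [IsProbabilityMeasure P] (hT : 0 < T)
    (hb : LipschitzWith L b) (hM : ∀ x, |u₀ x| ≤ M)
    (hα₀ : 0 < α) (hα₁ : α < 1) (hu₀ : HolderWith C α u₀) (hq : 0 < q) (hq2 : q < 2) (hK : K ≠ ∞)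
    (hδ : 0 ≤ δ) (hδα : δ ≤ α / 2) (hδq : δ ≤ (2 - q) / 4) (hp : p ≠ 0)
    (hpr : (p : ℝ).HolderConjugate r) :
    ∃ D : ℝ≥0∞, D ≠ ∞ ∧ ∀ (μ : Measure (Space d)) (W : SpaceTimeTest d → Ω → ℝ)
      (u : ℝ → Space d → Ω → ℝ), IsHomogeneousNoise P μ W → spectralWeight q μ ≤ K →
      IsMildHeatSolution P μ W b u₀ T u →
      (∀ z, DualBound P r (fun ω => ‖clampTime hT.le u z ω‖ₑ) D) ∧
      ∀ z z', DualBound P r (fun ω => ‖clampTime hT.le u z ω - clampTime hT.le u z' ω‖ₑ)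
        (D * edist z z' ^ δ) := by
  obtain ⟨a, ha, hforce⟩ := exists_dualBound_forcing (d := d) P hT hM hα₀ hα₁ hu₀ hq hq2 hK hδ hδα
    hδq hp hpr
  set g := gronwallConst L T with hg
  have hgtop : g ≠ ∞ := by rw [hg]; unfold gronwallConst; finiteness
  -- `A₁` bounds the size of `u`, `A₂` that of `b(u)`, and `B` the increments in time and space
  -- together.
  set A₁ := g * (‖b 0‖ₑ * ENNReal.ofReal T + a) with hA₁
  set A₂ := ‖b 0‖ₑ + L * A₁ with hA₂
  set B := g * (A₂ + a) + g * a with hB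
  refine ⟨(A₁ + A₁) + B, ?_, fun μ W u hW hμ hu => ?_⟩
  · have h0 : ‖b 0‖ₑ ≠ ∞ := enorm_ne_top
    simp only [hB, hA₂, hA₁]
    finiteness
  obtain ⟨m, I, hI, hpm⟩ := hu.exists_isPerturbedMild hT.le
  obtain ⟨hsize, hspace, htime⟩ := hforce μ W I hW hμ hI
  have h1 : ∀ z, DualBound P r (fun ω => ‖clampTime hT.le u z ω‖ₑ) A₁ := fun z => by
    rw [clampTime_eq hT.le]
    exact hpm.dualBound hb hpr hsize (projIcc 0 T hT.le z.1).2 z.2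
  have hmz : ∀ z, Measurable (clampTime hT.le u z) := fun z =>
    (hu.measurable_clampTime hT.le).comp (measurable_const.prodMk measurable_id)
  have h2 : ∀ t ∈ Icc 0 T, ∀ x, DualBound P r (fun ω => ‖b (clampTime hT.le u (t, x) ω)‖ₑ) A₂ :=
    fun t ht x => ((DualBound.const hpr ‖b 0‖ₑ).add ((h1 (t, x)).const_mul
      (ENNReal.coe_ne_top (r := L))) aemeasurable_const).mono
      (ae_of_all _ fun ω => enorm_lipschitz_le hb _) le_rfl
  -- From `(t,x)` the path goes to `(t,x')` in space, then to `(t',x')` in time.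
  have hinc : ∀ ρ, 0 ≤ ρ → ρ ≤ 1 → ∀ t ∈ Icc 0 T, ∀ t' ∈ Icc 0 T, t ≤ t' → t' - t ≤ ρ →
      ∀ x x' : Space d, ‖x' - x‖ ≤ ρ → DualBound P r
        (fun ω => ‖clampTime hT.le u (t', x') ω - clampTime hT.le u (t, x) ω‖ₑ)
        (B * ENNReal.ofReal (ρ ^ δ)) := by
    intro ρ hρ0 hρ1 t ht t' ht' htt hρt x x' hρx
    have hh : 0 ≤ t' - t := sub_nonneg.2 htt
    have e1 := hpm.dualBound_time hb hh h2 (htime ρ hρ0 hρ1 _ hh hρt) (t := t)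
      ⟨ht.1, by linarith [ht'.2]⟩ x'
    have e2 := hpm.dualBound_space hb (x' - x) (hspace ρ hρ0 hρ1 _ hρx) ht x
    simp only [add_sub_cancel] at e1 e2
    refine (e1.add e2 ((hmz _).sub (hmz _)).enorm.aemeasurable).mono (ae_of_all _ fun ω => ?_) ?_
    · refine le_trans (le_of_eq ?_) (enorm_add_le _ _)
      congr 1; ring
    · have hle : ENNReal.ofReal (t' - t) ≤ ENNReal.ofReal (ρ ^ δ) := by
        refine ENNReal.ofReal_le_ofReal ?_
        have := rpow_le_rpow_of_le_one (γ := 1) hh hρt hρ1 hδ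
          (by have : (α : ℝ) < 1 := hα₁
              linarith)
        rwa [Real.rpow_one] at this
      calc g * (A₂ * ENNReal.ofReal (t' - t) + a * ENNReal.ofReal (ρ ^ δ)) +
            g * (a * ENNReal.ofReal (ρ ^ δ))
          ≤ g * (A₂ * ENNReal.ofReal (ρ ^ δ) + a * ENNReal.ofReal (ρ ^ δ)) +
            g * (a * ENNReal.ofReal (ρ ^ δ)) := by gcongr
        _ = B * ENNReal.ofReal (ρ ^ δ) := by rw [hB]; ring
  refine ⟨fun z => (h1 z).mono (ae_of_all _ fun _ => le_rfl) (by
    rw [add_assoc]; exact le_self_add), fun z z' => ?_⟩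
  -- For distances above one the size bound is enough; below one, clamping does not increase
  -- distances.
  rcases le_total (dist z z') 1 with hzz | hzz
  · have hd1 : dist (projIcc 0 T hT.le z.1 : ℝ) (projIcc 0 T hT.le z'.1) ≤ dist z z' :=
      ((LipschitzWith.projIcc hT.le).dist_le_mul _ _).trans (by
        rw [NNReal.coe_one, one_mul]; exact le_max_left _ _)
    have hd2 : dist z.2 z'.2 ≤ dist z z' := le_max_right _ _
    have he : ENNReal.ofReal (dist z z' ^ δ) = edist z z' ^ δ := by
      rw [edist_dist, ENNReal.ofReal_rpow_of_nonneg dist_nonneg hδ]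
    rw [clampTime_eq hT.le z, clampTime_eq hT.le z', ← he]
    have hBle : B * ENNReal.ofReal (dist z z' ^ δ) ≤
        (A₁ + A₁ + B) * ENNReal.ofReal (dist z z' ^ δ) := by
      gcongr; exact le_add_self
    rcases le_total (projIcc 0 T hT.le z.1 : ℝ) (projIcc 0 T hT.le z'.1) with hle | hle
    · refine (hinc _ dist_nonneg hzz _ (projIcc 0 T hT.le z.1).2 _ (projIcc 0 T hT.le z'.1).2 hle ?_
        z.2 z'.2 ?_).mono (ae_of_all _ fun ω => ?_) hBle
      · rw [dist_comm, Real.dist_eq] at hd1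
        exact (le_abs_self _).trans hd1
      · rwa [dist_comm, dist_eq_norm] at hd2
      · rw [enorm_sub_rev]
    · refine (hinc _ dist_nonneg hzz _ (projIcc 0 T hT.le z'.1).2 _ (projIcc 0 T hT.le z.1).2 hle ?_
        z'.2 z.2 ?_).mono (ae_of_all _ fun ω => le_rfl) hBle
      · rw [Real.dist_eq] at hd1
        exact (le_abs_self _).trans hd1
      · rwa [dist_eq_norm] at hd2
  · refine ((h1 z).add (h1 z') (hmz z).enorm.aemeasurable).mono
      (ae_of_all _ fun ω => enorm_sub_le) ?_
    have h1e : (1 : ℝ≥0∞) ≤ edist z z' ^ δ := by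
      refine (ENNReal.one_rpow δ).symm.trans_le (ENNReal.rpow_le_rpow ?_ hδ)
      rw [edist_dist, ← ENNReal.ofReal_one]
      exact ENNReal.ofReal_le_ofReal hzz
    calc A₁ + A₁ ≤ (A₁ + A₁ + B) * 1 := by rw [mul_one]; exact le_self_add
      _ ≤ _ := by gcongr

end Forcing

/-! ### Choice of exponents and conclusion. -/

section Assembly

instance isAddHaarMeasure_volume_space_time (d : ℕ) :
    (volume : Measure (ℝ × Space d)).IsAddHaarMeasure :=
  inferInstanceAs ((volume.prod volume : Measure (ℝ × Space d)).IsAddHaarMeasure)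

/-- The nearest point of `[0,T] × ℝ^d`. -/
noncomputable def clampPoint {d : ℕ} {T : ℝ} (hT : 0 ≤ T) (z : ℝ × Space d) :
    Icc (0 : ℝ) T × Space d :=
  (projIcc 0 T hT z.1, z.2)

lemma continuous_clampPoint {d : ℕ} {T : ℝ} (hT : 0 ≤ T) :
    Continuous (clampPoint (d := d) hT) :=
  (continuous_projIcc.comp continuous_fst).prodMk continuous_snd

lemma isometry_coe_prod (d : ℕ) (T : ℝ) :
    Isometry fun z : Icc (0 : ℝ) T × Space d => ((z.1 : ℝ), z.2) := fun z z' => by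
  simp only [Prod.edist_eq, Subtype.edist_eq]

lemma leftInverse_clampPoint {d : ℕ} {T : ℝ} (hT : 0 ≤ T) :
    Function.LeftInverse (clampPoint hT)
      fun z : Icc (0 : ℝ) T × Space d => ((z.1 : ℝ), z.2) := fun z => by
  simp [clampPoint]

lemma IsContinuousVersion.ae_clampPoint_eq {d : ℕ} {Ω : Type*} [MeasurableSpace Ω] {P : Measure Ω}
    {T : ℝ} (hT : 0 ≤ T) {u : ℝ → Space d → Ω → ℝ} {U : Ω → PathSpace T d}
    (hU : IsContinuousVersion P T u U) (z : ℝ × Space d) :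
    ∀ᵐ ω ∂P, U ω (clampPoint hT z) = clampTime hT u z ω :=
  hU.version (projIcc 0 T hT z.1) z.2

end Assembly

theorem proposition5p2 (d : ℕ) (hd : 1 ≤ d) (T : ℝ) (hT : 0 < T)
    {Ω : Type*} [MeasurableSpace Ω] (P : Measure Ω) [IsProbabilityMeasure P] [P.IsComplete]
    (μ : ℕ → Measure (Space d)) (W : ℕ → SpaceTimeTest d → Ω → ℝ)
    (hW : ∀ n, IsHomogeneousNoise P (μ n) (W n))
    (hμ : HypothesisH1 μ)
    (b : ℝ → ℝ) (hb : ∃ L : ℝ≥0, LipschitzWith L b)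
    (u₀ : Space d → ℝ) (hu₀_bdd : ∃ M : ℝ, ∀ x, |u₀ x| ≤ M)
    (α : ℝ≥0) (hα₀ : 0 < α) (hα₁ : α < 1) (hu₀ : ∃ C : ℝ≥0, HolderWith C α u₀)
    (u : ℕ → ℝ → Space d → Ω → ℝ)
    (hu : ∀ n, IsMildHeatSolution P (μ n) (W n) b u₀ T (u n)) :
    (∀ n, ∃ U : Ω → PathSpace T d, IsContinuousVersion P T (u n) U) ∧
      ∀ U : ℕ → Ω → PathSpace T d, (∀ n, IsContinuousVersion P T (u n) (U n)) →
        IsTightMeasureSet (range fun n => P.map (U n)) := by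
  obtain ⟨q, hq, hq2, hK⟩ := hμ
  obtain ⟨L, hL⟩ := hb
  obtain ⟨M, hM⟩ := hu₀_bdd
  obtain ⟨C, hC⟩ := hu₀
  have hα : (0 : ℝ) < α := hα₀
  obtain ⟨δ, hδ, hδα, hδq⟩ : ∃ δ : ℝ, 0 < δ ∧ δ ≤ α / 2 ∧ δ ≤ (2 - q) / 4 :=
    ⟨min (α / 2) ((2 - q) / 4), lt_min (by linarith) (by linarith), min_le_left _ _,
      min_le_right _ _⟩
  -- The space-time dimension is `d + 1`, and the energy estimate loses it twice; `p` is taken large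
  -- enough to leave `β > 0`.
  obtain ⟨p, hp1, hpδ⟩ : ∃ p : ℝ≥0, 1 < (p : ℝ) ∧ 2 * ((d : ℝ) + 1) < p * δ := by
    obtain ⟨k, hk⟩ := exists_nat_gt (2 * ((d : ℝ) + 1) / δ)
    refine ⟨k + 2, by push_cast; linarith [(Nat.cast_nonneg k : (0 : ℝ) ≤ k)], ?_⟩
    rw [div_lt_iff₀ hδ] at hk
    push_cast
    linarith
  have hp0 : (0 : ℝ) < p := by linarith
  have hp : p ≠ 0 := by
    rintro rfl
    simp at hp0
  obtain ⟨r, hpr⟩ : ∃ r, (p : ℝ).HolderConjugate r := ⟨_, Real.HolderConjugate.conjExponent hp1⟩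
  obtain ⟨D, hD, hbound⟩ := exists_dualBound_solution (d := d) P hT hL hM hα₀ hα₁ hC hq hq2 hK.ne
    hδ.le hδα hδq hp hpr
  have hsol := fun n => hbound (μ n) (W n) (u n) (hW n)
    (le_iSup (fun n => spectralWeight q (μ n)) n) (hu n)
  have hmeas := fun n => (hu n).measurable_clampTime hT.le
  have hmz : ∀ n z, Measurable (clampTime hT.le (u n) z) := fun n z =>
    (hmeas n).comp (measurable_const.prodMk measurable_id)
  have hM1 : ∀ n z, ∫⁻ ω, ‖clampTime hT.le (u n) z ω‖ₑ ∂P ≤ D := fun n z =>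
    ((hsol n).1 z).lintegral_le
  have hKp : ∀ n z z', ∫⁻ ω, ‖clampTime hT.le (u n) z ω - clampTime hT.le (u n) z' ω‖ₑ ^ (p : ℝ) ∂P
      ≤ D ^ (p : ℝ) * edist z z' ^ (p * δ) := fun n z z' => by
    refine (((hsol n).2 z z').lintegral_rpow_le hpr ((hmz n z).sub (hmz n z')).enorm).trans_eq ?_
    rw [ENNReal.mul_rpow_of_nonneg _ _ hp0.le, ← ENNReal.rpow_mul, mul_comm δ]
  have hDp : D ^ (p : ℝ) ≠ ∞ := ENNReal.rpow_ne_top_of_nonneg hp0.le hD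
  have hκ : 0 ≤ p * δ := by positivity
  have hrank : (Module.finrank ℝ (ℝ × Space d) : ℝ) = d + 1 := by simp [add_comm]
  set β : ℝ := δ - 2 * (d + 1) / p with hβdef
  have hβ : p * δ = β * p + 2 * Module.finrank ℝ (ℝ × Space d) := by
    rw [hrank, hβdef]
    field_simp
    ring
  have hβ0 : 0 < β := by
    rw [hβdef, sub_pos, div_lt_iff₀ hp0]
    linarith
  constructor
  · intro n
    obtain ⟨V, hVc, hVm, hV⟩ := exists_continuous_modification (ν := volume) (hmeas n) (hKp n) hDp
      (hM1 n) hD hp1.le hκ hβ hβ0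
    refine ⟨fun ω => ⟨fun z => V (z.1, z.2) ω, (hVc ω).comp (isometry_coe_prod d T).continuous⟩,
      measurable_continuousMap_of_apply fun z => hVm _, fun t x => ?_⟩
    filter_upwards [hV (t, x)] with ω hω
    rw [clampTime_of_mem hT.le t.2] at hω
    exact hω
  · intro U hU
    have : Nonempty (Icc (0 : ℝ) T × Space d) := ⟨(⟨0, le_rfl, hT.le⟩, 0)⟩
    refine isTightMeasureSet_of_moments (volume : Measure (ℝ × Space d)) (isometry_coe_prod d T)
      (continuous_clampPoint hT.le) (leftInverse_clampPoint hT.le) (fun n => (hU n).measurable)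
      (fun n z z' => ?_) hDp (M := D) (fun n x => ?_) hD hp1.le hκ hβ hβ0
    -- At fixed points any continuous version agrees almost surely with the field, hence inherits
    -- its moment bounds.
    · refine (lintegral_congr_ae ?_).trans_le (hKp n z z')
      filter_upwards [(hU n).ae_clampPoint_eq hT.le z, (hU n).ae_clampPoint_eq hT.le z']
        with ω h1 h2
      rw [h1, h2]
    · refine (lintegral_congr_ae ?_).trans_le (hM1 n (x.1, x.2))
      filter_upwards [(hU n).ae_clampPoint_eq hT.le (x.1, x.2)] with ω h1
      rw [← h1]
      exact congrArg (fun y => ‖U n ω y‖ₑ) (leftInverse_clampPoint hT.le x).symm
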